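/- **Definitions.** For $k\ge 0$ let $TW_k$ be the twin group, generated by $\sigma_1,\dots,\sigma_{k-1}$ with relations $\sigma_i^2=1$ for all $i$ and $\sigma_i\sigma_j=\sigma_j\sigma_i$ for $|i-j|>1$, and let $PTW_k$ be the kernel of the homomorphism $TW_k\to S_k$, $\sigma_i\mapsto(i\ \,i{+}1)$. A *small pure twin group on $k$ arcs* is a subgroup $\overline{PTW_k}$ of $PTW_k$ generated by finitely many elements $p^{(1)},\dots,p^{(\ell)}\in PTW_k$, each of which is reduced to $1$ by applying a Yang–Baxter relation $\sigma_i\sigma_{i+1}\sigma_i=\sigma_{i+1}\sigma_i\sigma_{i+1}$ exactly once, with the relations of $TW_k$ freely used. The lower central series of a group $G$ is $\operatorname{LCS}_1(G)=G$, $\operatorname{LCS}_{n+1}(G)=[G,\operatorname{LCS}_n(G)]$. A *link projection* is the image in $\mathbb R^2$ of a generic immersion of finitely many (at least one) disjoint circles, all of whose multiple points are transverse double points. A twin $x\in TW_k$ is pictured by $k$ arcs in $\mathbb R\times[0,1]$, monotone in the second coordinate: to a word in the $\sigma_i$ representing $x$ one stacks, letter by letter, configurations in which only the arcs in positions $i$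 and $i+1$ cross, exactly once. A *self-tangency modification* replaces, inside a disc, the picture of $\sigma_1\sigma_1$ on two arcs by that of the empty word, or conversely; a *triple-point modification* replaces, inside a disc, the picture of $\sigma_1\sigma_2\sigma_1$ on three arcs by that of $\sigma_2\sigma_1\sigma_2$, or conversely. A *rondle* is an equivalence class of link projections under compactly supported diffeomorphisms of $\mathbb R^2$ and self-tangency modifications. A *tangle projection* with $2k$ ends is the part of a link projection outside a disc in which the link projection is a picture of $k$ arcs; putting pictures of twins $x\in TW_k$ into that disc gives the rondles $T(x)$ (the *tangle map* $T$). Two rondles $C,C'$ *differ by* the twin $p\in TW_k$ if $C=T(x)$ and $C'=T(px)$ for some tangle map $T$ and some $x\in TW_k$. A *rondle invariant* is a map $f$ from the set of rondles to an abelian group. Its *order* with respect to triple-point modifications is the least integer $m\ge 0$ such that for every link projection $D$ with $m+1$ chosen pairwise disjoint triangles (places where a triple-point modification applies), numbered $1,\dots,m+1$, $$\sum_{s\subseteq\{1,\dots,m+1\}}(-1)^{|s|}f(D_s)=0,$$ where $D_s$ is obtained from $D$ by applying the triple-point modification at each triangle in $s$; the order is $\infty$ if there is no such $m$. **Theorem.**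 Let $n\ge 1$, let $\overline{PTW_k}$ be a small pure twin group on $k$ arcs, let $p\in\operatorname{LCS}_n(\overline{PTW_k})$, and let $C$ and $C'$ be two rondles that differ by the twin $p$. Let $f$ be a rondle invariant of order less than $n$ with respect to triple-point modifications. Then $f(C)=f(C')$. -/

import Mathlib

open scoped ContDiff Manifold

/-! ## Twin groups -/

/-- The defining relators of the twin group on `k` arcs; the generators `σ_1, …, σ_{k-1}` are
indexed from `0` by `Fin (k - 1)`. -/
def twinRels (k : ℕ) : Set (FreeGroup (Fin (k - 1))) :=
  {r | ∃ i, r = FreeGroup.of i ^ 2} ∪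
  {r | ∃ i j : Fin (k - 1), ((i : ℕ) + 1 < j ∨ (j : ℕ) + 1 < i) ∧
    r = FreeGroup.of i * FreeGroup.of j * (FreeGroup.of j * FreeGroup.of i)⁻¹}

/-- The twin group `TW_k`. -/
abbrev TwinGroup (k : ℕ) : Type := PresentedGroup (twinRels k)

/-- The standard generators of the twin group. -/
def twinGen {k : ℕ} (i : Fin (k - 1)) : TwinGroup k := PresentedGroup.of i

/-- The twin represented by a word in the generators.
Every twin is represented by such a word, because the generators are involutions. -/
def twinOfWord {k : ℕ} (w : List (Fin (k - 1))) : TwinGroup k := (w.map twinGen).prod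

/-- The `i`-th adjacent transposition of `{0, …, k - 1}`. -/
def adjSwap {k : ℕ} (i : Fin (k - 1)) : Equiv.Perm (Fin k) :=
  Equiv.swap ⟨i, by omega⟩ ⟨i + 1, by omega⟩

theorem adjSwap_rels (k : ℕ) : ∀ r ∈ twinRels k, FreeGroup.lift (adjSwap (k := k)) r = 1 := by
  rintro r (⟨i, rfl⟩ | ⟨i, j, hij, rfl⟩)
  · simp [adjSwap, pow_two]
  · have h : Equiv.Perm.Disjoint (adjSwap (k := k) i) (adjSwap j) := by
      intro x
      by_cases hx : x = ⟨i, by omega⟩ ∨ x = ⟨i + 1, by omega⟩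
      · right
        apply Equiv.swap_apply_of_ne_of_ne <;>
          (rcases hx with rfl | rfl <;> simp only [ne_eq, Fin.mk.injEq] <;> omega)
      · left
        push Not at hx
        exact Equiv.swap_apply_of_ne_of_ne hx.1 hx.2
    simp only [map_mul, map_inv, FreeGroup.lift_apply_of]
    rw [h.commute.eq, mul_inv_cancel]

/-- The natural homomorphism `TW_k → S_k`. -/
def twinPerm (k : ℕ) : TwinGroup k →* Equiv.Perm (Fin k) :=
  PresentedGroup.toGroup (adjSwap_rels k)

/-- The pure twin group `PTW_k`. -/
def pureTwinGroup (k : ℕ) : Subgroup (TwinGroup k) := (twinPerm k).ker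

/-- `YBStep x y`: the twin `y` arises from the twin `x` by one application of a Yang-Baxter relation
`σ_i σ_{i+1} σ_i = σ_{i+1} σ_i σ_{i+1}`, in either direction, to some word representing `x`
(the relations of the twin group are used freely, since `x` and `y` are elements of it). -/
def YBStep {k : ℕ} (x y : TwinGroup k) : Prop :=
  ∃ (g h : TwinGroup k) (i j : Fin (k - 1)), ((i : ℕ) + 1 = j ∨ (j : ℕ) + 1 = i) ∧
    x = g * (twinGen i * twinGen j * twinGen i) * h ∧
    y = g * (twinGen j * twinGen i * twinGen j) * h

/-- `H` is a small pure twin group on `k` arcs: it is generated by finitely many pure twins, each of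
which is reduced to `1` by applying a Yang-Baxter relation exactly once. -/
def IsSmallPureTwinGroup {k : ℕ} (H : Subgroup (TwinGroup k)) : Prop :=
  ∃ S : Set (TwinGroup k), S.Finite ∧ S ⊆ pureTwinGroup k ∧ (∀ p ∈ S, YBStep p 1) ∧
    H = Subgroup.closure S

/-! ## Link projections -/

/-- A generic immersion of `m` disjoint circles in the plane. The circles are `ℝ / ℤ`, so that each
component is a smooth `1`-periodic map on `ℝ` and the points of the source are the pairs in
`Fin m × [0, 1)`. All multiple points are transverse double points. -/
structure IsGenericImmersion {m : ℕ} (γ : Fin m → ℝ → ℝ × ℝ) : Prop where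
  smooth : ∀ i, ContDiff ℝ ∞ (γ i)
  periodic : ∀ i, Function.Periodic (γ i) 1
  immersion : ∀ i s, deriv (γ i) s ≠ 0
  transverse : ∀ a b : Fin m × Set.Ico (0 : ℝ) 1, a ≠ b → γ a.1 a.2 = γ b.1 b.2 →
    LinearIndependent ℝ ![deriv (γ a.1) a.2, deriv (γ b.1) b.2]
  no_triple : ∀ a b c : Fin m × Set.Ico (0 : ℝ) 1, a ≠ b → b ≠ c → a ≠ c →
    ¬ (γ a.1 a.2 = γ b.1 b.2 ∧ γ b.1 b.2 = γ c.1 c.2)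

/-- A link projection: the image of a generic immersion of finitely many (at least one) circles. -/
def LinkProjection : Type :=
  {D : Set (ℝ × ℝ) // ∃ (m : ℕ) (γ : Fin m → ℝ → ℝ × ℝ),
    0 < m ∧ IsGenericImmersion γ ∧ D = ⋃ i, Set.range (γ i)}

/-- Diffeomorphisms of the plane. -/
abbrev PlaneDiffeo : Type := (ℝ × ℝ) ≃ₘ[ℝ] (ℝ × ℝ)

/-- A diffeomorphism with compact support. -/
def HasCompactSupp (Φ : PlaneDiffeo) : Prop :=
  ∃ K : Set (ℝ × ℝ), IsCompact K ∧ ∀ z ∉ K, Φ z = z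

/-! ## Geometric realization of words by monotone arcs -/

/-- A smooth monotone function, `0` for `t ≤ 1/3` and `1` for `t ≥ 2/3`. -/
noncomputable def crossStep (t : ℝ) : ℝ := Real.smoothTransition (3 * t - 1)

/-- The configuration of `k` arcs in `ℝ × [0, 1]` which has exactly one double point, formed by the
arcs in adjacent positions `i` and `i + 1` (positions are counted from `0`; the `l`-th position has
abscissa `l + 1`). The other arcs are vertical. -/
def letterPic (k : ℕ) (i : Fin (k - 1)) : Set (ℝ × ℝ) :=
  {z | z.2 ∈ Set.Icc (0 : ℝ) 1 ∧
    ((∃ l : Fin k, (l : ℕ) ≠ i ∧ (l : ℕ) ≠ i + 1 ∧ z.1 = (l : ℝ) + 1) ∨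
      z.1 = (i : ℝ) + 1 + crossStep z.2 ∨ z.1 = (i : ℝ) + 2 - crossStep z.2)}

/-- The configuration of `k` vertical arcs. -/
def trivialPic (k : ℕ) : Set (ℝ × ℝ) :=
  {z | z.2 ∈ Set.Icc (0 : ℝ) 1 ∧ ∃ l : Fin k, z.1 = (l : ℝ) + 1}

open Classical in
/-- The configuration of `k` arcs in `ℝ × [0, 1]` represented by a word: the configurations of its
letters are stacked, the first one at the bottom, and the heights are rescaled to `[0, 1]`. -/
noncomputable def wordPic (k : ℕ) (w : List (Fin (k - 1))) : Set (ℝ × ℝ) :=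
  if w = [] then trivialPic k
  else ⋃ a : Fin w.length, {z | (z.1, w.length * z.2 - (a : ℝ)) ∈ letterPic k (w.get a)}

/-- A rectangle which contains the configurations of `k` arcs; these meet its boundary exactly in
their `2k` end points, near which they are vertical. -/
def twinBox (k : ℕ) : Set (ℝ × ℝ) := Set.Icc (1 / 2 : ℝ) (k + 1 / 2) ×ˢ Set.Icc (0 : ℝ) 1

/-- `IsFilling φ E w D`: the set `D` is the union of a set `E` outside the disc `φ (twinBox k)` and
of the configuration of the word `w`, placed in that disc by the diffeomorphism `φ`. -/
def IsFilling {k : ℕ} (φ : PlaneDiffeo) (E : Set (ℝ × ℝ)) (w : List (Fin (k - 1)))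
    (D : Set (ℝ × ℝ)) : Prop :=
  Disjoint E (φ '' twinBox k) ∧ D = E ∪ φ '' wordPic k w

/-! ## Rondles -/

/-- A self-tangency modification: in a disc, the configuration of `σ_1 σ_1` on two arcs (a bigon) is
replaced by that of the empty word (two disjoint arcs). -/
def SelfTangencyMove (D D' : LinkProjection) : Prop :=
  ∃ (φ : PlaneDiffeo) (E : Set (ℝ × ℝ)),
    IsFilling (k := 2) φ E [⟨0, by decide⟩, ⟨0, by decide⟩] D.1 ∧ IsFilling (k := 2) φ E [] D'.1

/-- The elementary moves which generate the equivalence of link projections. -/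
def RondleMove (D D' : LinkProjection) : Prop :=
  (∃ Φ : PlaneDiffeo, HasCompactSupp Φ ∧ D'.1 = Φ '' D.1) ∨ SelfTangencyMove D D'

/-- Rondles: link projections modulo the equivalence relation generated by compactly supported
diffeomorphisms of the plane and self-tangency modifications. -/
def Rondle : Type := Quot RondleMove

/-- The rondle of a link projection. -/
def LinkProjection.toRondle (D : LinkProjection) : Rondle := Quot.mk RondleMove D

/-! ## Differing by a twin -/

/-- A tangle projection with `2k` ends, given by the position `disc` of the disc
`disc '' twinBox k` in the plane and by the part `outer` of the projection outside that disc. -/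
structure TangleProjection (k : ℕ) where
  disc : PlaneDiffeo
  outer : Set (ℝ × ℝ)
  disjoint : Disjoint outer (disc '' twinBox k)

/-- The tangle map of `T` takes the twin `x` to the rondle `C`: putting a configuration that
represents `x` into `T` gives a link projection that represents `C`. -/
def TangleProjection.MapsTo {k : ℕ} (T : TangleProjection k) (x : TwinGroup k) (C : Rondle) :
    Prop :=
  ∃ (w : List (Fin (k - 1))) (D : LinkProjection),
    twinOfWord w = x ∧ IsFilling T.disc T.outer w D.1 ∧ D.toRondle = C

/-- Two rondles differ by the twin `p`: they are `T(x)` and `T(p x)` for a tangle map `T` and a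
twin `x`. -/
def DifferBy {k : ℕ} (p : TwinGroup k) (C C' : Rondle) : Prop :=
  ∃ (T : TangleProjection k) (x : TwinGroup k), T.MapsTo x C ∧ T.MapsTo (p * x) C'

/-! ## Finite order invariants -/

/-- The words `σ_1 σ_2 σ_1` (positive triangle) and `σ_2 σ_1 σ_2` (negative triangle) on three
arcs. A triple-point modification replaces the configuration of one by that of the other. -/
def triangleWord : Bool → List (Fin (3 - 1))
  | true => [⟨0, by decide⟩, ⟨1, by decide⟩, ⟨0, by decide⟩]
  | false => [⟨1, by decide⟩, ⟨0, by decide⟩, ⟨1, by decide⟩]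

/-- A projection with `n` numbered disjoint triangles: pairwise disjoint discs, each of which is to
contain the configuration of a triangle of the given sign, and the part of the projection outside
these discs. -/
structure TriangleSystem (n : ℕ) where
  disc : Fin n → PlaneDiffeo
  sign : Fin n → Bool
  outer : Set (ℝ × ℝ)
  outer_disjoint : ∀ j, Disjoint outer (disc j '' twinBox 3)
  disc_disjoint : ∀ i j, i ≠ j → Disjoint (disc i '' twinBox 3) (disc j '' twinBox 3)

/-- The set `D_s`, obtained by applying the triple-point modification to the triangles in `s`. -/
def TriangleSystem.modify {n : ℕ} (S : TriangleSystem n) (s : Finset (Fin n)) : Set (ℝ × ℝ) :=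
  S.outer ∪ ⋃ j, S.disc j '' wordPic 3 (triangleWord (if j ∈ s then !(S.sign j) else S.sign j))

/-- The alternating sum of `f (D_s)` over the sets `s` of triangles is zero for every link
projection `D` with `n` numbered disjoint triangles. -/
def AlternatingSumVanishes {A : Type*} [AddCommGroup A] (f : Rondle → A) (n : ℕ) : Prop :=
  ∀ (S : TriangleSystem n) (D : Finset (Fin n) → LinkProjection),
    (∀ s, (D s).1 = S.modify s) →
    ∑ s : Finset (Fin n), (-1 : ℤ) ^ s.card • f (D s).toRondle = 0

/-- The order of a rondle invariant with respect to triple-point modifications: the least `m` such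
that the alternating sums over `m + 1` disjoint triangles vanish; `⊤` if there is no such `m`. -/
noncomputable def invariantOrder {A : Type*} [AddCommGroup A] (f : Rondle → A) : ℕ∞ :=
  sInf {m | ∃ d : ℕ, m = (d : ℕ∞) ∧ AlternatingSumVanishes f (d + 1)}

/-! ## The word problem of twin groups -/

/-! Fix the tangle map T and the twin x, and put F(y) = f(T(yx)); the claim is F(p) = F(1). The
order of f gives some d < n such that the alternating sums over d + 1 disjoint triangles vanish, and
p lies in the (d + 1)-st term of the lower central series of the small group H.

Algebra. Extend F linearly to the integral group ring. If F kills every h(1 - s_0)⋯(1 - s_d) with h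
in H and generators s_i, it kills the (d + 1)-st power of the augmentation ideal of H. This power
contains 1 - p, because 1 - [a,b] = ((1-b)(1-a) - (1-a)(1-b))a⁻¹b⁻¹ raises the exponent by one with
each commutator (`one_sub_mem_augPow`, `eq_of_mem_lowerCentralSeries`).

Topology. Each generator is represented by a word with a marked triangle whose flip turns it into a
word for 1 (`YBStep.exists_words`). Expanding the product gives the alternating sum over subsets of
blocks, where each block is s_i or 1. Hence the fillings differ exactly by triple-point
modifications at d + 1 disjoint triangles, and the sum vanishes (`alternatingSum_blockWord`).

Two geometric facts make this legitimate. First, the rondle of a filling depends only on the twin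
(`toRondle_eq_of_twinOfWord_eq`): the relation σ_i² = 1 is a self-tangency modification up to
isotopy, and far commutation is an isotopy. To get the isotopies, pictures are encoded by sets of
crossings; configurations with the same positions and compatible vertical order form a convex set,
and nearby ones are related by vertical shears. Second, words inducing the same permutation can
replace each other without destroying the property of being a link projection
(`IsLinkProjection.replace_word`). This is where purity enters. As projections are mere sets, a
parametrization has to be shown to follow the strands one at a time before it can be rerouted. -/

theorem twinGen_mul_self {k : ℕ} (i : Fin (k - 1)) : twinGen i * twinGen i = (1 : TwinGroup k) := by
  have h : (PresentedGroup.mk (twinRels k)) (FreeGroup.of i ^ 2) = 1 :=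
    PresentedGroup.one_of_mem (Or.inl ⟨i, rfl⟩)
  rw [pow_two, map_mul] at h
  exact h

theorem twinGen_comm {k : ℕ} {i j : Fin (k - 1)} (h : (i : ℕ) + 1 < j) :
    twinGen i * twinGen j = (twinGen j * twinGen i : TwinGroup k) := by
  have h : (PresentedGroup.mk (twinRels k))
      (FreeGroup.of i * FreeGroup.of j * (FreeGroup.of j * FreeGroup.of i)⁻¹) = 1 :=
    PresentedGroup.one_of_mem (Or.inr ⟨i, j, Or.inl h, rfl⟩)
  rw [map_mul, map_inv, mul_inv_eq_one, map_mul, map_mul] at h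
  exact h

theorem twinOfWord_append {k : ℕ} (u v : List (Fin (k - 1))) :
    twinOfWord (u ++ v) = twinOfWord u * twinOfWord v := by
  simp [twinOfWord]

theorem twinOfWord_cons {k : ℕ} (i : Fin (k - 1)) (v : List (Fin (k - 1))) :
    twinOfWord (i :: v) = twinGen i * twinOfWord v := by
  simp [twinOfWord]

theorem twinOfWord_reverse {k : ℕ} (u : List (Fin (k - 1))) :
    twinOfWord u.reverse = (twinOfWord u)⁻¹ := by
  induction u with
  | nil => simp [twinOfWord]
  | cons i u ih =>
    rw [List.reverse_cons, twinOfWord_append, ih, twinOfWord_cons i u, mul_inv_rev]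
    congr 1
    rw [eq_inv_iff_mul_eq_one]
    simp [twinOfWord, twinGen_mul_self]

theorem twinOfWord_surjective {k : ℕ} (x : TwinGroup k) : ∃ w, twinOfWord w = x := by
  have hx : x ∈ Subgroup.closure (Set.range (PresentedGroup.of (rels := twinRels k))) := by
    rw [PresentedGroup.closure_range_of]; trivial
  induction hx using Subgroup.closure_induction with
  | mem x hx => obtain ⟨i, rfl⟩ := hx; exact ⟨[i], by simp [twinOfWord, twinGen]⟩
  | one => exact ⟨[], rfl⟩
  | mul x y _ _ hx hy =>
    obtain ⟨u, rfl⟩ := hx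
    obtain ⟨v, rfl⟩ := hy
    exact ⟨u ++ v, twinOfWord_append u v⟩
  | inv x _ hx =>
    obtain ⟨u, rfl⟩ := hx
    exact ⟨u.reverse, twinOfWord_reverse u⟩

/-- The elementary relations between words which define the twin group. -/
inductive TwinWordRel (k : ℕ) : FreeMonoid (Fin (k - 1)) → FreeMonoid (Fin (k - 1)) → Prop
  | sq (i) : TwinWordRel k (FreeMonoid.of i * FreeMonoid.of i) 1
  | comm (i j : Fin (k - 1)) : (i : ℕ) + 1 < j →
      TwinWordRel k (FreeMonoid.of i * FreeMonoid.of j) (FreeMonoid.of j * FreeMonoid.of i)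

/-- The generators of the twin group as units of the monoid with the same presentation. -/
def twinUnit {k : ℕ} (i : Fin (k - 1)) : (conGen (TwinWordRel k)).Quotientˣ where
  val := (FreeMonoid.of i : FreeMonoid (Fin (k - 1)))
  -- The relation σ_i² = 1 makes each letter its own inverse, so the monoid presentation already
  -- defines a group.
  inv := (FreeMonoid.of i : FreeMonoid (Fin (k - 1)))
  val_inv := (Con.eq _).2 (ConGen.Rel.of _ _ (TwinWordRel.sq i))
  inv_val := (Con.eq _).2 (ConGen.Rel.of _ _ (TwinWordRel.sq i))

theorem twinUnit_comm {k : ℕ} {i j : Fin (k - 1)} (h : (i : ℕ) + 1 < j) :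
    twinUnit i * twinUnit j = twinUnit j * twinUnit i :=
  Units.ext ((Con.eq _).2 (ConGen.Rel.of _ _ (TwinWordRel.comm i j h)))

theorem twinUnit_rels (k : ℕ) : ∀ r ∈ twinRels k, FreeGroup.lift (twinUnit (k := k)) r = 1 := by
  rintro r (⟨i, rfl⟩ | ⟨i, j, hij, rfl⟩)
  · rw [map_pow, FreeGroup.lift_apply_of, pow_two]
    exact Units.ext (twinUnit i).val_inv
  · simp only [map_mul, map_inv, FreeGroup.lift_apply_of, mul_inv_eq_one]
    rcases hij with h | h
    · exact twinUnit_comm h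
    · exact (twinUnit_comm h).symm

/-- Evaluating words in the twin group and then in the monoid recovers their congruence classes.
Thus words equal as twins are related by the monoid relations alone, with no formal inverses. -/
theorem toGroup_twinOfWord {k : ℕ} (w : List (Fin (k - 1))) :
    ((PresentedGroup.toGroup (twinUnit_rels k) (twinOfWord w) :
      (conGen (TwinWordRel k)).Quotientˣ) : (conGen (TwinWordRel k)).Quotient) =
      (FreeMonoid.ofList w : FreeMonoid (Fin (k - 1))) := by
  induction w with
  | nil => simp [twinOfWord]
  | cons i w ih =>
    rw [twinOfWord_cons, map_mul, Units.val_mul, ih, twinGen, PresentedGroup.toGroup.of]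
    rfl

/-- Words that represent the same twin are related by the elementary relations. -/
theorem twinOfWord_eq_induction {k : ℕ} {P : List (Fin (k - 1)) → List (Fin (k - 1)) → Prop}
    (refl : ∀ w, P w w) (symm : ∀ w w', P w w' → P w' w)
    (trans : ∀ w w' w'', P w w' → P w' w'' → P w w'')
    (sq : ∀ u v i, P (u ++ i :: i :: v) (u ++ v))
    (comm : ∀ (u v) (i j : Fin (k - 1)), (i : ℕ) + 1 < j →
      P (u ++ i :: j :: v) (u ++ j :: i :: v))
    {w w' : List (Fin (k - 1))} (h : twinOfWord w = twinOfWord w') : P w w' := by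
  have h1 : ((FreeMonoid.ofList w : FreeMonoid (Fin (k - 1))) :
      (conGen (TwinWordRel k)).Quotient) = (FreeMonoid.ofList w' : FreeMonoid (Fin (k - 1))) := by
    rw [← toGroup_twinOfWord, ← toGroup_twinOfWord, h]
  -- Arbitrary contexts `u`, `v` are carried along so that the multiplicative closure of the
  -- congruence can be handled one factor at a time.
  have h2 : ∀ x y, ConGen.Rel (TwinWordRel k) x y → ∀ u v,
      P (u ++ x.toList ++ v) (u ++ y.toList ++ v) := by
    intro x y hxy
    induction hxy with
    | of x y hxy =>
      intro u v
      cases hxy with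
      | sq i => simpa using sq u v i
      | comm i j hij => simpa using comm u v i j hij
    | refl x => exact fun u v => refl _
    | symm _ ih => exact fun u v => symm _ _ (ih u v)
    | trans _ _ ih1 ih2 => exact fun u v => trans _ _ _ (ih1 u v) (ih2 u v)
    | @mul a b c d _ _ ih1 ih2 =>
      intro u v
      have e1 := ih1 u (c.toList ++ v)
      have e2 := ih2 (u ++ b.toList) v
      simp only [FreeMonoid.toList_mul, List.append_assoc] at e1 e2 ⊢
      exact trans _ _ _ e1 e2
  simpa using h2 _ _ ((Con.eq _).1 h1) [] []

/-! ## Lower central series and powers of the augmentation ideal -/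

section Augmentation

open scoped commutatorElement

variable {G : Type*} [Group G]

/-- The left multiples, by elements of the group ring of `closure S`, of products of `n` elements
`1 - s` with `s ∈ S`. -/
noncomputable def augPow (S : Set G) (n : ℕ) : Submodule ℤ (MonoidAlgebra ℤ G) :=
  Submodule.span ℤ (MonoidAlgebra.of ℤ G '' (Subgroup.closure S : Set G)) *
    Submodule.span ℤ ((fun s => 1 - MonoidAlgebra.of ℤ G s) '' S) ^ n

variable {S : Set G}

theorem augPow_succ (n : ℕ) : augPow S (n + 1) =
    augPow S n * Submodule.span ℤ ((fun s => 1 - MonoidAlgebra.of ℤ G s) '' S) := by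
  rw [augPow, augPow, pow_succ, mul_assoc]

/-- Uses x(1 - ab) = xa(1 - b) + x(1 - a) and x(1 - a⁻¹) = -xa⁻¹(1 - a) to pass from generators to
all of the subgroup. Stability under right multiplication in degree `n` is an assumption here
because it is proved by an induction that uses this lemma. -/
theorem augPow_mul_one_sub {n : ℕ}
    (hr : ∀ h ∈ Subgroup.closure S, ∀ x ∈ augPow S n, x * MonoidAlgebra.of ℤ G h ∈ augPow S n)
    {h : G} (hh : h ∈ Subgroup.closure S) :
    ∀ x ∈ augPow S n, x * (1 - MonoidAlgebra.of ℤ G h) ∈ augPow S (n + 1) := by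
  induction hh using Subgroup.closure_induction with
  | mem s hs =>
    intro x hx
    rw [augPow_succ]
    exact Submodule.mul_mem_mul hx (Submodule.subset_span ⟨s, hs, rfl⟩)
  | one => intro x _; rw [map_one, sub_self, mul_zero]; exact zero_mem _
  | mul a b ha hb iha ihb =>
    intro x hx
    have : x * (1 - MonoidAlgebra.of ℤ G (a * b)) = x * MonoidAlgebra.of ℤ G a *
        (1 - MonoidAlgebra.of ℤ G b) + x * (1 - MonoidAlgebra.of ℤ G a) := by
      rw [map_mul]; noncomm_ring
    rw [this]
    exact add_mem (ihb _ (hr a ha x hx)) (iha x hx)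
  | inv a ha iha =>
    intro x hx
    have h1 : MonoidAlgebra.of ℤ G a⁻¹ * MonoidAlgebra.of ℤ G a = 1 := by
      rw [← map_mul, inv_mul_cancel, map_one]
    have : x * (1 - MonoidAlgebra.of ℤ G a⁻¹) =
        -(x * MonoidAlgebra.of ℤ G a⁻¹ * (1 - MonoidAlgebra.of ℤ G a)) := by
      rw [mul_assoc x, mul_sub (MonoidAlgebra.of ℤ G a⁻¹), h1]; noncomm_ring
    rw [this]
    exact neg_mem (iha _ (hr _ (inv_mem ha) x hx))

/-- The definition builds in left multiples only. A right factor is absorbed through (1 - s)h = (1 -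
sh) - (1 - h). -/
theorem augPow_mul_of (n : ℕ) : ∀ h ∈ Subgroup.closure S, ∀ x ∈ augPow S n,
    x * MonoidAlgebra.of ℤ G h ∈ augPow S n := by
  induction n with
  | zero =>
    intro h hh x hx
    simp only [augPow, pow_zero, mul_one] at hx ⊢
    induction hx using Submodule.span_induction with
    | mem x hx =>
      obtain ⟨g, hg, rfl⟩ := hx
      exact Submodule.subset_span ⟨g * h, mul_mem hg hh, map_mul _ _ _⟩
    | zero => simp
    | add x y _ _ hx hy => rw [add_mul]; exact add_mem hx hy
    | smul c x _ hx => rw [smul_mul_assoc]; exact Submodule.smul_mem _ _ hx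
  | succ n ih =>
    intro h hh y hy
    rw [augPow_succ] at hy
    induction hy using Submodule.mul_induction_on' with
    | mem_mul_mem x hx t ht =>
      induction ht using Submodule.span_induction with
      | mem t ht =>
        obtain ⟨s, hs, rfl⟩ := ht
        have : x * (1 - MonoidAlgebra.of ℤ G s) * MonoidAlgebra.of ℤ G h =
            x * (1 - MonoidAlgebra.of ℤ G (s * h)) - x * (1 - MonoidAlgebra.of ℤ G h) := by
          rw [map_mul]; noncomm_ring
        simp only
        rw [this]
        exact sub_mem (augPow_mul_one_sub ih (mul_mem (Subgroup.subset_closure hs) hh) x hx)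
          (augPow_mul_one_sub ih hh x hx)
      | zero => simp
      | add a b _ _ ha hb => rw [mul_add, add_mul]; exact add_mem ha hb
      | smul c a _ ha =>
        rw [mul_smul_comm, smul_mul_assoc]; exact Submodule.smul_mem _ _ ha
    | add a _ b _ ha hb => rw [add_mul]; exact add_mem ha hb

theorem one_sub_mem_augPow_one {a : G} (ha : a ∈ Subgroup.closure S) :
    1 - MonoidAlgebra.of ℤ G a ∈ augPow S 1 := by
  have h1 : (1 : MonoidAlgebra ℤ G) ∈ augPow S 0 := by
    simp only [augPow, pow_zero, mul_one]
    exact Submodule.subset_span ⟨1, one_mem _, map_one _⟩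
  simpa using augPow_mul_one_sub (augPow_mul_of 0) ha 1 h1

/-- The new factor arrives on the left of the group ring coefficient: (1 - a)h lies in degree 1 by
right stability, and the remaining `n` factors stay untouched. -/
theorem one_sub_mul_augPow {a : G} (ha : a ∈ Subgroup.closure S) (n : ℕ) :
    ∀ x ∈ augPow S n, (1 - MonoidAlgebra.of ℤ G a) * x ∈ augPow S (n + 1) := by
  intro x hx
  have key : augPow S (n + 1) =
      augPow S 1 * Submodule.span ℤ ((fun s => 1 - MonoidAlgebra.of ℤ G s) '' S) ^ n := by
    rw [augPow, augPow, pow_one, pow_succ', mul_assoc]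
  rw [augPow] at hx
  rw [key]
  induction hx using Submodule.mul_induction_on' with
  | mem_mul_mem b hb t ht =>
    rw [← mul_assoc]
    refine Submodule.mul_mem_mul ?_ ht
    induction hb using Submodule.span_induction with
    | mem b hb =>
      obtain ⟨h, hh, rfl⟩ := hb
      exact augPow_mul_of 1 h hh _ (one_sub_mem_augPow_one ha)
    | zero => simp
    | add x y _ _ hx hy => rw [mul_add]; exact add_mem hx hy
    | smul c x _ hx => rw [mul_smul_comm]; exact Submodule.smul_mem _ _ hx
  | add x _ y _ hx hy => rw [mul_add]; exact add_mem hx hy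

/-- The classical inclusion of the lower central series in the dimension subgroups. Here term `n` is
counted from 0, hence the degree `n + 1`. -/
theorem one_sub_mem_augPow {n : ℕ} {p : G}
    (hp : p ∈ (Subgroup.closure S).lowerCentralSeries n) :
    1 - MonoidAlgebra.of ℤ G p ∈ augPow S (n + 1) := by
  induction n generalizing p with
  | zero => exact one_sub_mem_augPow_one hp
  | succ n ih =>
    have hle : ∀ m, (Subgroup.closure S).lowerCentralSeries m ≤ Subgroup.closure S := fun m =>
      Subgroup.lowerCentralSeries_antitone _ (Nat.zero_le m)
    rw [Subgroup.mem_lowerCentralSeries_succ_iff] at hp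
    -- The closure induction below forgets that its elements lie in the subgroup generated by `S`;
    -- this is needed to multiply by them.
    have hmem : ∀ x, x ∈ Subgroup.closure {x : G | ∃ p ∈ (Subgroup.closure S).lowerCentralSeries n,
        ∃ q ∈ Subgroup.closure S, ⁅p, q⁆ = x} → x ∈ Subgroup.closure S := fun x hx =>
      hle (n + 1) ((Subgroup.mem_lowerCentralSeries_succ_iff _ _ _).2 hx)
    induction hp using Subgroup.closure_induction with
    | mem x hx =>
      obtain ⟨a, ha, b, hb, rfl⟩ := hx
      have haH := hle n ha
      have hab : a * b * (a⁻¹ * b⁻¹) = ⁅a, b⁆ := by rw [commutatorElement_def]; group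
      have hba : b * a * (a⁻¹ * b⁻¹) = 1 := by group
      have : 1 - MonoidAlgebra.of ℤ G ⁅a, b⁆ =
          ((1 - MonoidAlgebra.of ℤ G b) * (1 - MonoidAlgebra.of ℤ G a) -
            (1 - MonoidAlgebra.of ℤ G a) * (1 - MonoidAlgebra.of ℤ G b)) *
              MonoidAlgebra.of ℤ G (a⁻¹ * b⁻¹) := by
        have e : (1 - MonoidAlgebra.of ℤ G b) * (1 - MonoidAlgebra.of ℤ G a) -
            (1 - MonoidAlgebra.of ℤ G a) * (1 - MonoidAlgebra.of ℤ G b) =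
            MonoidAlgebra.of ℤ G (b * a) - MonoidAlgebra.of ℤ G (a * b) := by
          rw [map_mul, map_mul]; noncomm_ring
        rw [e, sub_mul, ← map_mul, ← map_mul, hab, hba, map_one]
      rw [this]
      refine augPow_mul_of _ _ (mul_mem (inv_mem haH) (inv_mem hb)) _ (sub_mem ?_ ?_)
      · exact one_sub_mul_augPow hb _ _ (ih ha)
      · exact augPow_mul_one_sub (augPow_mul_of _) hb _ (ih ha)
    | one => rw [map_one, sub_self]; exact zero_mem _
    | mul a b ha hb iha ihb =>
      have : 1 - MonoidAlgebra.of ℤ G (a * b) =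
          (1 - MonoidAlgebra.of ℤ G a) * MonoidAlgebra.of ℤ G b +
            (1 - MonoidAlgebra.of ℤ G b) := by
        rw [map_mul]; noncomm_ring
      rw [this]
      exact add_mem (augPow_mul_of _ _ (hmem b hb) _ iha) ihb
    | inv a ha iha =>
      have h1 : MonoidAlgebra.of ℤ G a * MonoidAlgebra.of ℤ G a⁻¹ = 1 := by
        rw [← map_mul, mul_inv_cancel, map_one]
      have : 1 - MonoidAlgebra.of ℤ G a⁻¹ =
          -((1 - MonoidAlgebra.of ℤ G a) * MonoidAlgebra.of ℤ G a⁻¹) := by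
        rw [sub_mul, h1]; noncomm_ring
      rw [this]
      exact neg_mem (augPow_mul_of _ _ (inv_mem (hmem a ha)) _ iha)

/-- Multilinear expansion of a noncommutative product: each factor 1 - s contributes either -s or 1,
and the subset `e` records where -s is taken. -/
theorem prod_one_sub_of {n : ℕ} (s : Fin n → G) :
    (List.ofFn fun i => 1 - MonoidAlgebra.of ℤ G (s i)).prod =
      ∑ e : Finset (Fin n), (-1 : ℤ) ^ e.card •
        MonoidAlgebra.of ℤ G (List.ofFn fun i => if i ∈ e then s i else 1).prod := by
  have h := (MultilinearMap.mkPiAlgebraFin ℤ n (MonoidAlgebra ℤ G)).map_add_univ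
    (fun i => (-1 : ℤ) • MonoidAlgebra.of ℤ G (s i)) (fun _ => 1)
  rw [MultilinearMap.mkPiAlgebraFin_apply] at h
  have e : ((fun i => (-1 : ℤ) • MonoidAlgebra.of ℤ G (s i)) + (fun _ => 1)) =
      fun i => 1 - MonoidAlgebra.of ℤ G (s i) := by
    ext1 i; simp only [Pi.add_apply, neg_smul, one_smul]; abel
  rw [e] at h
  rw [h]
  refine Finset.sum_congr rfl fun e _ => ?_
  -- Isolates the scalars -1 on `e`, so that multilinearity pulls them out as a single sign.
  have h2 : (e.piecewise (fun i => (-1 : ℤ) • MonoidAlgebra.of ℤ G (s i)) fun _ => 1) =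
      e.piecewise (fun i => (-1 : ℤ) • (fun i => if i ∈ e then MonoidAlgebra.of ℤ G (s i) else 1) i)
        (fun i => if i ∈ e then MonoidAlgebra.of ℤ G (s i) else 1) := by
    ext1 i
    by_cases hi : i ∈ e <;> simp [hi]
  rw [h2, MultilinearMap.map_piecewise_smul, MultilinearMap.mkPiAlgebraFin_apply,
    Finset.prod_const]
  congr 1
  rw [map_list_prod, List.map_ofFn]
  congr 2
  ext1 i
  rw [Function.comp_apply, apply_ite (MonoidAlgebra.of ℤ G), map_one]

/-- A function on a group whose alternating sums over products of `n + 1` generators of a subgroup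
vanish is constant on the `(n + 1)`-st term of the lower central series of this subgroup. -/
theorem eq_of_mem_lowerCentralSeries {A : Type*} [AddCommGroup A] (g : G → A) {n : ℕ}
    (hg : ∀ h ∈ Subgroup.closure S, ∀ s : Fin (n + 1) → G, (∀ i, s i ∈ S) →
      ∑ e : Finset (Fin (n + 1)), (-1 : ℤ) ^ e.card •
        g (h * (List.ofFn fun i => if i ∈ e then s i else 1).prod) = 0)
    {p : G} (hp : p ∈ (Subgroup.closure S).lowerCentralSeries n) : g p = g 1 := by
  obtain ⟨L, hL⟩ : ∃ L : MonoidAlgebra ℤ G →ₗ[ℤ] A, ∀ x, L (MonoidAlgebra.of ℤ G x) = g x := by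
    refine ⟨Finsupp.linearCombination ℤ g ∘ₗ
      (MonoidAlgebra.coeffLinearEquiv ℤ : MonoidAlgebra ℤ G ≃ₗ[ℤ] G →₀ ℤ).toLinearMap, fun x => ?_⟩
    simp [MonoidAlgebra.of_apply]
  have key : ∀ x ∈ augPow S (n + 1), L x = 0 := by
    intro x hx
    rw [augPow, Submodule.span_pow] at hx
    induction hx using Submodule.mul_induction_on' with
    | mem_mul_mem b hb t ht =>
      induction hb using Submodule.span_induction with
      | mem b hb =>
        obtain ⟨h, hh, rfl⟩ := hb
        induction ht using Submodule.span_induction with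
        | mem t ht =>
          obtain ⟨s, rfl⟩ := Set.mem_pow.1 ht
          choose s' hs' hs'' using fun i => (s i).2
          simp only [← hs'']
          rw [prod_one_sub_of, Finset.mul_sum, map_sum, ← hg h hh s' hs']
          refine Finset.sum_congr rfl fun e _ => ?_
          rw [mul_smul_comm, map_smul, ← map_mul, hL]
        | zero => simp
        | add x y _ _ hx hy => rw [mul_add, map_add, hx, hy, add_zero]
        | smul c x _ hx => rw [mul_smul_comm, map_smul, hx, smul_zero]
      | zero => simp
      | add x y _ _ hx hy => rw [add_mul, map_add, hx, hy, add_zero]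
      | smul c x _ hx => rw [smul_mul_assoc, map_smul, hx, smul_zero]
    | add x _ y _ hx hy => rw [map_add, hx, hy, add_zero]
  have h := key _ (one_sub_mem_augPow hp)
  rw [map_sub, hL, ← map_one (MonoidAlgebra.of ℤ G), hL] at h
  exact (sub_eq_zero.1 h).symm

end Augmentation

/-! ## Diffeomorphisms of the plane -/

theorem PlaneDiffeo.contDiff (Φ : PlaneDiffeo) : ContDiff ℝ ∞ Φ :=
  contMDiff_iff_contDiff.1 Φ.contMDiff

/-- Diffeomorphisms of the plane from mutually inverse smooth maps. -/
def PlaneDiffeo.mk' (F G : ℝ × ℝ → ℝ × ℝ) (hF : ContDiff ℝ ∞ F) (hG : ContDiff ℝ ∞ G)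
    (hGF : ∀ z, G (F z) = z) (hFG : ∀ z, F (G z) = z) : PlaneDiffeo where
  toFun := F
  invFun := G
  left_inv := hGF
  right_inv := hFG
  contMDiff_toFun := contMDiff_iff_contDiff.2 hF
  contMDiff_invFun := contMDiff_iff_contDiff.2 hG

/-- A smooth bijection of the plane with invertible derivatives is a diffeomorphism. -/
theorem PlaneDiffeo.exists_of_bijective {F : ℝ × ℝ → ℝ × ℝ} (hF : ContDiff ℝ ∞ F)
    (hb : Function.Bijective F) (F' : ℝ × ℝ → (ℝ × ℝ) ≃L[ℝ] (ℝ × ℝ))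
    (hF' : ∀ z, HasFDerivAt F (F' z : (ℝ × ℝ) →L[ℝ] (ℝ × ℝ)) z) :
    ∃ Φ : PlaneDiffeo, ∀ z, Φ z = F z := by
  have hs : ∀ z, HasStrictFDerivAt F (F' z : (ℝ × ℝ) →L[ℝ] (ℝ × ℝ)) z := fun z => by
    have h := hF.contDiffAt.hasStrictFDerivAt (x := z) (by simp)
    rwa [(hF' z).fderiv] at h
  let e : (ℝ × ℝ) ≃ₜ (ℝ × ℝ) := (Equiv.ofBijective F hb).toHomeomorphOfContinuousOpen
    hF.continuous (isOpenMap_of_hasStrictFDerivAt_equiv hs)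
  exact ⟨PlaneDiffeo.mk' F e.symm hF (e.contDiff_symm hF' hF) e.symm_apply_apply
    e.apply_symm_apply, fun z => rfl⟩

/-- The linear automorphism `(a, b) ↦ (a, p a + q b)` of the plane. -/
noncomputable def shearEquiv (p q : ℝ) (hq : q ≠ 0) : (ℝ × ℝ) ≃L[ℝ] (ℝ × ℝ) :=
  LinearEquiv.toContinuousLinearEquiv
    { toFun := fun z => (z.1, p * z.1 + q * z.2)
      invFun := fun z => (z.1, (z.2 - p * z.1) / q)
      map_add' := fun x y => by ext <;> simp; ring
      map_smul' := fun c x => by ext <;> simp; ring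
      left_inv := fun z => by ext <;> simp [hq]
      right_inv := fun z => by ext <;> simp; field_simp; ring }

/-- The vertical displacement by a smooth bounded function whose derivative in the vertical
direction is larger than `-1` is a diffeomorphism. -/
theorem PlaneDiffeo.exists_shear {g : ℝ × ℝ → ℝ} (hg : ContDiff ℝ ∞ g) {C : ℝ}
    (hC : ∀ z, |g z| ≤ C) (hg' : ∀ z, -1 < fderiv ℝ g z (0, 1)) :
    ∃ Φ : PlaneDiffeo, ∀ z, Φ z = (z.1, z.2 + g z) := by
  have hd : ∀ x y, HasDerivAt (fun y => y + g (x, y)) (1 + fderiv ℝ g (x, y) (0, 1)) y := by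
    intro x y
    refine (hasDerivAt_id y).add ?_
    have h1 : HasDerivAt (fun y : ℝ => (x, y)) ((0 : ℝ), (1 : ℝ)) y :=
      (hasDerivAt_const y x).prodMk (hasDerivAt_id y)
    exact ((hg.differentiable (by simp)) (x, y)).hasFDerivAt.comp_hasDerivAt y h1
  -- Bijectivity is checked on each vertical line: the derivative bound gives injectivity, the
  -- boundedness of the displacement gives surjectivity.
  have hmono : ∀ x, StrictMono (fun y => y + g (x, y)) := fun x =>
    strictMono_of_deriv_pos fun y => by
      rw [(hd x y).deriv]; linarith [hg' (x, y)]
  have hsurj : ∀ x, Function.Surjective (fun y => y + g (x, y)) := by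
    intro x
    refine Continuous.surjective ?_ ?_ ?_
    · exact continuous_id.add (hg.continuous.comp (by fun_prop))
    · refine Filter.tendsto_atTop_mono (f := fun y => y - C) (fun y => ?_)
        (Filter.tendsto_atTop_add_const_right _ _ Filter.tendsto_id)
      have := (abs_le.1 (hC (x, y))).1
      linarith
    · refine Filter.tendsto_atBot_mono (f := fun y => y + C) (fun y => ?_)
        (Filter.tendsto_atBot_add_const_right _ _ Filter.tendsto_id)
      have := (abs_le.1 (hC (x, y))).2
      linarith
  refine PlaneDiffeo.exists_of_bijective (F := fun z => (z.1, z.2 + g z))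
    (contDiff_fst.prodMk (contDiff_snd.add hg)) ⟨?_, ?_⟩
    (fun z => shearEquiv (fderiv ℝ g z (1, 0)) (1 + fderiv ℝ g z (0, 1))
      (by linarith [hg' z])) fun z => ?_
  · rintro ⟨x, y⟩ ⟨x', y'⟩ h
    simp only [Prod.mk.injEq] at h
    obtain ⟨rfl, h⟩ := h
    rw [(hmono x).injective h]
  · rintro ⟨x, y⟩
    obtain ⟨y', hy'⟩ := hsurj x y
    exact ⟨(x, y'), by simpa using hy'⟩
  · have h := (hasFDerivAt_fst (𝕜 := ℝ) (p := z)).prodMk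
      ((hasFDerivAt_snd (𝕜 := ℝ) (p := z)).add ((hg.differentiable (by simp)) z).hasFDerivAt)
    have e : (shearEquiv (fderiv ℝ g z (1, 0)) (1 + fderiv ℝ g z (0, 1))
        (by linarith [hg' z]) : (ℝ × ℝ) →L[ℝ] (ℝ × ℝ)) = (ContinuousLinearMap.fst ℝ ℝ ℝ).prod
          (ContinuousLinearMap.snd ℝ ℝ ℝ + fderiv ℝ g z) := by
      ext <;> simp [shearEquiv]
    rw [e]
    exact h

/-- The affine diffeomorphism `(x, y) ↦ (x + o, s y + b)`. -/
noncomputable def placeDiffeo (o s b : ℝ) (hs : 0 < s) : PlaneDiffeo :=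
  PlaneDiffeo.mk' (fun z => (z.1 + o, s * z.2 + b)) (fun z => (z.1 - o, (z.2 - b) / s))
    (by fun_prop) (by fun_prop) (fun z => by ext <;> simp [hs.ne'])
    (fun z => by ext <;> simp; field_simp; ring)

theorem placeDiffeo_apply (o s b : ℝ) (hs : 0 < s) (z : ℝ × ℝ) :
    placeDiffeo o s b hs z = (z.1 + o, s * z.2 + b) := rfl

theorem PlaneDiffeo.image_trans (φ ψ : PlaneDiffeo) (s : Set (ℝ × ℝ)) :
    (ψ.trans φ) '' s = φ '' (ψ '' s) := by
  rw [Diffeomorph.coe_trans, Set.image_comp]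

/-! ## Images of link projections -/

/-- The chain rule applied to the inverse composed with the map gives the derivative a left inverse.
Injectivity is what preserves immersions and transversality. -/
theorem PlaneDiffeo.exists_hasFDerivAt (Φ : PlaneDiffeo) (z : ℝ × ℝ) :
    ∃ L : (ℝ × ℝ) →L[ℝ] (ℝ × ℝ), Function.Injective L ∧ HasFDerivAt Φ L z := by
  have h1 := (Φ.contDiff.differentiable (by simp) z).hasFDerivAt
  have h2 := (Φ.symm.contDiff.differentiable (by simp) (Φ z)).hasFDerivAt
  refine ⟨_, ?_, h1⟩
  have h3 := h2.comp z h1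
  have h4 : (Φ.symm ∘ Φ : ℝ × ℝ → ℝ × ℝ) = id := by ext1 x; simp
  rw [h4] at h3
  have h5 := h3.unique (hasFDerivAt_id z)
  exact Function.LeftInverse.injective (g := fderiv ℝ Φ.symm (Φ z)) fun v =>
    congrArg (fun L : (ℝ × ℝ) →L[ℝ] (ℝ × ℝ) => L v) h5

theorem IsGenericImmersion.comp {m : ℕ} {γ : Fin m → ℝ → ℝ × ℝ} (hγ : IsGenericImmersion γ)
    (Φ : PlaneDiffeo) : IsGenericImmersion fun i s => Φ (γ i s) := by
  choose L hLi hL using Φ.exists_hasFDerivAt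
  have hd : ∀ i s, deriv (fun s => Φ (γ i s)) s = L (γ i s) (deriv (γ i) s) := fun i s =>
    ((hL (γ i s)).comp_hasDerivAt s
      ((hγ.smooth i).differentiable (by simp) s).hasDerivAt).deriv
  refine ⟨fun i => Φ.contDiff.comp (hγ.smooth i), fun i s => ?_, fun i s => ?_,
    fun a b hab h => ?_, fun a b c hab hbc hac h => ?_⟩
  · simp only [hγ.periodic i s]
  · rw [hd]
    exact (map_ne_zero_iff _ (hLi _)).2 (hγ.immersion i s)
  · have h' := Φ.injective h
    have hl := hγ.transverse a b hab h'
    rw [hd, hd, ← h']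
    have := hl.map' (L (γ a.1 a.2) : (ℝ × ℝ) →ₗ[ℝ] (ℝ × ℝ))
      (LinearMap.ker_eq_bot.2 (hLi _))
    have e : ![L (γ a.1 a.2) (deriv (γ a.1) a.2), L (γ a.1 a.2) (deriv (γ b.1) b.2)] =
        L (γ a.1 a.2) ∘ ![deriv (γ a.1) a.2, deriv (γ b.1) b.2] := by
      ext1 i
      fin_cases i <;> rfl
    rw [e]
    exact this
  · exact hγ.no_triple a b c hab hbc hac ⟨Φ.injective h.1, Φ.injective h.2⟩

/-- A set which is a link projection. -/
def IsLinkProjection (D : Set (ℝ × ℝ)) : Prop :=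
  ∃ (m : ℕ) (γ : Fin m → ℝ → ℝ × ℝ),
    0 < m ∧ IsGenericImmersion γ ∧ D = ⋃ i, Set.range (γ i)

theorem IsLinkProjection.image {D : Set (ℝ × ℝ)} (hD : IsLinkProjection D) (Φ : PlaneDiffeo) :
    IsLinkProjection (Φ '' D) := by
  obtain ⟨m, γ, hm, hγ, rfl⟩ := hD
  refine ⟨m, _, hm, hγ.comp Φ, ?_⟩
  rw [Set.image_iUnion]
  refine Set.iUnion_congr fun i => ?_
  rw [← Set.range_comp]
  rfl

theorem isLinkProjection_image_iff {D : Set (ℝ × ℝ)} (Φ : PlaneDiffeo) :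
    IsLinkProjection (Φ '' D) ↔ IsLinkProjection D := by
  refine ⟨fun h => ?_, fun h => h.image Φ⟩
  have := h.image Φ.symm
  rwa [← Set.image_comp, ← Diffeomorph.coe_trans, Diffeomorph.self_trans_symm,
    Diffeomorph.coe_refl, Set.image_id] at this

/-! ## Pictures given by sets of crossings -/

/-- A crossing of the arcs in the positions `pos` and `pos + 1`, which takes place at the heights of
distance at most `radius` from `height`. -/
@[ext]
structure Crossing where
  pos : ℕ
  height : ℝ
  radius : ℝ

namespace Crossing

/-- The horizontal displacement of the arcs of a crossing. -/
noncomputable def step (c : Crossing) (y : ℝ) : ℝ :=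
  Real.smoothTransition ((y - c.height) / (2 * c.radius) + 1 / 2)

/-- The two crossing arcs. -/
def graph (c : Crossing) : Set (ℝ × ℝ) :=
  {z | |z.2 - c.height| ≤ c.radius ∧
    (z.1 = c.pos + 1 + c.step z.2 ∨ z.1 = c.pos + 2 - c.step z.2)}

/-- The crossing moved by `placeDiffeo o s b`. -/
noncomputable def place (o : ℕ) (s b : ℝ) (c : Crossing) : Crossing :=
  ⟨c.pos + o, s * c.height + b, s * c.radius⟩

theorem graph_fst_mem {c : Crossing} {z : ℝ × ℝ} (h : z ∈ c.graph) :
    z.1 ∈ Set.Icc (c.pos + 1 : ℝ) (c.pos + 2) := by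
  have h0 := Real.smoothTransition.nonneg ((z.2 - c.height) / (2 * c.radius) + 1 / 2)
  have h1 := Real.smoothTransition.le_one ((z.2 - c.height) / (2 * c.radius) + 1 / 2)
  obtain ⟨-, h | h⟩ := h <;> rw [h, step] <;> constructor <;> linarith

theorem abs_place {o : ℕ} {s b : ℝ} (hs : 0 < s) (c : Crossing) (y : ℝ) :
    |s * y + b - (c.place o s b).height| = s * |y - c.height| := by
  rw [place, ← abs_of_pos hs, ← abs_mul, abs_of_pos hs]
  congr 1
  ring

theorem step_place {o : ℕ} {s b : ℝ} (hs : 0 < s) (c : Crossing) (y : ℝ) :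
    (c.place o s b).step (s * y + b) = c.step y := by
  have e : s * y + b - (s * c.height + b) = s * (y - c.height) := by ring
  rw [step, step, place, e, mul_left_comm, mul_div_mul_left _ _ hs.ne']

theorem mem_graph_place {o : ℕ} {s b : ℝ} (hs : 0 < s) (c : Crossing) (z : ℝ × ℝ) :
    placeDiffeo o s b hs z ∈ (c.place o s b).graph ↔ z ∈ c.graph := by
  simp only [graph, Set.mem_ofPred_eq, placeDiffeo_apply, abs_place hs, step_place hs]
  simp only [place, Nat.cast_add]
  rw [mul_le_mul_iff_right₀ hs]
  refine and_congr_right fun _ => or_congr ?_ ?_ <;> constructor <;> intro h <;> linarith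

end Crossing

/-- The configuration of `k` arcs with the given crossings. -/
def crossPic (k : ℕ) (E : Set Crossing) : Set (ℝ × ℝ) :=
  {z | z.2 ∈ Set.Icc (0 : ℝ) 1 ∧ ((∃ c ∈ E, z ∈ c.graph) ∨
    ∃ l : ℕ, l < k ∧ z.1 = l + 1 ∧
      ∀ c ∈ E, l = c.pos ∨ l = c.pos + 1 → c.radius < |z.2 - c.height|)}

theorem crossPic_subset_twinBox {k : ℕ} {E : Set Crossing} (hE : ∀ c ∈ E, c.pos + 2 ≤ k) :
    crossPic k E ⊆ twinBox k := by
  rintro z ⟨hz, ⟨c, hc, h⟩ | ⟨l, hl, h, -⟩⟩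
  · have h1 := Crossing.graph_fst_mem h
    have h2 : (c.pos + 2 : ℝ) ≤ k := by exact_mod_cast hE c hc
    have h3 : (0 : ℝ) ≤ c.pos := Nat.cast_nonneg _
    exact ⟨⟨by linarith [h1.1], by linarith [h1.2]⟩, hz⟩
  · have h2 : (l + 1 : ℝ) ≤ k := by exact_mod_cast hl
    have h3 : (0 : ℝ) ≤ l := Nat.cast_nonneg _
    exact ⟨⟨by rw [h]; linarith, by rw [h]; linarith⟩, hz⟩

theorem crossPic_empty (k : ℕ) : crossPic k ∅ = trivialPic k := by
  ext z
  simp only [crossPic, trivialPic, Set.mem_ofPred_eq, Set.mem_empty_iff_false, false_and,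
    exists_false, false_or, false_imp_iff, implies_true, and_true]
  refine and_congr_right fun _ => ⟨?_, ?_⟩
  · rintro ⟨l, hl, h⟩; exact ⟨⟨l, hl⟩, h⟩
  · rintro ⟨l, h⟩; exact ⟨l, l.2, h⟩

/-- Inside a box which is free of other crossings, a picture is a smaller picture. -/
theorem placeDiffeo_mem_crossPic {k q o : ℕ} {s b : ℝ} (hs : 0 < s) (hb : 0 ≤ b) (hbs : b + s ≤ 1)
    (ho : o + q ≤ k) {E F : Set Crossing} (h1 : ∀ c ∈ F, c.place o s b ∈ E)
    (h2 : ∀ c ∈ E, (∃ c' ∈ F, c = c'.place o s b) ∨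
      ∀ y ∈ Set.Icc b (b + s), c.radius < |y - c.height|)
    {z : ℝ × ℝ} (hz : z ∈ twinBox q) :
    placeDiffeo o s b hs z ∈ crossPic k E ↔ z ∈ crossPic q F := by
  obtain ⟨⟨hx0, hx1⟩, hy0, hy1⟩ := hz
  have hy : s * z.2 + b ∈ Set.Icc b (b + s) := ⟨by nlinarith, by nlinarith⟩
  have hy' : s * z.2 + b ∈ Set.Icc (0 : ℝ) 1 := ⟨hb.trans hy.1, hy.2.trans hbs⟩
  constructor
  · rintro ⟨-, ⟨c, hc, h⟩ | ⟨l, hl, h, h'⟩⟩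
    · refine ⟨⟨hy0, hy1⟩, Or.inl ?_⟩
      rcases h2 c hc with ⟨c', hc', rfl⟩ | hc'
      · exact ⟨c', hc', (Crossing.mem_graph_place hs c' z).1 h⟩
      · exact absurd h.1 (not_le.2 (hc' _ hy))
    -- The side walls of the box have half-integral abscissas and vertical arcs have integral ones,
    -- so an arc met in the box has one of the `q` positions starting at `o`.
    · refine ⟨⟨hy0, hy1⟩, Or.inr ?_⟩
      simp only [placeDiffeo_apply] at h h'
      have e1 : o ≤ l := by
        by_contra hlt
        have : (l + 1 : ℝ) ≤ o := by exact_mod_cast not_le.1 hlt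
        linarith
      obtain ⟨m, rfl⟩ := Nat.exists_eq_add_of_le e1
      push_cast at h
      have e2 : m < q := by
        by_contra hlt
        have : (q : ℝ) ≤ m := by exact_mod_cast not_lt.1 hlt
        linarith
      refine ⟨m, e2, by linarith, fun c hc hm => ?_⟩
      have := h' _ (h1 c hc) (by simp only [Crossing.place]; omega)
      rw [Crossing.abs_place hs] at this
      exact lt_of_mul_lt_mul_left this hs.le
  · rintro ⟨-, ⟨c, hc, h⟩ | ⟨l, hl, h, h'⟩⟩
    · exact ⟨hy', Or.inl ⟨_, h1 c hc, (Crossing.mem_graph_place hs c z).2 h⟩⟩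
    · refine ⟨hy', Or.inr ⟨o + l, by omega, ?_, fun c hc hl' => ?_⟩⟩
      · rw [placeDiffeo_apply, h]; push_cast; ring
      · rcases h2 c hc with ⟨c', hc', rfl⟩ | hc'
        · rw [placeDiffeo_apply, Crossing.abs_place hs]
          exact mul_lt_mul_of_pos_left (h' c' hc' (by simp only [Crossing.place] at hl'; omega)) hs
        · exact hc' _ hy

/-- Outside of a set, a picture does not depend on the crossings which take place in the set. -/
theorem mem_crossPic_iff_of_subset {k : ℕ} {E E' : Set Crossing} (h : E' ⊆ E) {z : ℝ × ℝ}
    (hz : ∀ c ∈ E, c ∉ E' → ¬ (z.1 ∈ Set.Icc (c.pos + 1 : ℝ) (c.pos + 2) ∧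
      |z.2 - c.height| ≤ c.radius)) :
    z ∈ crossPic k E ↔ z ∈ crossPic k E' := by
  constructor
  · rintro ⟨h0, ⟨c, hc, h1⟩ | ⟨l, hl, h1, h2⟩⟩
    · refine ⟨h0, Or.inl ⟨c, ?_, h1⟩⟩
      by_contra hc'
      exact hz c hc hc' ⟨Crossing.graph_fst_mem h1, h1.1⟩
    · exact ⟨h0, Or.inr ⟨l, hl, h1, fun c hc => h2 c (h hc)⟩⟩
  · rintro ⟨h0, ⟨c, hc, h1⟩ | ⟨l, hl, h1, h2⟩⟩
    · exact ⟨h0, Or.inl ⟨c, h hc, h1⟩⟩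
    · refine ⟨h0, Or.inr ⟨l, hl, h1, fun c hc hl' => ?_⟩⟩
      by_cases hc' : c ∈ E'
      · exact h2 c hc' hl'
      · by_contra hlt
        refine hz c hc hc' ⟨?_, not_lt.1 hlt⟩
        rw [h1]
        rcases hl' with rfl | rfl <;> constructor <;> push_cast <;> linarith

/-- The decomposition of a picture into its parts inside and outside of boxes. -/
theorem crossPic_eq_diff_union {ι : Type*} {k q : ℕ} (o : ι → ℕ) (s b : ι → ℝ) (hs : ∀ j, 0 < s j)
    (hb : ∀ j, 0 ≤ b j) (hbs : ∀ j, b j + s j ≤ 1) (ho : ∀ j, o j + q ≤ k)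
    {E₀ : Set Crossing} {F : ι → Set Crossing} (hFq : ∀ j, ∀ c ∈ F j, c.pos + 2 ≤ q)
    (hF0 : ∀ j, ∀ c ∈ F j, 0 ≤ c.height - c.radius ∧ c.height + c.radius ≤ 1)
    (hsep₀ : ∀ j, ∀ c ∈ E₀, ∀ y ∈ Set.Icc (b j) (b j + s j), c.radius < |y - c.height|)
    (hsep : ∀ i j, i ≠ j → ∀ c ∈ F i, ∀ y ∈ Set.Icc (b j) (b j + s j),
      (c.place (o i) (s i) (b i)).radius < |y - (c.place (o i) (s i) (b i)).height|) :
    crossPic k (E₀ ∪ ⋃ j, Crossing.place (o j) (s j) (b j) '' F j) =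
      (crossPic k E₀ \ ⋃ j, placeDiffeo (o j) (s j) (b j) (hs j) '' twinBox q) ∪
        ⋃ j, placeDiffeo (o j) (s j) (b j) (hs j) '' crossPic q (F j) := by
  -- Inside a box only its own crossings are active; outside all boxes only those of `E₀` matter.
  -- Since the picture is determined pointwise by the active crossings, these two statements
  -- suffice.
  have hin : ∀ j, ∀ z ∈ twinBox q, (placeDiffeo (o j) (s j) (b j) (hs j) z ∈
      crossPic k (E₀ ∪ ⋃ j, Crossing.place (o j) (s j) (b j) '' F j) ↔ z ∈ crossPic q (F j)) := by
    intro j z hz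
    refine placeDiffeo_mem_crossPic (hs j) (hb j) (hbs j) (ho j)
      (fun c hc => ?_) (fun c hc => ?_) hz
    · exact Set.mem_union_right _ (Set.mem_iUnion.2 ⟨j, c, hc, rfl⟩)
    rcases hc with hc | hc
    · exact Or.inr (hsep₀ j c hc)
    · obtain ⟨i, c, hcF, rfl⟩ := Set.mem_iUnion.1 hc
      by_cases hij : i = j
      · subst hij; exact Or.inl ⟨c, hcF, rfl⟩
      · exact Or.inr (hsep i j hij c hcF)
  have hout : ∀ z, (∀ j, z ∉ placeDiffeo (o j) (s j) (b j) (hs j) '' twinBox q) →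
      (z ∈ crossPic k (E₀ ∪ ⋃ j, Crossing.place (o j) (s j) (b j) '' F j) ↔
        z ∈ crossPic k E₀) := by
    intro z hz
    refine mem_crossPic_iff_of_subset Set.subset_union_left fun c hc hc' hzc => ?_
    obtain ⟨j, c, hcF, rfl⟩ := Set.mem_iUnion.1 (hc.resolve_left hc')
    apply hz j
    obtain ⟨z', rfl⟩ : ∃ z', placeDiffeo (o j) (s j) (b j) (hs j) z' = z :=
      (placeDiffeo (o j) (s j) (b j) (hs j)).surjective z
    refine ⟨z', ?_, rfl⟩
    obtain ⟨⟨hx0, hx1⟩, hy⟩ := hzc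
    rw [placeDiffeo_apply, Crossing.abs_place (hs j)] at hy
    have hy := abs_le.1 (le_of_mul_le_mul_left hy (hs j))
    have h0 := hF0 j c hcF
    have h3 : (c.pos + 2 : ℝ) ≤ q := by exact_mod_cast hFq j c hcF
    have h4 : (0 : ℝ) ≤ c.pos := Nat.cast_nonneg _
    simp only [placeDiffeo_apply, Crossing.place, Nat.cast_add] at hx0 hx1
    exact ⟨⟨by linarith, by linarith⟩, by linarith [hy.1], by linarith [hy.2]⟩
  ext z
  simp only [Set.mem_union, Set.mem_sdiff, Set.mem_iUnion, not_exists]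
  by_cases hz : ∀ j, z ∉ placeDiffeo (o j) (s j) (b j) (hs j) '' twinBox q
  · have h2 : ¬ ∃ j, z ∈ placeDiffeo (o j) (s j) (b j) (hs j) '' crossPic q (F j) := by
      rintro ⟨j, hj⟩
      exact hz j (Set.image_mono (crossPic_subset_twinBox (hFq j)) hj)
    have := hout z hz
    tauto
  · push Not at hz
    obtain ⟨j, z', hz', rfl⟩ := hz
    rw [hin j z' hz']
    refine ⟨fun h => Or.inr ⟨j, z', h, rfl⟩, ?_⟩
    rintro (⟨-, h⟩ | ⟨i, z'', hz'', h⟩)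
    · exact absurd ⟨z', hz', rfl⟩ (h j)
    · rw [← hin j z' hz', ← h, hin i z'' (crossPic_subset_twinBox (hFq i) hz'')]
      exact hz''

/-! ## The picture of a word -/

/-- The crossing of the letter `i` in the slot `a` of a word of length `N`. -/
noncomputable def slotCrossing (N a i : ℕ) : Crossing := ⟨i, (a + 1 / 2) / N, 1 / (6 * N)⟩

/-- In the slot coordinate N y - a the crossing fills exactly the middle third [1/3, 2/3], where
`crossStep` is not locally constant. This explains the radius 1/(6N). -/
theorem slotCrossing_abs {N : ℕ} (hN : 0 < N) (a i : ℕ) (y : ℝ) :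
    |y - (slotCrossing N a i).height| ≤ (slotCrossing N a i).radius ↔
      |N * y - a - 1 / 2| ≤ 1 / 6 := by
  have hN' : (0 : ℝ) < N := by exact_mod_cast hN
  have e : N * y - a - 1 / 2 = N * (y - (a + 1 / 2) / N) := by field_simp; ring
  simp only [slotCrossing]
  rw [e, abs_mul, abs_of_pos hN', ← div_div, le_div_iff₀ hN', mul_comm]

theorem slotCrossing_abs_lt {N : ℕ} (hN : 0 < N) (a i : ℕ) (y : ℝ) :
    (slotCrossing N a i).radius < |y - (slotCrossing N a i).height| ↔
      1 / 6 < |N * y - a - 1 / 2| := by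
  rw [← not_le, slotCrossing_abs hN, not_le]

theorem slotCrossing_step {N : ℕ} (hN : 0 < N) (a i : ℕ) (y : ℝ) :
    (slotCrossing N a i).step y = crossStep (N * y - a) := by
  have hN' : (0 : ℝ) < N := by exact_mod_cast hN
  simp only [slotCrossing, Crossing.step, crossStep]
  congr 1
  field_simp
  ring

/-- The crossings of the picture of a word. -/
def wordCrossings {k : ℕ} (w : List (Fin (k - 1))) : Set Crossing :=
  {c | ∃ (a : ℕ) (i : Fin (k - 1)), w[a]? = some i ∧ c = slotCrossing w.length a i}

theorem mem_wordPic_iff {k : ℕ} {w : List (Fin (k - 1))} (hw : w ≠ []) (z : ℝ × ℝ) :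
    z ∈ wordPic k w ↔ ∃ (a : ℕ) (i : Fin (k - 1)), w[a]? = some i ∧
      (z.1, w.length * z.2 - (a : ℝ)) ∈ letterPic k i := by
  rw [wordPic, if_neg hw, Set.mem_iUnion]
  constructor
  · rintro ⟨a, h⟩
    exact ⟨a, w.get a, by simp, h⟩
  · rintro ⟨a, i, ha, h⟩
    obtain ⟨ha', rfl⟩ := List.getElem?_eq_some_iff.1 ha
    exact ⟨⟨a, ha'⟩, h⟩

theorem crossStep_of_le {t : ℝ} (h : t ≤ 1 / 3) : crossStep t = 0 :=
  Real.smoothTransition.zero_of_nonpos (by linarith)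

theorem crossStep_of_ge {t : ℝ} (h : 2 / 3 ≤ t) : crossStep t = 1 :=
  Real.smoothTransition.one_of_one_le (by linarith)

/-- At each height at most one crossing is active, and away from the middle thirds of the slots all
arcs stand at integral positions, so gluing letters adds nothing beyond their crossings. -/
theorem wordPic_eq_crossPic {k : ℕ} (w : List (Fin (k - 1))) :
    wordPic k w = crossPic k (wordCrossings w) := by
  by_cases hw : w = []
  · subst hw
    have : wordCrossings ([] : List (Fin (k - 1))) = ∅ := by
      ext c; simp [wordCrossings]
    rw [this, crossPic_empty, wordPic, if_pos rfl]
  have hN : 0 < w.length := List.length_pos_iff.2 hw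
  have hN' : (0 : ℝ) < w.length := by exact_mod_cast hN
  ext z
  rw [mem_wordPic_iff hw]
  constructor
  · rintro ⟨a, i, ha, ⟨ht0, ht1⟩, h⟩
    simp only at ht0 ht1 h
    have haN : a < w.length := (List.getElem?_eq_some_iff.1 ha).1
    have haN' : (a + 1 : ℝ) ≤ w.length := by exact_mod_cast haN
    have ha0 : (0 : ℝ) ≤ a := Nat.cast_nonneg _
    have hz : z.2 ∈ Set.Icc (0 : ℝ) 1 := by
      constructor <;> by_contra hlt <;> rw [not_le] at hlt <;> nlinarith
    have hact : ∀ b : ℕ, |w.length * z.2 - (b : ℝ) - 1 / 2| ≤ 1 / 6 → b = a := by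
      intro b hb
      rw [abs_le] at hb
      have h1 : (b : ℝ) < a + 1 := by linarith [hb.1]
      have h2 : (a : ℝ) < b + 1 := by linarith [hb.2]
      have h1 : b < a + 1 := by exact_mod_cast h1
      have h2 : a < b + 1 := by exact_mod_cast h2
      omega
    refine ⟨hz, ?_⟩
    by_cases hmid : |w.length * z.2 - (a : ℝ) - 1 / 2| ≤ 1 / 6
    · rcases h with ⟨l, hl1, hl2, hl⟩ | h
      · refine Or.inr ⟨l, l.2, hl, ?_⟩
        rintro c ⟨b, j, hb, rfl⟩ hc
        rw [slotCrossing_abs_lt hN]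
        by_contra hlt
        obtain rfl := hact b (not_lt.1 hlt)
        rw [ha] at hb
        cases hb
        simp only [slotCrossing] at hc
        omega
      · refine Or.inl ⟨_, ⟨a, i, ha, rfl⟩, (slotCrossing_abs hN _ _ _).2 hmid, ?_⟩
        rw [slotCrossing_step hN]
        exact h
    · have hno : ∀ c ∈ wordCrossings w, c.radius < |z.2 - c.height| := by
        rintro c ⟨b, j, hb, rfl⟩
        rw [slotCrossing_abs_lt hN]
        by_contra hlt
        obtain rfl := hact b (not_lt.1 hlt)
        exact hmid (not_lt.1 hlt)
      have hi := i.2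
      have hx : ∃ l : ℕ, l < k ∧ z.1 = l + 1 := by
        rcases h with ⟨l, hl1, hl2, hl⟩ | h
        · exact ⟨l, l.2, hl⟩
        · have hs : crossStep (w.length * z.2 - a) = 0 ∨ crossStep (w.length * z.2 - a) = 1 := by
            rw [abs_le, not_and_or, not_le, not_le] at hmid
            rcases hmid with hm | hm
            · exact Or.inl (crossStep_of_le (by linarith))
            · exact Or.inr (crossStep_of_ge (by linarith))
          rcases hs with hs | hs <;> rw [hs] at h <;> rcases h with h | h
          · exact ⟨i, by omega, by rw [h]; ring⟩
          · exact ⟨i + 1, by omega, by rw [h]; push_cast; ring⟩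
          · exact ⟨i + 1, by omega, by rw [h]; push_cast; ring⟩
          · exact ⟨i, by omega, by rw [h]; ring⟩
      obtain ⟨l, hl, hl'⟩ := hx
      exact Or.inr ⟨l, hl, hl', fun c hc _ => hno c hc⟩
  · rintro ⟨hz, ⟨c, ⟨a, i, ha, rfl⟩, hc, h⟩ | ⟨l, hl, hx, h⟩⟩
    · rw [slotCrossing_abs hN, abs_le] at hc
      rw [slotCrossing_step hN] at h
      exact ⟨a, i, ha, ⟨by simp only; linarith, by simp only; linarith⟩, Or.inr h⟩
    · obtain ⟨a, ha, ha0, ha1⟩ : ∃ a : ℕ, a < w.length ∧ 0 ≤ w.length * z.2 - (a : ℝ) ∧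
          w.length * z.2 - (a : ℝ) ≤ 1 := by
        -- The slot is the integer part of N y, except at the top height, where this would be one
        -- past the last slot.
        rcases hz.2.eq_or_lt with h1 | h1
        · refine ⟨w.length - 1, by omega, ?_⟩
          rw [h1, Nat.cast_sub hN]
          push_cast
          constructor <;> linarith
        · have hnn : 0 ≤ w.length * z.2 := mul_nonneg hN'.le hz.1
          refine ⟨⌊w.length * z.2⌋₊, ?_, ?_, ?_⟩
          · rw [Nat.floor_lt hnn]
            nlinarith
          · linarith [Nat.floor_le hnn]
          · linarith [Nat.lt_floor_add_one (w.length * z.2)]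
      refine ⟨a, w[a], List.getElem?_eq_getElem ha, ⟨ha0, ha1⟩, ?_⟩
      by_cases hla : l = w[a] ∨ l = w[a] + 1
      · right
        have := h _ ⟨a, w[a], List.getElem?_eq_getElem ha, rfl⟩ hla
        rw [slotCrossing_abs_lt hN, lt_abs] at this
        rcases this with hm | hm
        · rw [crossStep_of_ge (by linarith), hx]
          rcases hla with rfl | rfl
          · right; ring
          · left; push_cast; ring
        · rw [crossStep_of_le (by linarith), hx]
          rcases hla with rfl | rfl
          · left; ring
          · right; push_cast; ring
      · left
        push Not at hla
        exact ⟨⟨l, hl⟩, hla.1, hla.2, hx⟩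

/-! ## Moving crossings vertically -/

theorem exists_bound_fderiv {f : ℝ × ℝ → ℝ} (hf : ContDiff ℝ ∞ f) (hc : HasCompactSupport f) :
    ∃ M : ℝ, ∀ z, |f z| ≤ M ∧ |fderiv ℝ f z (0, 1)| ≤ M := by
  obtain ⟨M₁, h₁⟩ := hc.exists_bound_of_continuous hf.continuous
  obtain ⟨M₂, h₂⟩ := (hc.fderiv (𝕜 := ℝ)).exists_bound_of_continuous
    (hf.continuous_fderiv (by simp))
  refine ⟨max M₁ M₂, fun z => ⟨(h₁ z).trans (le_max_left _ _), ?_⟩⟩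
  refine ((fderiv ℝ f z).le_opNorm (0, 1)).trans (le_trans ?_ (le_max_right M₁ M₂))
  have : ‖((0 : ℝ), (1 : ℝ))‖ = 1 := by simp [Prod.norm_def]
  rw [this, mul_one]
  exact h₂ z

/-- Small linear combinations of smooth functions of compact support are the vertical displacements
of diffeomorphisms. -/
theorem PlaneDiffeo.exists_shear_sum {κ : Type*} [Fintype κ] {u : κ → ℝ × ℝ → ℝ}
    (hu : ∀ i, ContDiff ℝ ∞ (u i)) (hc : ∀ i, HasCompactSupport (u i)) :
    ∃ δ > 0, ∀ c : κ → ℝ, (∀ i, |c i| < δ) →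
      ∃ Φ : PlaneDiffeo, ∀ z, Φ z = (z.1, z.2 + ∑ i, c i * u i z) := by
  choose M hM using fun i => exists_bound_fderiv (hu i) (hc i)
  have hM0 : ∀ i, 0 ≤ M i := fun i => (abs_nonneg _).trans (hM i 0).1
  have hS : 0 ≤ ∑ i, M i := Finset.sum_nonneg fun i _ => hM0 i
  -- With coefficients below this value both the displacement and its vertical derivative have
  -- absolute value less than 1, as `exists_shear` requires.
  refine ⟨1 / (1 + ∑ i, M i), by positivity, fun c hcδ => ?_⟩
  have hbound : ∀ v : κ → ℝ, (∀ i, |v i| ≤ M i) → |∑ i, c i * v i| < 1 := by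
    intro v hv
    calc |∑ i, c i * v i| ≤ ∑ i, |c i * v i| := Finset.abs_sum_le_sum_abs _ _
      _ ≤ ∑ i, 1 / (1 + ∑ i, M i) * M i := by
        refine Finset.sum_le_sum fun i _ => ?_
        rw [abs_mul]
        exact mul_le_mul (hcδ i).le (hv i) (abs_nonneg _) (by positivity)
      _ = (∑ i, M i) / (1 + ∑ i, M i) := by rw [← Finset.mul_sum]; ring
      _ < 1 := by rw [div_lt_one (by positivity)]; linarith
  refine PlaneDiffeo.exists_shear (g := fun z => ∑ i, c i * u i z) (C := 1)
    (ContDiff.sum fun i _ => contDiff_const.mul (hu i))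
    (fun z => (hbound _ fun i => (hM i z).1).le) fun z => ?_
  have hd : HasFDerivAt (fun z => ∑ i, c i * u i z) (∑ i, c i • fderiv ℝ (u i) z) z :=
    HasFDerivAt.fun_sum fun i _ =>
      (((hu i).differentiable (by simp)) z).hasFDerivAt.const_mul (c i)
  rw [hd.fderiv]
  have := (abs_lt.1 (hbound (fun i => fderiv ℝ (u i) z (0, 1)) fun i => (hM i z).2)).1
  simpa using this

section MoveCrossings

variable {ι : Type*}

/-- The set of crossings with given positions, given heights and a common radius. -/
def crossingFamily (pos : ι → ℕ) (t : ι → ℝ) (r : ℝ) : Set Crossing :=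
  Set.range fun e => ⟨pos e, t e, r⟩

/-- The heights and the radii for which the crossings take place at heights in `(0, 1)`, those of
related crossings one after the other. -/
def crossingConf (R : ι → ι → Prop) : Set ((ι → ℝ) × ℝ) :=
  {p | 0 < p.2 ∧ (∀ e, 0 < p.1 e - p.2 ∧ p.1 e + p.2 < 1) ∧
    ∀ e f, R e f → p.1 e + p.2 < p.1 f - p.2}

/-- Every condition is a strict linear inequality. Convexity supplies the connectedness that turns
local isotopies into global ones. -/
theorem convex_crossingConf (R : ι → ι → Prop) : Convex ℝ (crossingConf R) := by
  have key : ∀ {u v a b : ℝ}, 0 < u → 0 < v → 0 ≤ a → 0 ≤ b → a + b = 1 → 0 < a * u + b * v :=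
    fun hu hv ha hb hab => (convex_Ioi (0 : ℝ)) hu hv ha hb hab
  rintro p ⟨hp0, hp1, hp2⟩ p' ⟨hp0', hp1', hp2'⟩ a b ha hb hab
  refine ⟨?_, fun e => ⟨?_, ?_⟩, fun e f hef => ?_⟩
  · exact key hp0 hp0' ha hb hab
  · have := key (hp1 e).1 (hp1' e).1 ha hb hab
    simp only [Prod.fst_add, Prod.smul_fst, Pi.add_apply, Pi.smul_apply, smul_eq_mul, Prod.snd_add,
      Prod.smul_snd]
    linarith
  · have := key (sub_pos.2 (hp1 e).2) (sub_pos.2 (hp1' e).2) ha hb hab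
    simp only [Prod.fst_add, Prod.smul_fst, Pi.add_apply, Pi.smul_apply, smul_eq_mul, Prod.snd_add,
      Prod.smul_snd]
    linarith
  · have := key (sub_pos.2 (hp2 e f hef)) (sub_pos.2 (hp2' e f hef)) ha hb hab
    simp only [Prod.fst_add, Prod.smul_fst, Pi.add_apply, Pi.smul_apply, smul_eq_mul, Prod.snd_add,
      Prod.smul_snd]
    linarith

/-- A diffeomorphism which is supported in the box of the pictures of `k` arcs and which takes one
set to another. -/
def BoxIsotopic (k : ℕ) (P P' : Set (ℝ × ℝ)) : Prop :=
  ∃ Φ : PlaneDiffeo, (∀ z ∉ twinBox k, Φ z = z) ∧ Φ '' P = P'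

theorem BoxIsotopic.symm {k : ℕ} {P P' : Set (ℝ × ℝ)} (h : BoxIsotopic k P P') :
    BoxIsotopic k P' P := by
  obtain ⟨Φ, h1, rfl⟩ := h
  refine ⟨Φ.symm, fun z hz => ?_, ?_⟩
  · conv_lhs => rw [← h1 z hz]
    exact Φ.symm_apply_apply z
  · rw [← Set.image_comp, ← Diffeomorph.coe_trans, Diffeomorph.self_trans_symm,
      Diffeomorph.coe_refl, Set.image_id]

theorem BoxIsotopic.trans {k : ℕ} {P P' P'' : Set (ℝ × ℝ)} (h : BoxIsotopic k P P')
    (h' : BoxIsotopic k P' P'') : BoxIsotopic k P P'' := by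
  obtain ⟨Φ, h1, rfl⟩ := h
  obtain ⟨Ψ, h2, rfl⟩ := h'
  refine ⟨Φ.trans Ψ, fun z hz => ?_, PlaneDiffeo.image_trans _ _ _⟩
  rw [Diffeomorph.coe_trans, Function.comp_apply, h1 z hz, h2 z hz]

/-- A diffeomorphism which preserves the vertical lines and moves the heights of the crossings
correctly takes one picture to another. -/
theorem image_crossPic_of_shear {k : ℕ} {pos : ι → ℕ} {t t' : ι → ℝ} {r r' : ℝ} (hr : 0 < r)
    (hr' : 0 < r') (Φ : PlaneDiffeo) (h1 : ∀ z, (Φ z).1 = z.1)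
    (hmono : ∀ x, StrictMono fun y => (Φ (x, y)).2)
    (h0 : ∀ x, Φ (x, 0) = (x, 0)) (h1' : ∀ x, Φ (x, 1) = (x, 1))
    (hcore : ∀ e, ∀ x ∈ Set.Icc (pos e + 1 : ℝ) (pos e + 2), ∀ y, |y - t e| ≤ r →
      (Φ (x, y)).2 = t' e + r' / r * (y - t e)) :
    Φ '' crossPic k (crossingFamily pos t r) = crossPic k (crossingFamily pos t' r') := by
  -- The ends t ± r of the active interval go to t' ± r', and the map is increasing on the vertical
  -- line, so active heights correspond exactly.
  have hact : ∀ e, ∀ x ∈ Set.Icc (pos e + 1 : ℝ) (pos e + 2), ∀ y,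
      |(Φ (x, y)).2 - t' e| ≤ r' ↔ |y - t e| ≤ r := by
    intro e x hx y
    have e1 := hcore e x hx (t e - r) (by rw [abs_le]; constructor <;> linarith)
    have e2 := hcore e x hx (t e + r) (by rw [abs_le]; constructor <;> linarith)
    have e3 : r' / r * (t e - r - t e) = -r' := by field_simp; ring
    have e4 : r' / r * (t e + r - t e) = r' := by field_simp; ring
    have m1 := (hmono x).le_iff_le (a := t e - r) (b := y)
    have m2 := (hmono x).le_iff_le (a := y) (b := t e + r)
    simp only [e1, e2, e3, e4] at m1 m2
    rw [abs_le, abs_le]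
    constructor
    · rintro ⟨a, b⟩
      have := m1.1 (by linarith)
      have := m2.1 (by linarith)
      constructor <;> linarith
    · rintro ⟨a, b⟩
      have := m1.2 (by linarith)
      have := m2.2 (by linarith)
      constructor <;> linarith
  have hiff : ∀ z, Φ z ∈ crossPic k (crossingFamily pos t' r') ↔
      z ∈ crossPic k (crossingFamily pos t r) := by
    rintro ⟨x, y⟩
    have hx : (Φ (x, y)).1 = x := h1 _
    have i0 := (hmono x).le_iff_le (a := 0) (b := y)
    have i1 := (hmono x).le_iff_le (a := y) (b := 1)
    simp only [h0, h1'] at i0 i1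
    refine and_congr (and_congr i0 i1) (or_congr ?_ ?_)
    · simp only [crossingFamily, Set.exists_range_iff]
      refine exists_congr fun e => ?_
      by_cases hxe : x ∈ Set.Icc (pos e + 1 : ℝ) (pos e + 2)
      · simp only [Crossing.graph, Set.mem_ofPred_eq, hact e x hxe y, hx]
        refine and_congr_right fun hy => ?_
        have : Crossing.step ⟨pos e, t' e, r'⟩ (Φ (x, y)).2 = Crossing.step ⟨pos e, t e, r⟩ y := by
          simp only [Crossing.step]
          rw [hcore e x hxe y hy]
          congr 1
          field_simp
          ring
        rw [this]
      · refine ⟨fun h => absurd ?_ hxe, fun h => absurd ?_ hxe⟩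
        · have := Crossing.graph_fst_mem h
          rwa [hx] at this
        · exact Crossing.graph_fst_mem h
    · refine exists_congr fun l => and_congr_right fun _ => ?_
      rw [hx]
      refine and_congr_right fun hl => ?_
      simp only [crossingFamily, Set.forall_mem_range]
      refine forall_congr' fun e => imp_congr_right fun hle => ?_
      rw [← not_le, ← not_le, not_iff_not]
      refine hact e x ?_ y
      rw [hl]
      rcases hle with rfl | rfl <;> constructor <;> push_cast <;> linarith
  ext z
  constructor
  · rintro ⟨z, hz, rfl⟩
    exact (hiff z).2 hz
  · intro hz
    obtain ⟨z, rfl⟩ : ∃ z', Φ z' = z := Φ.surjective z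
    exact ⟨z, (hiff z).1 hz, rfl⟩

variable [Fintype ι]

open Filter Topology in
-- For small changes, a vertical shear supported near the crossings translates and rescales each of
-- them. Crossings whose columns interfere are ordered by `R`, hence have disjoint ranges of
-- heights, so the cutoffs do not disturb each other's cores.
theorem eventually_boxIsotopic {k : ℕ} {pos : ι → ℕ} (hpos : ∀ e, pos e + 2 ≤ k)
    {R : ι → ι → Prop}
    (hR : ∀ e f, e ≠ f → pos e ≤ pos f + 1 → pos f ≤ pos e + 1 → R e f ∨ R f e)
    {p : (ι → ℝ) × ℝ} (hp : p ∈ crossingConf R) :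
    ∀ᶠ p' in 𝓝[crossingConf R] p, BoxIsotopic k (crossPic k (crossingFamily pos p.1 p.2))
      (crossPic k (crossingFamily pos p'.1 p'.2)) := by
  classical
  obtain ⟨t, r⟩ := p
  obtain ⟨hr, hbox, hsep⟩ := hp
  simp only at hr hbox hsep
  -- A margin smaller than all gaps between related crossings and to the top and bottom of the box,
  -- finitely many in number.
  obtain ⟨η, hη, hη1, hη2, hη3⟩ : ∃ η : ℝ, 0 < η ∧ (∀ e, η < t e - r) ∧
      (∀ e, η < 1 - (t e + r)) ∧ ∀ e f, R e f → η < t f - r - (t e + r) := by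
    have h1 : ∀ᶠ η in 𝓝[>] (0 : ℝ), (∀ e, η < t e - r) ∧
      (∀ e, η < 1 - (t e + r)) ∧ ∀ e f, R e f → η < t f - r - (t e + r) := by
      refine nhdsWithin_le_nhds ?_
      refine (eventually_all.2 fun e => eventually_lt_nhds (hbox e).1).and
        ((eventually_all.2 fun e => eventually_lt_nhds (by linarith [(hbox e).2])).and
        (eventually_all.2 fun e => eventually_all.2 fun f => ?_))
      by_cases hef : R e f
      · filter_upwards [eventually_lt_nhds (sub_pos.2 (hsep e f hef))] with η h _ using h
      · exact Eventually.of_forall fun η h => absurd h hef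
    obtain ⟨η, h, h0⟩ := (h1.and self_mem_nhdsWithin).exists
    exact ⟨η, h0, h⟩
  let A : ∀ e, ContDiffBump (pos e + 3 / 2 : ℝ) := fun e => ⟨1 / 2, 1, by norm_num, by norm_num⟩
  let B : ∀ e, ContDiffBump (t e) := fun e => ⟨r, r + η, hr, by linarith⟩
  let χ : ι → ℝ × ℝ → ℝ := fun e z => A e z.1 * B e z.2
  have hχ : ∀ e, ContDiff ℝ ∞ (χ e) := fun e =>
    ((A e).contDiff.comp contDiff_fst).mul ((B e).contDiff.comp contDiff_snd)
  have hχ0 : ∀ (e : ι) (z : ℝ × ℝ), ¬ (|z.1 - (pos e + 3 / 2 : ℝ)| < 1 ∧ |z.2 - t e| < r + η) →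
      χ e z = 0 := by
    intro e z h
    rw [not_and_or, not_lt, not_lt] at h
    rcases h with h | h
    · simp only [χ]
      rw [(A e).zero_of_le_dist (by rwa [Real.dist_eq]), zero_mul]
    · simp only [χ]
      rw [(B e).zero_of_le_dist (by rwa [Real.dist_eq]), mul_zero]
  have hχ1 : ∀ (e : ι) (z : ℝ × ℝ), z.1 ∈ Set.Icc (pos e + 1 : ℝ) (pos e + 2) →
      |z.2 - t e| ≤ r → χ e z = 1 := by
    intro e z h h'
    simp only [χ]
    rw [(A e).one_of_mem_closedBall, (B e).one_of_mem_closedBall, mul_one]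
    · rwa [Metric.mem_closedBall, Real.dist_eq]
    · rw [Metric.mem_closedBall, Real.dist_eq, abs_le]
      constructor
      · show -(1 / 2 : ℝ) ≤ _
        linarith [h.1]
      · show _ ≤ (1 / 2 : ℝ)
        linarith [h.2]
  -- The first summand translates a crossing; the second dilates it about its height, since the
  -- common radius changes too.
  let u : ι ⊕ ι → ℝ × ℝ → ℝ := Sum.elim χ fun e z => χ e z * (z.2 - t e)
  have hu : ∀ i, ContDiff ℝ ∞ (u i) := by
    rintro (e | e)
    · exact hχ e
    · exact (hχ e).mul (contDiff_snd.sub contDiff_const)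
  have huc : ∀ i, HasCompactSupport (u i) := by
    have : ∀ e, HasCompactSupport (χ e) := by
      intro e
      refine HasCompactSupport.of_support_subset_isCompact
        ((isCompact_closedBall (pos e + 3 / 2 : ℝ) 1).prod (isCompact_closedBall (t e) (r + η))) ?_
      intro z hz
      by_contra hz'
      refine hz (hχ0 e z fun h => hz' ⟨?_, ?_⟩)
      · rw [Metric.mem_closedBall, Real.dist_eq]; exact h.1.le
      · rw [Metric.mem_closedBall, Real.dist_eq]; exact h.2.le
    rintro (e | e)
    · exact this e
    · exact (this e).mul_right
  obtain ⟨δ, hδ, hΦ⟩ := PlaneDiffeo.exists_shear_sum hu huc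
  have hev : ∀ᶠ p' : (ι → ℝ) × ℝ in 𝓝 (t, r), (∀ e, |p'.1 e - t e| < δ) ∧ |p'.2 / r - 1| < δ := by
    refine (eventually_all.2 fun e => ?_).and ?_
    · have hc : Continuous fun p' : (ι → ℝ) × ℝ => |p'.1 e - t e| := by fun_prop
      refine hc.continuousAt.eventually_lt continuousAt_const ?_
      simpa using hδ
    · have hc : Continuous fun p' : (ι → ℝ) × ℝ => |p'.2 / r - 1| := by fun_prop
      refine hc.continuousAt.eventually_lt continuousAt_const ?_
      simpa [hr.ne'] using hδ
  filter_upwards [nhdsWithin_le_nhds hev, self_mem_nhdsWithin]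
  rintro ⟨t', r'⟩ ⟨hd, hε⟩ ⟨hr', -, -⟩
  simp only at hd hε hr'
  obtain ⟨Φ, hΦ⟩ := hΦ (Sum.elim (fun e => t' e - t e) fun _ => r' / r - 1)
    (by rintro (e | e); exacts [hd e, hε])
  have hg : ∀ z, Φ z = (z.1, z.2 + ∑ e, χ e z * (t' e - t e + (r' / r - 1) * (z.2 - t e))) := by
    intro z
    rw [hΦ, Fintype.sum_sum_type, ← Finset.sum_add_distrib]
    congr 2
    refine Finset.sum_congr rfl fun e _ => ?_
    simp only [Sum.elim_inl, Sum.elim_inr, u]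
    ring
  have hfix : ∀ z, (∀ e, χ e z = 0) → Φ z = z := by
    intro z hz
    rw [hg, Finset.sum_eq_zero fun e _ => by rw [hz e, zero_mul], add_zero]
  refine ⟨Φ, fun z hz => hfix z fun e => hχ0 e z fun h => hz ?_, ?_⟩
  · have h1 := abs_lt.1 h.1
    have h2 := abs_lt.1 h.2
    have h3 : (pos e + 2 : ℝ) ≤ k := by exact_mod_cast hpos e
    have h4 : (0 : ℝ) ≤ pos e := Nat.cast_nonneg _
    have h5 := hη1 e
    have h6 := hη2 e
    exact ⟨⟨by linarith, by linarith⟩, by linarith, by linarith⟩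
  · have hfst : ∀ z, (Φ z).1 = z.1 := fun z => by rw [hg]
    have hcore : ∀ e, ∀ x ∈ Set.Icc (pos e + 1 : ℝ) (pos e + 2), ∀ y, |y - t e| ≤ r →
        (Φ (x, y)).2 = t' e + r' / r * (y - t e) := by
      intro e x hx y hy
      rw [hg, Fintype.sum_eq_single e, hχ1 e (x, y) hx hy]
      · simp only; ring
      · intro f hfe
        rw [hχ0 f (x, y), zero_mul]
        rintro ⟨hf1, hf2⟩
        have hf1 := abs_lt.1 hf1
        have hf2 := abs_lt.1 hf2
        have hy := abs_le.1 hy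
        simp only at hf1 hf2
        have c1 : (pos f : ℝ) < pos e + 2 := by linarith [hx.2]
        have c2 : (pos e : ℝ) < pos f + 2 := by linarith [hx.1]
        have c1 : pos f < pos e + 2 := by exact_mod_cast c1
        have c2 : pos e < pos f + 2 := by exact_mod_cast c2
        rcases hR e f hfe.symm (by omega) (by omega) with h | h
        · have := hη3 _ _ h
          linarith [hf2.1]
        · have := hη3 _ _ h
          linarith [hf2.2]
    have hend : ∀ x y, y = 0 ∨ y = 1 → Φ (x, y) = (x, y) := by
      intro x y hy
      refine hfix _ fun e => hχ0 e _ fun h => ?_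
      have h2 := abs_lt.1 h.2
      have h5 := hη1 e
      have h6 := hη2 e
      simp only at h2
      rcases hy with rfl | rfl <;> linarith
    refine image_crossPic_of_shear hr hr' Φ hfst ?_ (fun x => hend x 0 (Or.inl rfl))
      (fun x => hend x 1 (Or.inr rfl)) hcore
    intro x
    -- A continuous injection of the line is strictly monotone, and fixing 0 and 1 excludes the
    -- decreasing case.
    have hinj : Function.Injective fun y => (Φ (x, y)).2 := by
      intro y y' hyy
      have : Φ (x, y) = Φ (x, y') := Prod.ext (by rw [hfst, hfst]) hyy
      exact congrArg Prod.snd (Φ.injective this)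
    have hcont : Continuous fun y => (Φ (x, y)).2 :=
      continuous_snd.comp (Φ.contDiff.continuous.comp (by fun_prop))
    rcases hcont.strictMono_of_inj hinj with h | h
    · exact h
    · have := h (show (0 : ℝ) < 1 by norm_num)
      simp only [hend x 0 (Or.inl rfl), hend x 1 (Or.inr rfl)] at this
      linarith

/-- Pictures whose crossings have the same positions and take place in the same order up to
commutation of distant crossings are isotopic. -/
theorem boxIsotopic_crossingFamily {k : ℕ} {pos : ι → ℕ} (hpos : ∀ e, pos e + 2 ≤ k)
    {R : ι → ι → Prop}
    (hR : ∀ e f, e ≠ f → pos e ≤ pos f + 1 → pos f ≤ pos e + 1 → R e f ∨ R f e)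
    {t t' : ι → ℝ} {r r' : ℝ} (h : (t, r) ∈ crossingConf R) (h' : (t', r') ∈ crossingConf R) :
    BoxIsotopic k (crossPic k (crossingFamily pos t r)) (crossPic k (crossingFamily pos t' r')) :=
  -- Isotopy is an equivalence relation that holds between nearby configurations, and the space of
  -- configurations is connected.
  (convex_crossingConf R).isPreconnected.induction₂
    (fun p p' => BoxIsotopic k (crossPic k (crossingFamily pos p.1 p.2))
      (crossPic k (crossingFamily pos p'.1 p'.2)))
    (fun _ hp => eventually_boxIsotopic hpos hR hp)
    (fun _ _ _ _ _ _ h1 h2 => h1.trans h2) (fun _ _ _ _ h1 => h1.symm) h h'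

end MoveCrossings

/-! ## Replacing the arcs of a link projection in a box -/

/-- The picture formed by the graphs of the given functions of the height. -/
def strandPic {k : ℕ} (c : Fin k → ℝ → ℝ) : Set (ℝ × ℝ) :=
  {z | z.2 ∈ Set.Icc (0 : ℝ) 1 ∧ ∃ l, z.1 = c l z.2}

/-- Smooth functions which form a picture of arcs in the box without tangencies. -/
structure IsStrandSystem {k : ℕ} (c : Fin k → ℝ → ℝ) : Prop where
  smooth : ∀ l, ContDiff ℝ ∞ (c l)
  mem_Ioo : ∀ l y, c l y ∈ Set.Ioo (1 / 2 : ℝ) (k + 1 / 2)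
  transverse : ∀ l m y, l ≠ m → c l y = c m y → deriv (c l) y ≠ deriv (c m) y
  no_triple : ∀ l m n y, l ≠ m → m ≠ n → l ≠ n → ¬ (c l y = c m y ∧ c m y = c n y)

/-- The interior of `twinBox k`, but for `k = 0`. -/
def twinBoxInterior (k : ℕ) : Set (ℝ × ℝ) := Set.Ioo (1 / 2 : ℝ) (k + 1 / 2) ×ˢ Set.Ioo (0 : ℝ) 1

theorem isOpen_twinBoxInterior (k : ℕ) : IsOpen (twinBoxInterior k) := isOpen_Ioo.prod isOpen_Ioo

theorem twinBoxInterior_subset (k : ℕ) : twinBoxInterior k ⊆ twinBox k :=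
  Set.prod_mono Set.Ioo_subset_Icc_self Set.Ioo_subset_Icc_self

/-- At the parameter `s`, the curve `β` touches the graph of the function `c` of the height. -/
def FollowsAt (c : ℝ → ℝ) (β : ℝ → ℝ × ℝ) (s : ℝ) : Prop :=
  (β s).1 = c (β s).2 ∧ (deriv β s).1 = deriv c (β s).2 * (deriv β s).2

section Follow

variable {k : ℕ} {c : Fin k → ℝ → ℝ} {β : ℝ → ℝ × ℝ}

theorem hasDerivAt_fst_snd (hβ : ContDiff ℝ ∞ β) (s : ℝ) :
    HasDerivAt (fun s => (β s).1) (deriv β s).1 s ∧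
    HasDerivAt (fun s => (β s).2) (deriv β s).2 s := by
  have h := (hβ.differentiable (by simp) s).hasDerivAt
  exact ⟨(hasFDerivAt_fst (𝕜 := ℝ) (p := β s)).comp_hasDerivAt s h,
    (hasFDerivAt_snd (𝕜 := ℝ) (p := β s)).comp_hasDerivAt s h⟩

theorem hasDerivAt_comp_snd (hβ : ContDiff ℝ ∞ β) {f : ℝ → ℝ} (hf : ContDiff ℝ ∞ f)
    (s : ℝ) :
    HasDerivAt (fun s => f (β s).2) (deriv f (β s).2 * (deriv β s).2) s :=
  (hf.differentiable (by simp) (β s).2).hasDerivAt.comp s (hasDerivAt_fst_snd hβ s).2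

theorem isClosed_followsAt (hβ : ContDiff ℝ ∞ β) {f : ℝ → ℝ} (hf : ContDiff ℝ ∞ f) :
    IsClosed {s | FollowsAt f β s} := by
  have h1 := hβ.continuous
  have h2 := hβ.continuous_deriv (by simp)
  have h3 := hf.continuous
  have h4 := hf.continuous_deriv (by simp)
  exact (isClosed_eq (by fun_prop) (by fun_prop)).inter
    (isClosed_eq (by fun_prop) (by fun_prop))

/-- The velocity is a multiple of the direction (slope, 1) of the graph, so if its vertical
component vanished it would be zero. -/
theorem snd_deriv_ne_zero {f : ℝ → ℝ} {s : ℝ} (h : FollowsAt f β s) (hs : deriv β s ≠ 0) :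
    (deriv β s).2 ≠ 0 := by
  intro h0
  apply hs
  ext
  · rw [h.2, h0, mul_zero]; rfl
  · exact h0

theorem followsAt_unique (hc : IsStrandSystem c) {s : ℝ} (hs : deriv β s ≠ 0) {l m : Fin k}
    (hl : FollowsAt (c l) β s) (hm : FollowsAt (c m) β s) : l = m := by
  by_contra hlm
  refine hc.transverse l m _ hlm (hl.1.symm.trans hm.1) ?_
  exact mul_right_cancel₀ (snd_deriv_ne_zero hl hs) (hl.2.symm.trans hm.2)

open Filter Topology in
-- If the curve were tangent to no strand at `s`, it would avoid each of the finitely many strands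
-- on a punctured neighbourhood of `s`, contrary to `hs`.
theorem exists_followsAt (hc : IsStrandSystem c) (hβ : ContDiff ℝ ∞ β)
    {s : ℝ} (hs : ∀ᶠ s' in 𝓝 s, ∃ l, (β s').1 = c l (β s').2) :
    ∃ l, FollowsAt (c l) β s := by
  by_contra hno
  push Not at hno
  have hne : ∀ l, ∀ᶠ s' in 𝓝[≠] s, (β s').1 ≠ c l (β s').2 := by
    intro l
    have hd := (hasDerivAt_fst_snd hβ s).1.sub (hasDerivAt_comp_snd hβ (hc.smooth l) s)
    by_cases h0 : (β s).1 = c l (β s).2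
    · have h1 : (deriv β s).1 - deriv (c l) (β s).2 * (deriv β s).2 ≠ 0 :=
        fun h => hno l ⟨h0, sub_eq_zero.1 h⟩
      filter_upwards [hd.eventually_ne (c := 0) h1] with s' h
      exact sub_ne_zero.1 h
    · refine nhdsWithin_le_nhds ?_
      filter_upwards [hd.continuousAt.eventually_ne (sub_ne_zero.2 h0)] with s' h
      exact sub_ne_zero.1 h
  obtain ⟨s', ⟨l, hl⟩, h⟩ :=
    ((hs.filter_mono nhdsWithin_le_nhds).and (eventually_all.2 hne)).exists
  exact h l hl

open Filter Topology in
-- The strand followed is locally constant: each strand is followed on a closed set of parameters,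
-- these finitely many sets are disjoint, and they cover `U`.
theorem eventually_followsAt (hc : IsStrandSystem c) (hβ : ContDiff ℝ ∞ β)
    (hβ' : ∀ s, deriv β s ≠ 0) {U : Set ℝ} (hU : IsOpen U)
    (hUc : ∀ s ∈ U, ∃ l, (β s).1 = c l (β s).2) {s : ℝ} (hs : s ∈ U) {l : Fin k}
    (hl : FollowsAt (c l) β s) : ∀ᶠ s' in 𝓝 s, s' ∈ U ∧ FollowsAt (c l) β s' := by
  have hne : ∀ᶠ s' in 𝓝 s, ∀ m, m ≠ l → ¬ FollowsAt (c m) β s' := by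
    refine eventually_all.2 fun m => ?_
    by_cases hm : m = l
    · exact Eventually.of_forall fun s' h => absurd hm h
    · have := (isClosed_followsAt hβ (hc.smooth m)).isOpen_compl.mem_nhds
        (fun h => hm (followsAt_unique hc (hβ' s) h hl) : s ∈ {s | FollowsAt (c m) β s}ᶜ)
      filter_upwards [this] with s' h _ using h
  filter_upwards [hne, hU.mem_nhds hs] with s' h hs'
  obtain ⟨m, hm⟩ := exists_followsAt hc hβ (s := s')
    (Filter.eventually_of_mem (hU.mem_nhds hs') hUc)
  by_cases hml : m = l
  · exact ⟨hs', hml ▸ hm⟩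
  · exact absurd hm (h m hml)

end Follow

theorem linearIndependent_pair_of_slopes {p q a b : ℝ} (hpq : p ≠ q) (ha : a ≠ 0) (hb : b ≠ 0) :
    LinearIndependent ℝ ![((p * a, a) : ℝ × ℝ), (q * b, b)] := by
  rw [LinearIndependent.pair_iff]
  intro x y h
  have h1 : x * (p * a) + y * (q * b) = 0 := congrArg Prod.fst h
  have h2 : x * a + y * b = 0 := congrArg Prod.snd h
  have h3 : y * b * (q - p) = 0 := by linear_combination h1 - p * h2
  have h4 : y * b = 0 := (mul_eq_zero.1 h3).resolve_right (sub_ne_zero.2 hpq.symm)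
  rw [h4, add_zero] at h2
  exact ⟨(mul_eq_zero.1 h2).resolve_right ha, (mul_eq_zero.1 h4).resolve_right hb⟩

theorem not_linearIndependent_pair_of_slope {p a b : ℝ} (ha : a ≠ 0) :
    ¬ LinearIndependent ℝ ![((p * a, a) : ℝ × ℝ), (p * b, b)] := by
  rw [LinearIndependent.pair_iff]
  intro h
  have := (h b (-a) (by ext <;> simp <;> ring)).2
  exact ha (neg_eq_zero.1 this)

section Replace

variable {k m : ℕ} {c c' : Fin k → ℝ → ℝ} {γ : Fin m → ℝ → ℝ × ℝ} {E : Set (ℝ × ℝ)}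

open Filter Topology in
/-- Every strand is followed at every height. -/
theorem exists_followsAt_of_height (hc : IsStrandSystem c) (hγ : IsGenericImmersion γ)
    (hin : ∀ i s, γ i s ∈ twinBoxInterior k → ∃ l, (γ i s).1 = c l (γ i s).2)
    (hD : strandPic c ⊆ ⋃ i, Set.range (γ i)) (l : Fin k) {y : ℝ} (hy : y ∈ Set.Ioo (0 : ℝ) 1) :
    ∃ i s, FollowsAt (c l) (γ i) s ∧ (γ i s).2 = y := by
  -- The heights at which the strand is followed form a closed set, by compactness of a period.
  -- Where `l` meets no other strand the projection must follow it; crossing heights are then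
  -- reached as limits.
  let Q : Set ℝ := ⋃ i, (fun s => (γ i s).2) '' (Set.Icc (0 : ℝ) 1 ∩ {s | FollowsAt (c l) (γ i) s})
  have hQ : IsClosed Q := by
    refine isClosed_iUnion_of_finite fun i => IsCompact.isClosed ?_
    refine IsCompact.image (isCompact_Icc.inter_right
      (isClosed_followsAt (hγ.smooth i) (hc.smooth l))) ?_
    exact continuous_snd.comp (hγ.smooth i).continuous
  have hev : ∀ᶠ y' in 𝓝[≠] y, y' ∈ Q := by
    have hne : ∀ n, n ≠ l → ∀ᶠ y' in 𝓝[≠] y, c n y' ≠ c l y' := by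
      intro n hn
      have hd := ((hc.smooth n).differentiable (by simp) y).hasDerivAt.sub
        ((hc.smooth l).differentiable (by simp) y).hasDerivAt
      by_cases h0 : c n y = c l y
      · filter_upwards [hd.eventually_ne (c := 0)
          (sub_ne_zero.2 (hc.transverse n l y hn h0))] with y' h
        exact sub_ne_zero.1 h
      · refine nhdsWithin_le_nhds ?_
        filter_upwards [hd.continuousAt.eventually_ne (sub_ne_zero.2 h0)] with y' h
        exact sub_ne_zero.1 h
    have hne' : ∀ᶠ y' in 𝓝[≠] y, ∀ n, n ≠ l → c n y' ≠ c l y' := by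
      refine eventually_all.2 fun n => ?_
      by_cases hn : n = l
      · exact Eventually.of_forall fun _ h => absurd hn h
      · filter_upwards [hne n hn] with y' h _ using h
    filter_upwards [hne', nhdsWithin_le_nhds (isOpen_Ioo.mem_nhds hy)] with y' h hy'
    have hmem : (c l y', y') ∈ strandPic c := ⟨Set.Ioo_subset_Icc_self hy', l, rfl⟩
    obtain ⟨i, s₀, hs₀⟩ := Set.mem_iUnion.1 (hD hmem)
    obtain ⟨s, hs, hs'⟩ := (hγ.periodic i).exists_mem_Ico₀ one_pos s₀
    rw [hs'] at hs₀
    have hopen : IsOpen {s | γ i s ∈ twinBoxInterior k} :=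
      (isOpen_twinBoxInterior k).preimage (hγ.smooth i).continuous
    have hsV : γ i s ∈ twinBoxInterior k := by
      rw [hs₀]; exact ⟨hc.mem_Ioo l y', hy'⟩
    obtain ⟨n, hn⟩ := exists_followsAt hc (hγ.smooth i) (s := s)
      (Filter.eventually_of_mem (hopen.mem_nhds hsV) fun s' hs' => hin i s' hs')
    have hnl : n = l := by
      by_contra hnl
      refine h n hnl ?_
      have := hn.1
      rw [hs₀] at this
      exact this.symm
    subst hnl
    exact Set.mem_iUnion.2 ⟨i, s, ⟨Set.Ico_subset_Icc_self hs, hn⟩, by simp only [hs₀]⟩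
  have hyQ : y ∈ Q := hQ.mem_of_frequently_of_tendsto hev.frequently
    (tendsto_id.mono_left nhdsWithin_le_nhds)
  obtain ⟨i, s, ⟨-, hs⟩, hsy⟩ := Set.mem_iUnion.1 hyQ
  exact ⟨i, s, hs, hsy⟩

open Classical in
/-- The curve which follows the strands of `c'` instead of those of `c`. -/
noncomputable def replaceStrands (c c' : Fin k → ℝ → ℝ) (β : ℝ → ℝ × ℝ) (s : ℝ) : ℝ × ℝ :=
  if h : β s ∈ twinBoxInterior k ∧ ∃ l, FollowsAt (c l) β s then (c' h.2.choose (β s).2, (β s).2)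
  else β s

theorem replaceStrands_of_followsAt (hc : IsStrandSystem c) {β : ℝ → ℝ × ℝ} {s : ℝ}
    (hβ' : deriv β s ≠ 0) (hs : β s ∈ twinBoxInterior k) {l : Fin k}
    (hl : FollowsAt (c l) β s) : replaceStrands c c' β s = (c' l (β s).2, (β s).2) := by
  have h : β s ∈ twinBoxInterior k ∧ ∃ l, FollowsAt (c l) β s := ⟨hs, l, hl⟩
  rw [replaceStrands, dif_pos h, followsAt_unique hc hβ' h.2.choose_spec hl]

theorem replaceStrands_of_notMem {β : ℝ → ℝ × ℝ} {s : ℝ} (hs : β s ∉ twinBoxInterior k) :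
    replaceStrands c c' β s = β s :=
  dif_neg fun h => hs h.1

open Filter Topology in
/-- A link projection remains one when the strands in a box are replaced by others with the
same ends. -/
theorem IsLinkProjection.replace_strands (hc : IsStrandSystem c) (hc' : IsStrandSystem c') {δ : ℝ}
    (hδ : 0 < δ) (heq : ∀ l y, y ∉ Set.Ioo δ (1 - δ) → c' l y = c l y)
    (hE : Disjoint E (twinBox k)) (hD : IsLinkProjection (E ∪ strandPic c)) :
    IsLinkProjection (E ∪ strandPic c') := by
  obtain ⟨m, γ, hm, hγ, hD⟩ := hD
  have hin : ∀ i s, γ i s ∈ twinBoxInterior k → ∃ l, (γ i s).1 = c l (γ i s).2 := by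
    intro i s hs
    have h : γ i s ∈ E ∪ strandPic c := hD ▸ Set.mem_iUnion.2 ⟨i, s, rfl⟩
    rcases h with h | h
    · exact absurd (twinBoxInterior_subset k hs) (Set.disjoint_left.1 hE h)
    · exact h.2
  have hopen : ∀ i, IsOpen {s | γ i s ∈ twinBoxInterior k} := fun i =>
    (isOpen_twinBoxInterior k).preimage (hγ.smooth i).continuous
  have hex : ∀ i s, γ i s ∈ twinBoxInterior k → ∃ l, FollowsAt (c l) (γ i) s := fun i s hs =>
    exists_followsAt hc (hγ.smooth i)
      (Filter.eventually_of_mem ((hopen i).mem_nhds hs) fun s' hs' => hin i s' hs')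
  let γ' : Fin m → ℝ → ℝ × ℝ := fun i => replaceStrands c c' (γ i)
  have hevA : ∀ i s l, γ i s ∈ twinBoxInterior k → FollowsAt (c l) (γ i) s →
      γ' i =ᶠ[𝓝 s] fun s => (c' l (γ i s).2, (γ i s).2) := by
    intro i s l hs hl
    filter_upwards [eventually_followsAt hc (hγ.smooth i) (hγ.immersion i) (hopen i) (hin i) hs hl]
      with s' hs'
    exact replaceStrands_of_followsAt hc (hγ.immersion i s') hs'.1 hs'.2
  have hA : ∀ i s l, γ i s ∈ twinBoxInterior k → FollowsAt (c l) (γ i) s →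
      γ' i s = (c' l (γ i s).2, (γ i s).2) ∧
        HasDerivAt (γ' i) (deriv (c' l) (γ i s).2 * (deriv (γ i) s).2, (deriv (γ i) s).2) s := by
    intro i s l hs hl
    refine ⟨(hevA i s l hs hl).eq_of_nhds, HasDerivAt.congr_of_eventuallyEq ?_ (hevA i s l hs hl)⟩
    exact (hasDerivAt_comp_snd (hγ.smooth i) (hc'.smooth l) s).prodMk
      (hasDerivAt_fst_snd (hγ.smooth i) s).2
  -- The strands differ only in the closed set `K`. The part of the projection in `K` lies in the
  -- interior of the box, so a curve point outside the interior has a neighbourhood avoiding `K`,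
  -- where nothing changes.
  have hevB : ∀ i s, γ i s ∉ twinBoxInterior k → γ' i =ᶠ[𝓝 s] γ i := by
    intro i s hs
    let K : Set (ℝ × ℝ) := Set.Icc (1 / 2 : ℝ) (k + 1 / 2) ×ˢ Set.Icc δ (1 - δ)
    have hK : IsClosed K := isClosed_Icc.prod isClosed_Icc
    have hsK : γ i s ∉ K := by
      rintro ⟨h1, h2⟩
      have hy : (γ i s).2 ∈ Set.Ioo (0 : ℝ) 1 := ⟨by linarith [h2.1], by linarith [h2.2]⟩
      have hbox : γ i s ∈ twinBox k := ⟨h1, Set.Ioo_subset_Icc_self hy⟩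
      have h : γ i s ∈ E ∪ strandPic c := hD ▸ Set.mem_iUnion.2 ⟨i, s, rfl⟩
      rcases h with h | ⟨-, l, h⟩
      · exact Set.disjoint_left.1 hE h hbox
      · exact hs ⟨h ▸ hc.mem_Ioo l _, hy⟩
    have : ∀ᶠ s' in 𝓝 s, γ i s' ∉ K :=
      (hK.isOpen_compl.preimage (hγ.smooth i).continuous).mem_nhds hsK
    filter_upwards [this] with s' hs'
    by_cases hV : γ i s' ∈ twinBoxInterior k
    · obtain ⟨l, hl⟩ := hex i s' hV
      show replaceStrands c c' (γ i) s' = γ i s'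
      rw [replaceStrands_of_followsAt hc (hγ.immersion i s') hV hl]
      rw [heq l _ fun h => hs' ⟨Set.Ioo_subset_Icc_self hV.1, Set.Ioo_subset_Icc_self h⟩, ← hl.1]
    · exact replaceStrands_of_notMem hV
  have hB : ∀ i s, γ i s ∉ twinBoxInterior k → γ' i s = γ i s ∧ deriv (γ' i) s = deriv (γ i) s :=
    fun i s hs => ⟨(hevB i s hs).eq_of_nhds, (hevB i s hs).deriv_eq⟩
  have hmem : ∀ i s, γ' i s ∈ twinBoxInterior k ↔ γ i s ∈ twinBoxInterior k := by
    intro i s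
    by_cases hs : γ i s ∈ twinBoxInterior k
    · obtain ⟨l, hl⟩ := hex i s hs
      rw [(hA i s l hs hl).1]
      exact iff_of_true ⟨hc'.mem_Ioo l _, hs.2⟩ hs
    · rw [(hB i s hs).1]
  -- Two distinct parameters meeting after the replacement on the same strand would already have met
  -- before, with parallel velocities, against transversality.
  have hdiff : ∀ (a b : Fin m × Set.Ico (0 : ℝ) 1) (l n : Fin k), a ≠ b →
      γ a.1 a.2 ∈ twinBoxInterior k → FollowsAt (c l) (γ a.1) a.2 →
      FollowsAt (c n) (γ b.1) b.2 → γ' a.1 a.2 = γ' b.1 b.2 → l ≠ n := by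
    rintro a b l n hab ha hl hn h rfl
    have hb : γ b.1 b.2 ∈ twinBoxInterior k := by rwa [← hmem, ← h, hmem]
    rw [(hA _ _ _ ha hl).1, (hA _ _ _ hb hn).1, Prod.mk.injEq] at h
    have hγab : γ a.1 a.2 = γ b.1 b.2 := by
      ext
      · rw [hl.1, hn.1, h.2]
      · exact h.2
    have hli := hγ.transverse a b hab hγab
    have e1 : deriv (γ a.1) a.2 = (deriv (c l) (γ a.1 a.2).2 * (deriv (γ a.1) a.2).2,
      (deriv (γ a.1) a.2).2) := Prod.ext hl.2 rfl
    have e2 : deriv (γ b.1) b.2 = (deriv (c l) (γ a.1 a.2).2 * (deriv (γ b.1) b.2).2,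
      (deriv (γ b.1) b.2).2) := Prod.ext (by rw [h.2]; exact hn.2) rfl
    rw [e1, e2] at hli
    exact not_linearIndependent_pair_of_slope
      (snd_deriv_ne_zero hl (hγ.immersion _ _)) hli
  refine ⟨m, γ', hm, ⟨fun i => ?_, fun i s => ?_, fun i s => ?_, fun a b hab h => ?_,
    fun a b d hab hbd had h => ?_⟩, ?_⟩
  · refine contDiff_iff_contDiffAt.2 fun s => ?_
    by_cases hs : γ i s ∈ twinBoxInterior k
    · obtain ⟨l, hl⟩ := hex i s hs
      refine ContDiffAt.congr_of_eventuallyEq ?_ (hevA i s l hs hl)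
      have h2 : ContDiff ℝ ∞ fun s => (γ i s).2 := contDiff_snd.comp (hγ.smooth i)
      exact (((hc'.smooth l).comp h2).prodMk h2).contDiffAt
    · exact (hγ.smooth i).contDiffAt.congr_of_eventuallyEq (hevB i s hs)
  · have hp : γ i (s + 1) = γ i s := hγ.periodic i s
    have hd : deriv (γ i) (s + 1) = deriv (γ i) s := by
      rw [← deriv_comp_add_const]
      congr 1
      ext1 s
      exact hγ.periodic i s
    by_cases hs : γ i s ∈ twinBoxInterior k
    · obtain ⟨l, hl⟩ := hex i s hs
      have hl' : FollowsAt (c l) (γ i) (s + 1) := by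
        rw [FollowsAt, hp, hd]; exact hl
      rw [(hA i s l hs hl).1, (hA i (s + 1) l (hp ▸ hs) hl').1, hp]
    · rw [(hB i s hs).1, (hB i (s + 1) (hp ▸ hs)).1, hp]
  · by_cases hs : γ i s ∈ twinBoxInterior k
    · obtain ⟨l, hl⟩ := hex i s hs
      rw [(hA i s l hs hl).2.deriv]
      exact fun h0 => snd_deriv_ne_zero hl (hγ.immersion i s) (congrArg Prod.snd h0)
    · rw [(hB i s hs).2]
      exact hγ.immersion i s
  · by_cases ha : γ a.1 a.2 ∈ twinBoxInterior k
    · have hb : γ b.1 b.2 ∈ twinBoxInterior k := by rwa [← hmem, ← h, hmem]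
      obtain ⟨l, hl⟩ := hex _ _ ha
      obtain ⟨n, hn⟩ := hex _ _ hb
      have hln := hdiff a b l n hab ha hl hn h
      rw [(hA _ _ _ ha hl).1, (hA _ _ _ hb hn).1, Prod.mk.injEq] at h
      rw [(hA _ _ _ ha hl).2.deriv, (hA _ _ _ hb hn).2.deriv, ← h.2]
      exact linearIndependent_pair_of_slopes (hc'.transverse l n _ hln (by rw [h.1, h.2]))
        (snd_deriv_ne_zero hl (hγ.immersion _ _)) (snd_deriv_ne_zero hn (hγ.immersion _ _))
    · have hb : γ b.1 b.2 ∉ twinBoxInterior k := by rwa [← hmem, ← h, hmem]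
      rw [(hB _ _ ha).2, (hB _ _ hb).2]
      rw [(hB _ _ ha).1, (hB _ _ hb).1] at h
      exact hγ.transverse a b hab h
  · by_cases ha : γ a.1 a.2 ∈ twinBoxInterior k
    · have hb : γ b.1 b.2 ∈ twinBoxInterior k := by rwa [← hmem, ← h.1, hmem]
      have hd : γ d.1 d.2 ∈ twinBoxInterior k := by rwa [← hmem, ← h.2, hmem]
      obtain ⟨l, hl⟩ := hex _ _ ha
      obtain ⟨n, hn⟩ := hex _ _ hb
      obtain ⟨q, hq⟩ := hex _ _ hd
      have h1 := hdiff a b l n hab ha hl hn h.1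
      have h2 := hdiff b d n q hbd hb hn hq h.2
      have h3 := hdiff a d l q had ha hl hq (h.1.trans h.2)
      rw [(hA _ _ _ ha hl).1, (hA _ _ _ hb hn).1, (hA _ _ _ hd hq).1, Prod.mk.injEq,
        Prod.mk.injEq] at h
      refine hc'.no_triple l n q (γ a.1 a.2).2 h1 h2 h3 ⟨?_, ?_⟩
      · rw [h.1.1, h.1.2]
      · rw [h.1.2, h.2.1, h.2.2]
    · have hb : γ b.1 b.2 ∉ twinBoxInterior k := by rwa [← hmem, ← h.1, hmem]
      have hd : γ d.1 d.2 ∉ twinBoxInterior k := by rwa [← hmem, ← h.2, hmem]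
      rw [(hB _ _ ha).1, (hB _ _ hb).1, (hB _ _ hd).1] at h
      exact hγ.no_triple a b d hab hbd had h
  · have hendpt : ∀ y ∈ Set.Icc (0 : ℝ) 1, y ∉ Set.Ioo (0 : ℝ) 1 → ∀ l, c' l y = c l y := by
      intro y _ hy' l
      exact heq l y fun h => hy' ⟨hδ.trans h.1, by linarith [h.2]⟩
    ext z
    constructor
    · rintro (hz | ⟨hz, l, hl⟩)
      · have : z ∈ ⋃ i, Set.range (γ i) := hD ▸ Or.inl hz
        obtain ⟨i, s, rfl⟩ := Set.mem_iUnion.1 this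
        refine Set.mem_iUnion.2 ⟨i, s, (hB i s fun h => ?_).1⟩
        exact Set.disjoint_left.1 hE hz (twinBoxInterior_subset k h)
      · by_cases hy : z.2 ∈ Set.Ioo (0 : ℝ) 1
        · obtain ⟨i, s, hs, hsy⟩ := exists_followsAt_of_height hc hγ hin
            (hD ▸ Set.subset_union_right) l hy
          refine Set.mem_iUnion.2 ⟨i, s, ?_⟩
          have hV : γ i s ∈ twinBoxInterior k := ⟨hs.1 ▸ hc.mem_Ioo l _, hsy ▸ hy⟩
          rw [(hA i s l hV hs).1, hsy, ← hl]
        · have : z ∈ ⋃ i, Set.range (γ i) := by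
            rw [← hD]
            exact Or.inr ⟨hz, l, by rw [hl, hendpt _ hz hy]⟩
          obtain ⟨i, s, rfl⟩ := Set.mem_iUnion.1 this
          exact Set.mem_iUnion.2 ⟨i, s, (hB i s fun h => hy h.2).1⟩
    · intro hz
      obtain ⟨i, s, rfl⟩ := Set.mem_iUnion.1 hz
      by_cases hs : γ i s ∈ twinBoxInterior k
      · obtain ⟨l, hl⟩ := hex i s hs
        rw [(hA i s l hs hl).1]
        exact Or.inr ⟨Set.Ioo_subset_Icc_self hs.2, l, rfl⟩
      · rw [(hB i s hs).1]
        have h : γ i s ∈ E ∪ strandPic c := hD ▸ Set.mem_iUnion.2 ⟨i, s, rfl⟩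
        rcases h with h | ⟨h1, l, h2⟩
        · exact Or.inl h
        · refine Or.inr ⟨h1, l, ?_⟩
          rw [h2, hendpt _ h1]
          intro hy
          exact hs ⟨h2 ▸ hc.mem_Ioo l _, hy⟩

end Replace

/-! ## The strands of a word -/

theorem hasDerivAt_expNegInvGlue (x : ℝ) :
    HasDerivAt expNegInvGlue (x⁻¹ ^ 2 * expNegInvGlue x) x := by
  simpa using expNegInvGlue.hasDerivAt_polynomial_eval_inv_mul 1 x

theorem deriv_smoothTransition_pos {x : ℝ} (h0 : 0 < x) (h1 : x < 1) :
    0 < deriv Real.smoothTransition x := by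
  have hf := hasDerivAt_expNegInvGlue x
  have hg : HasDerivAt (fun x => expNegInvGlue (1 - x))
      (-((1 - x)⁻¹ ^ 2 * expNegInvGlue (1 - x))) x := by
    simpa using (hasDerivAt_expNegInvGlue (1 - x)).comp_const_sub 1 x
  have hfx := expNegInvGlue.pos_of_pos h0
  have hgx := expNegInvGlue.pos_of_pos (sub_pos.2 h1)
  have hd := hf.fun_div (hf.fun_add hg) (by positivity)
  have hd : HasDerivAt Real.smoothTransition _ x := hd
  rw [hd.deriv]
  have h1x : 0 < 1 - x := sub_pos.2 h1
  refine div_pos ?_ (by positivity)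
  have e1 : 0 < x⁻¹ ^ 2 * expNegInvGlue x * expNegInvGlue (1 - x) := by positivity
  have e2 : 0 < expNegInvGlue x * ((1 - x)⁻¹ ^ 2 * expNegInvGlue (1 - x)) := by positivity
  nlinarith

theorem contDiff_crossStep : ContDiff ℝ ∞ crossStep :=
  Real.smoothTransition.contDiff.comp (by fun_prop)

/-- The value 1/2 is taken only strictly inside the transition, where the derivative is positive.
Arcs of a letter meet exactly at this value, so they cross transversely. -/
theorem deriv_crossStep_ne_zero {t : ℝ} (h : crossStep t = 1 / 2) : deriv crossStep t ≠ 0 := by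
  have h0 : 0 < 3 * t - 1 := by
    by_contra hlt
    rw [crossStep_of_le (by linarith)] at h
    norm_num at h
  have h1 : 3 * t - 1 < 1 := by
    by_contra hlt
    rw [crossStep_of_ge (by linarith)] at h
    norm_num at h
  have hd : HasDerivAt crossStep (deriv Real.smoothTransition (3 * t - 1) * 3) t := by
    have h2 : HasDerivAt (fun t : ℝ => 3 * t - 1) 3 t := by
      simpa using ((hasDerivAt_id t).const_mul 3).sub_const 1
    exact ((Real.smoothTransition.contDiff (n := ⊤)).differentiable
      (by simp) (3 * t - 1)).hasDerivAt.comp t h2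
  rw [hd.deriv]
  have := deriv_smoothTransition_pos h0 h1
  positivity

theorem crossStep_mem (t : ℝ) : crossStep t ∈ Set.Icc (0 : ℝ) 1 :=
  ⟨Real.smoothTransition.nonneg _, Real.smoothTransition.le_one _⟩

theorem adjSwap_val {k : ℕ} (i : Fin (k - 1)) (l : Fin k) : (adjSwap i l : ℕ) =
    if (l : ℕ) = i then (i : ℕ) + 1 else if (l : ℕ) = i + 1 then (i : ℕ) else l := by
  rw [adjSwap, Equiv.swap_apply_def]
  simp only [Fin.ext_iff]
  split_ifs <;> rfl

theorem adjSwap_adjSwap {k : ℕ} (i : Fin (k - 1)) (l : Fin k) : adjSwap i (adjSwap i l) = l :=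
  DFunLike.congr_fun (Equiv.swap_swap _ _) l

/-- The arc of the configuration of a word which starts in the position `l`; a letter takes the
time `1`. -/
noncomputable def strand {k : ℕ} : List (Fin (k - 1)) → Fin k → ℝ → ℝ
  | [], l, _ => l + 1
  | i :: w, l, t => strand w (adjSwap i l) (t - 1) +
      ((l : ℝ) - (adjSwap i l : Fin k)) * (1 - crossStep t)

section Strand

variable {k : ℕ}

theorem strand_of_le (w : List (Fin (k - 1))) (l : Fin k) {t : ℝ} (ht : t ≤ 1 / 3) :
    strand w l t = l + 1 := by
  induction w generalizing l t with
  | nil => rfl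
  | cons i w ih => rw [strand, ih _ (by linarith), crossStep_of_le ht]; ring

/-- Until time 4/3 the remaining word is still in its initial constant phase. The overlap with the
range t ≥ 2/3 of `strand_cons_of_ge` lets derivatives be computed on either side of t = 1 without
gluing. -/
theorem strand_cons_of_le (i : Fin (k - 1)) (w : List (Fin (k - 1))) (l : Fin k) {t : ℝ}
    (ht : t ≤ 4 / 3) : strand (i :: w) l t =
      l + 1 + (((adjSwap i l : Fin k) : ℝ) - l) * crossStep t := by
  rw [strand, strand_of_le _ _ (by linarith)]; ring

theorem strand_cons_of_ge (i : Fin (k - 1)) (w : List (Fin (k - 1))) (l : Fin k) {t : ℝ}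
    (ht : 2 / 3 ≤ t) : strand (i :: w) l t = strand w (adjSwap i l) (t - 1) := by
  rw [strand, crossStep_of_ge ht]; ring

/-- The first letter acts first on the arc, while in the product it is the leftmost permutation;
hence the inverse. -/
theorem strand_of_ge (w : List (Fin (k - 1))) (l : Fin k) {t : ℝ} (ht : w.length - 1 / 3 ≤ t) :
    strand w l t = ((twinPerm k (twinOfWord w))⁻¹ l : Fin k) + 1 := by
  induction w generalizing l t with
  | nil => simp [strand, twinOfWord]
  | cons i w ih =>
    have h0 : (0 : ℝ) ≤ w.length := Nat.cast_nonneg _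
    rw [List.length_cons, Nat.cast_add, Nat.cast_one] at ht
    rw [strand_cons_of_ge _ _ _ (by linarith), ih _ (by linarith), twinOfWord_cons, map_mul,
      mul_inv_rev, Equiv.Perm.mul_apply]
    have : (twinPerm k (twinGen i))⁻¹ l = adjSwap i l := by
      rw [twinGen, twinPerm, PresentedGroup.toGroup.of, Equiv.Perm.inv_eq_iff_eq, adjSwap_adjSwap]
    rw [this]

theorem contDiff_strand (w : List (Fin (k - 1))) (l : Fin k) : ContDiff ℝ ∞ (strand w l) := by
  induction w generalizing l with
  | nil => exact contDiff_const
  | cons i w ih =>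
    exact ((ih _).comp (by fun_prop)).add
      (contDiff_const.mul (contDiff_const.sub contDiff_crossStep))

theorem strand_mem_Icc (w : List (Fin (k - 1))) (l : Fin k) (t : ℝ) :
    strand w l t ∈ Set.Icc (1 : ℝ) k := by
  have hl : ∀ l : Fin k, ((l : ℝ) + 1) ∈ Set.Icc (1 : ℝ) k := fun l =>
    ⟨by linarith [(Nat.cast_nonneg l : (0 : ℝ) ≤ (l : ℕ))], by exact_mod_cast l.2⟩
  induction w generalizing l t with
  | nil => exact hl l
  | cons i w ih =>
    rcases le_total t 1 with h | h
    · rw [strand_cons_of_le _ _ _ (by linarith)]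
      have h0 := crossStep_mem t
      have := (convex_Icc (1 : ℝ) k) (hl l) (hl (adjSwap i l)) (sub_nonneg.2 h0.2) h0.1 (by ring)
      convert this using 1
      simp only [smul_eq_mul]
      ring
    · rw [strand_cons_of_ge _ _ _ (by linarith)]
      exact ih _ _

/-- Two arcs meet in a letter only if they form its crossing, and only in the middle. -/
theorem crossing_of_eq {i : Fin (k - 1)} {l m : Fin k} (hlm : l ≠ m) {x : ℝ}
    (hx : x ∈ Set.Icc (0 : ℝ) 1) (h : (l : ℝ) + 1 + (((adjSwap i l : Fin k) : ℝ) - l) * x =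
      m + 1 + (((adjSwap i m : Fin k) : ℝ) - m) * x) :
    x = 1 / 2 ∧ ((l : ℕ) = i ∧ (m : ℕ) = i + 1 ∨ (l : ℕ) = i + 1 ∧ (m : ℕ) = i) := by
  have hne : (l : ℕ) ≠ m := fun h => hlm (Fin.ext h)
  have key : ∀ {a b : ℕ}, a ≠ b → (a : ℝ) ≠ b := fun h h' => h (by exact_mod_cast h')
  -- A vertical arc stays strictly to one side of the strip swept by the crossing arcs, which rules
  -- out all mixed cases.
  have far : ∀ {a b : ℕ}, a ≠ b → a ≠ b + 1 → (a : ℝ) < b ∨ (b : ℝ) + 1 < a := by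
    intro a b h1 h2
    rcases lt_or_gt_of_ne h1 with h | h
    · left; exact_mod_cast h
    · right; exact_mod_cast (show b + 1 < a by omega)
  rw [adjSwap_val, adjSwap_val] at h
  obtain ⟨hx0, hx1⟩ := hx
  split_ifs at h with h1 h2 h3 h4 h5 h6 h7
  · omega
  · rw [h1, h3] at h
    push_cast at h
    exact ⟨by linarith, Or.inl ⟨h1, h3⟩⟩
  · rw [h1] at h
    push_cast at h
    rcases far h2 h3 with h' | h' <;> exfalso <;> linarith
  · rw [h4, h5] at h
    push_cast at h
    exact ⟨by linarith, Or.inr ⟨h4, h5⟩⟩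
  · omega
  · rw [h4] at h
    push_cast at h
    rcases far h5 h6 with h' | h' <;> exfalso <;> linarith
  · rw [h7] at h
    push_cast at h
    rcases far h1 h4 with h' | h' <;> exfalso <;> linarith
  · rename_i h8
    rw [h8] at h
    push_cast at h
    rcases far h1 h4 with h' | h' <;> exfalso <;> linarith
  · exact absurd (by linarith) (key hne)

open Filter Topology in
-- For t < 1 only the first letter moves the arcs, and its crossing arcs have opposite nonzero
-- slopes; from t = 1 on the claim is about the remaining word.
theorem strand_transverse (w : List (Fin (k - 1))) {l m : Fin k} (hlm : l ≠ m) {t : ℝ}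
    (h : strand w l t = strand w m t) : deriv (strand w l) t ≠ deriv (strand w m) t := by
  induction w generalizing l m t with
  | nil =>
    simp only [strand, add_left_inj, Nat.cast_inj] at h
    exact absurd (Fin.ext h) hlm
  | cons i w ih =>
    rcases lt_or_ge t 1 with ht | ht
    · have hev : ∀ l : Fin k, deriv (strand (i :: w) l) t =
          (((adjSwap i l : Fin k) : ℝ) - l) * deriv crossStep t := by
        intro l
        have h1 : strand (i :: w) l =ᶠ[𝓝 t]
            fun t => (l : ℝ) + 1 + (((adjSwap i l : Fin k) : ℝ) - l) * crossStep t := by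
          filter_upwards [eventually_lt_nhds ht] with t' ht'
          exact strand_cons_of_le _ _ _ (by linarith)
        rw [h1.deriv_eq, deriv_const_add, deriv_const_mul_field]
      rw [strand_cons_of_le _ _ _ (by linarith), strand_cons_of_le _ _ _ (by linarith)] at h
      obtain ⟨h2, h3⟩ := crossing_of_eq hlm (crossStep_mem t) h
      rw [hev, hev]
      intro h4
      have h5 := mul_right_cancel₀ (deriv_crossStep_ne_zero h2) h4
      rw [adjSwap_val, adjSwap_val] at h5
      rcases h3 with ⟨ha, hb⟩ | ⟨ha, hb⟩ <;> rw [ha, hb] at h5 <;> simp at h5 <;> linarith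
    · have hev : ∀ l : Fin k, deriv (strand (i :: w) l) t =
          deriv (strand w (adjSwap i l)) (t - 1) := by
        intro l
        have h1 : strand (i :: w) l =ᶠ[𝓝 t] fun t => strand w (adjSwap i l) (t - 1) := by
          filter_upwards [eventually_gt_nhds (show (2 / 3 : ℝ) < t by linarith)] with t' ht'
          exact strand_cons_of_ge _ _ _ ht'.le
        rw [h1.deriv_eq, deriv_comp_sub_const]
      rw [strand_cons_of_ge _ _ _ (by linarith), strand_cons_of_ge _ _ _ (by linarith)] at h
      rw [hev, hev]
      exact ih (fun h => hlm ((adjSwap i).injective h)) h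

theorem strand_no_triple (w : List (Fin (k - 1))) {l m n : Fin k} (hlm : l ≠ m) (hmn : m ≠ n)
    (hln : l ≠ n) {t : ℝ} (h : strand w l t = strand w m t) : strand w m t ≠ strand w n t := by
  induction w generalizing l m n t with
  | nil =>
    simp only [strand, add_left_inj, Nat.cast_inj] at h
    exact absurd (Fin.ext h) hlm
  | cons i w ih =>
    intro h'
    rcases le_total t 1 with ht | ht
    · rw [strand_cons_of_le _ _ _ (by linarith), strand_cons_of_le _ _ _ (by linarith)] at h h'
      have h1 := (crossing_of_eq hlm (crossStep_mem t) h).2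
      have h2 := (crossing_of_eq hmn (crossStep_mem t) h').2
      exact hln (Fin.ext (by omega))
    · rw [strand_cons_of_ge _ _ _ (by linarith), strand_cons_of_ge _ _ _ (by linarith)] at h h'
      exact ih (fun h => hlm ((adjSwap i).injective h)) (fun h => hmn ((adjSwap i).injective h))
        (fun h => hln ((adjSwap i).injective h)) h h'

/-- The arcs of the configuration of a word, as functions of the height. -/
noncomputable def wordStrand (w : List (Fin (k - 1))) (l : Fin k) (y : ℝ) : ℝ :=
  strand w l (w.length * y)

theorem isStrandSystem_wordStrand (w : List (Fin (k - 1))) : IsStrandSystem (wordStrand w) where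
  smooth l := (contDiff_strand w l).comp (by fun_prop)
  mem_Ioo l y := by
    have := strand_mem_Icc w l (w.length * y)
    exact ⟨by linarith [this.1, show wordStrand w l y = strand w l (w.length * y) from rfl],
      by linarith [this.2, show wordStrand w l y = strand w l (w.length * y) from rfl]⟩
  transverse l m y hlm h := by
    rcases eq_or_ne w [] with rfl | hw
    · simp only [wordStrand, strand, add_left_inj, Nat.cast_inj] at h
      exact absurd (Fin.ext h) hlm
    · have hN : (w.length : ℝ) ≠ 0 := by simpa using hw
      have hd : ∀ l, deriv (wordStrand w l) y =
          w.length * deriv (strand w l) (w.length * y) := by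
        intro l
        have := deriv_comp_mul_left (w.length : ℝ) (strand w l) y
        rwa [smul_eq_mul] at this
      rw [hd, hd]
      exact fun h' => strand_transverse w hlm h (mul_left_cancel₀ hN h')
  no_triple l m n y hlm hmn hln h := strand_no_triple w hlm hmn hln h.1 h.2

theorem mem_letterPic_iff (i : Fin (k - 1)) (x t : ℝ) : (x, t) ∈ letterPic k i ↔
    t ∈ Set.Icc (0 : ℝ) 1 ∧
      ∃ l : Fin k, x = l + 1 + (((adjSwap i l : Fin k) : ℝ) - l) * crossStep t := by
  have hi := i.2
  refine and_congr_right fun _ => ?_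
  simp only [adjSwap_val]
  constructor
  · rintro (⟨l, h1, h2, h⟩ | h | h)
    · refine ⟨l, ?_⟩
      rw [if_neg h1, if_neg h2, h]; ring
    · refine ⟨⟨i, by omega⟩, ?_⟩
      rw [if_pos rfl, h]; push_cast; ring
    · refine ⟨⟨i + 1, by omega⟩, ?_⟩
      rw [if_neg (by simp), if_pos rfl, h]; push_cast; ring
  · rintro ⟨l, h⟩
    split_ifs at h with h1 h2
    · right; left
      rw [h, h1]; push_cast; ring
    · right; right
      rw [h, h2]; push_cast; ring
    · left
      exact ⟨l, h1, h2, by rw [h]; ring⟩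

theorem exists_strand_of_letterPic {w : List (Fin (k - 1))} {a : ℕ} {i : Fin (k - 1)}
    (ha : w[a]? = some i) {x t : ℝ} (h : (x, t - a) ∈ letterPic k i) : ∃ l, x = strand w l t := by
  induction w generalizing a t with
  | nil => simp at ha
  | cons j w ih =>
    cases a with
    | zero =>
      simp only [List.getElem?_cons_zero, Option.some.injEq] at ha
      subst ha
      rw [Nat.cast_zero, sub_zero, mem_letterPic_iff] at h
      obtain ⟨ht, l, h⟩ := h
      exact ⟨l, by rw [strand_cons_of_le _ _ _ (by linarith [ht.2]), h]⟩
    | succ a =>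
      rw [List.getElem?_cons_succ] at ha
      have e : t - ((a + 1 : ℕ) : ℝ) = t - 1 - a := by push_cast; ring
      rw [e] at h
      obtain ⟨l, hl⟩ := ih ha h
      have h0 := h.1.1
      simp only at h0
      have h1 : (0 : ℝ) ≤ a := Nat.cast_nonneg _
      exact ⟨adjSwap j l, by rw [strand_cons_of_ge _ _ _ (by linarith), adjSwap_adjSwap, hl]⟩

theorem exists_letterPic_of_strand {w : List (Fin (k - 1))} (hw : w ≠ []) {t : ℝ} (h0 : 0 ≤ t)
    (h1 : t ≤ w.length) (l : Fin k) :
    ∃ (a : ℕ) (i : Fin (k - 1)), w[a]? = some i ∧ (strand w l t, t - a) ∈ letterPic k i := by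
  induction w generalizing t l with
  | nil => exact absurd rfl hw
  | cons j w ih =>
    rcases le_or_gt t 1 with ht | ht
    · refine ⟨0, j, rfl, ?_⟩
      rw [Nat.cast_zero, sub_zero, mem_letterPic_iff]
      exact ⟨⟨h0, ht⟩, l, strand_cons_of_le _ _ _ (by linarith)⟩
    · rw [List.length_cons, Nat.cast_add, Nat.cast_one] at h1
      have hw' : w ≠ [] := by
        rintro rfl
        simp only [List.length_nil, Nat.cast_zero, zero_add] at h1
        linarith
      obtain ⟨a, i, ha, h⟩ := ih hw' (t := t - 1) (by linarith) (by linarith) (adjSwap j l)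
      refine ⟨a + 1, i, by rwa [List.getElem?_cons_succ], ?_⟩
      rw [strand_cons_of_ge _ _ _ (by linarith)]
      have e : t - ((a + 1 : ℕ) : ℝ) = t - 1 - a := by push_cast; ring
      rwa [e]

/-- A second description of the same set: crossings serve to move pictures, complete arcs from
bottom to top serve to reroute parametrizations. -/
theorem wordPic_eq_strandPic (w : List (Fin (k - 1))) : wordPic k w = strandPic (wordStrand w) := by
  rcases eq_or_ne w [] with rfl | hw
  · rw [wordPic, if_pos rfl]
    rfl
  have hN : (0 : ℝ) < w.length := by
    exact_mod_cast List.length_pos_iff.2 hw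
  ext z
  rw [mem_wordPic_iff hw]
  constructor
  · rintro ⟨a, i, ha, h⟩
    have ha' : (a + 1 : ℝ) ≤ w.length := by
      exact_mod_cast (List.getElem?_eq_some_iff.1 ha).1
    have h0 : (0 : ℝ) ≤ a := Nat.cast_nonneg _
    obtain ⟨h1, h2⟩ := h.1
    simp only at h1 h2
    refine ⟨?_, exists_strand_of_letterPic ha h⟩
    constructor <;> by_contra hlt <;> rw [not_le] at hlt <;> nlinarith
  · rintro ⟨hz, l, hl⟩
    obtain ⟨a, i, ha, h⟩ := exists_letterPic_of_strand hw (t := w.length * z.2)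
      (mul_nonneg hN.le hz.1) (by nlinarith [hz.2]) l
    exact ⟨a, i, ha, by rw [hl]; exact h⟩

end Strand

/-! ### Replacing words in a link projection -/

theorem image_union_image (φ : PlaneDiffeo) (E P : Set (ℝ × ℝ)) :
    φ '' ((φ.symm '' E) ∪ P) = E ∪ φ '' P := by
  rw [Set.image_union, ← Set.image_comp, ← Diffeomorph.coe_trans, Diffeomorph.symm_trans_self,
    Diffeomorph.coe_refl, Set.image_id]

/-- In a link projection, the configuration of a word in a disc can be replaced by that of any other
word which induces the same permutation. -/
theorem IsLinkProjection.replace_word {k : ℕ} {φ : PlaneDiffeo} {E : Set (ℝ × ℝ)}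
    (hE : Disjoint E (φ '' twinBox k)) {w w' : List (Fin (k - 1))}
    (hw : twinPerm k (twinOfWord w) = twinPerm k (twinOfWord w'))
    (hD : IsLinkProjection (E ∪ φ '' wordPic k w)) :
    IsLinkProjection (E ∪ φ '' wordPic k w') := by
  rw [← image_union_image, isLinkProjection_image_iff, wordPic_eq_strandPic] at hD ⊢
  have hE' : Disjoint (φ.symm '' E) (twinBox k) := by
    rw [Set.disjoint_left] at hE ⊢
    rintro _ ⟨z, hz, rfl⟩ h
    exact hE hz ⟨_, h, φ.apply_symm_apply z⟩
  have hS : (0 : ℝ) < w.length + w'.length + 1 := by positivity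
  -- Within this distance of the bottom and the top both words are in the constant third of an end
  -- slot, so their arcs are vertical and agree there.
  have hδ : (0 : ℝ) < 1 / (3 * (w.length + w'.length + 1)) := by positivity
  have hle : ∀ N : ℕ, N ≤ w.length + w'.length →
      (N : ℝ) * (1 / (3 * (w.length + w'.length + 1))) ≤ 1 / 3 := by
    intro N hN
    have hN' : (N : ℝ) ≤ w.length + w'.length := by exact_mod_cast hN
    rw [mul_one_div, div_le_div_iff₀ (by positivity) (by norm_num)]
    linarith
  have hlow : ∀ (v : List (Fin (k - 1))) (y : ℝ), v.length ≤ w.length + w'.length →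
      y ≤ 1 / (3 * (w.length + w'.length + 1)) → ∀ l, wordStrand v l y = l + 1 :=
    fun v y hv hy l => strand_of_le _ _
      ((mul_le_mul_of_nonneg_left hy (Nat.cast_nonneg _)).trans (hle _ hv))
  have hhigh : ∀ (v : List (Fin (k - 1))) (y : ℝ), v.length ≤ w.length + w'.length →
      1 - 1 / (3 * (w.length + w'.length + 1)) ≤ y →
      ∀ l, wordStrand v l y = ((twinPerm k (twinOfWord v))⁻¹ l : Fin k) + 1 := by
    intro v y hv hy l
    refine strand_of_ge _ _ ?_
    have h1 := mul_le_mul_of_nonneg_left hy (Nat.cast_nonneg (α := ℝ) v.length)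
    have h2 := hle _ hv
    rw [mul_sub, mul_one] at h1
    linarith
  refine IsLinkProjection.replace_strands (isStrandSystem_wordStrand w)
    (isStrandSystem_wordStrand w') hδ (fun l y hy => ?_) hE' hD
  rw [Set.mem_Ioo, not_and_or, not_lt, not_lt] at hy
  rcases hy with hy | hy
  · rw [hlow w y (by omega) hy, hlow w' y (by omega) hy]
  · rw [hhigh w y (by omega) hy, hhigh w' y (by omega) hy, hw]

/-! ## Boxes in the picture of a word -/

/-- The picture of a word of length m, scaled by m/N and raised by a/N, has its slots on the slots
a, …, a + m - 1 of a word of length N. So subwords sit in affine boxes on the nose. -/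
theorem place_slotCrossing {m N : ℕ} (hm : 0 < m) (hN : 0 < N) (o a b i : ℕ) :
    (slotCrossing m b i).place o (m / N) (a / N) = slotCrossing N (a + b) (i + o) := by
  have hm' : (m : ℝ) ≠ 0 := by positivity
  have hN' : (N : ℝ) ≠ 0 := by positivity
  simp only [slotCrossing, Crossing.place, Crossing.mk.injEq, true_and]
  constructor
  · push_cast; field_simp; ring
  · field_simp

/-- The crossings of a word in the slots outside of the intervals `[a j, a j + m)`. -/
def outerCrossings {k : ℕ} {ι : Type*} (w : List (Fin (k - 1))) (a : ι → ℕ) (m : ℕ) :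
    Set Crossing :=
  {c | ∃ (x : ℕ) (i : Fin (k - 1)), (∀ j, x < a j ∨ a j + m ≤ x) ∧ w[x]? = some i ∧
    c = slotCrossing w.length x i}

/-- A crossing keeps a third of a slot away from the ends of its slot, so even adjacent slots are
strictly separated. -/
theorem slot_separated {N : ℕ} (hN : 0 < N) {a m x i : ℕ} (h : x < a ∨ a + m ≤ x) {y : ℝ}
    (hy : y ∈ Set.Icc ((a : ℝ) / N) (a / N + m / N)) :
    (slotCrossing N x i).radius < |y - (slotCrossing N x i).height| := by
  have hN' : (0 : ℝ) < N := by positivity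
  rw [slotCrossing_abs_lt hN, lt_abs]
  obtain ⟨h0, h1⟩ := hy
  rw [div_le_iff₀ hN'] at h0
  rw [← add_div, le_div_iff₀ hN'] at h1
  rcases h with h | h
  · left
    have : (x + 1 : ℝ) ≤ a := by exact_mod_cast h
    linarith
  · right
    have : (a + m : ℝ) ≤ x := by exact_mod_cast h
    linarith

section Boxes

variable {k q m : ℕ} {ι : Type*} {w : List (Fin (k - 1))}

theorem wordCrossings_height_mem {w : List (Fin (k - 1))} {c : Crossing}
    (hc : c ∈ wordCrossings w) : 0 ≤ c.height - c.radius ∧ c.height + c.radius ≤ 1 := by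
  obtain ⟨x, i, hx, rfl⟩ := hc
  have hx' := (List.getElem?_eq_some_iff.1 hx).1
  have hN : (0 : ℝ) < w.length := by exact_mod_cast (Nat.zero_le x).trans_lt hx'
  have hx' : (x + 1 : ℝ) ≤ w.length := by exact_mod_cast hx'
  have hx0 : (0 : ℝ) ≤ x := Nat.cast_nonneg _
  simp only [slotCrossing]
  have e1 : (x + 1 / 2 : ℝ) / w.length - 1 / (6 * w.length) = (x + 1 / 3) / w.length := by
    field_simp; ring
  have e2 : (x + 1 / 2 : ℝ) / w.length + 1 / (6 * w.length) = (x + 2 / 3) / w.length := by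
    field_simp; ring
  rw [e1, e2, div_le_one hN]
  exact ⟨by positivity, by linarith⟩

theorem wordCrossings_pos_le {w : List (Fin (k - 1))} {c : Crossing}
    (hc : c ∈ wordCrossings w) : c.pos + 2 ≤ k := by
  obtain ⟨x, i, hx, rfl⟩ := hc
  have := i.2
  simp only [slotCrossing]
  omega

/-- The crossings of a word with subwords in disjoint intervals of slots. -/
theorem wordCrossings_eq_union (hm : 0 < m) (hw : 0 < w.length) (o a : ι → ℕ)
    {sub : ι → List (Fin (q - 1))} (hsub : ∀ j, (sub j).length = m)
    (hget : ∀ j (b : ℕ) (i : Fin (q - 1)), (sub j)[b]? = some i →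
      ∃ x : Fin (k - 1), w[a j + b]? = some x ∧ (x : ℕ) = i + o j) :
    wordCrossings w = outerCrossings w a m ∪
      ⋃ j, Crossing.place (o j) ((m : ℝ) / w.length) ((a j : ℝ) / w.length) ''
        wordCrossings (sub j) := by
  ext c
  constructor
  · rintro ⟨x, i, hx, rfl⟩
    by_cases h : ∀ j, x < a j ∨ a j + m ≤ x
    · exact Or.inl ⟨x, i, h, hx, rfl⟩
    · push Not at h
      obtain ⟨j, h1, h2⟩ := h
      obtain ⟨b, rfl⟩ := Nat.exists_eq_add_of_le h1
      have hb : b < (sub j).length := by rw [hsub]; omega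
      obtain ⟨x', hx', he⟩ := hget j b _ (List.getElem?_eq_getElem hb)
      rw [hx] at hx'
      cases hx'
      refine Or.inr (Set.mem_iUnion.2 ⟨j, _, ⟨b, _, List.getElem?_eq_getElem hb, rfl⟩, ?_⟩)
      rw [hsub, place_slotCrossing hm hw, he]
  · rintro (⟨x, i, -, hx, rfl⟩ | hc)
    · exact ⟨x, i, hx, rfl⟩
    · obtain ⟨j, -, ⟨b, i, hb, rfl⟩, rfl⟩ := Set.mem_iUnion.1 hc
      obtain ⟨x, hx, he⟩ := hget j b i hb
      exact ⟨a j + b, x, hx, by rw [hsub, place_slotCrossing hm hw, he]⟩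

variable (hm : 0 < m) (hw : 0 < w.length) (o a : ι → ℕ)

/-- The box of the `j`-th interval of slots. -/
noncomputable def slotBox (j : ι) : PlaneDiffeo :=
  placeDiffeo (o j) ((m : ℝ) / w.length) ((a j : ℝ) / w.length)
    (div_pos (by exact_mod_cast hm) (by exact_mod_cast hw))

theorem slotBox_subset (ho : ∀ j, o j + q ≤ k) (ha : ∀ j, a j + m ≤ w.length) (j : ι) :
    slotBox hm hw o a j '' twinBox q ⊆ twinBox k := by
  have hN : (0 : ℝ) < w.length := by exact_mod_cast hw
  rintro _ ⟨z, ⟨⟨h1, h2⟩, h3, h4⟩, rfl⟩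
  rw [slotBox, placeDiffeo_apply]
  have h5 : (o j + q : ℝ) ≤ k := by exact_mod_cast ho j
  have h6 : (a j + m : ℝ) ≤ w.length := by exact_mod_cast ha j
  have h7 : (0 : ℝ) ≤ o j := Nat.cast_nonneg _
  refine ⟨⟨by simp only; linarith, by simp only; linarith⟩, by simp only; positivity, ?_⟩
  simp only
  have h8 : (m : ℝ) / w.length * z.2 ≤ m / w.length := mul_le_of_le_one_right (by positivity) h4
  have h9 : (m : ℝ) / w.length + a j / w.length ≤ 1 := by
    rw [← add_div, div_le_one hN]; linarith
  linarith

/-- The boxes are closed, so adjacent intervals of slots would share an edge; strict inequality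
demands a letter in between. -/
theorem slotBox_disjoint {i j : ι} (h : a i + m < a j ∨ a j + m < a i) :
    Disjoint (slotBox hm hw o a i '' twinBox q) (slotBox hm hw o a j '' twinBox q) := by
  have hN : (0 : ℝ) < w.length := by exact_mod_cast hw
  rw [Set.disjoint_left]
  rintro _ ⟨z, ⟨-, h3, h4⟩, rfl⟩ ⟨z', ⟨-, h3', h4'⟩, he⟩
  have he := congrArg Prod.snd he
  simp only [slotBox, placeDiffeo_apply] at he
  have he : (m : ℝ) * z'.2 + a j = m * z.2 + a i := by field_simp at he; linarith
  have hm' : (0 : ℝ) ≤ m := Nat.cast_nonneg _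
  have i1 : (m : ℝ) * z.2 ≤ m := mul_le_of_le_one_right hm' h4
  have i2 : (m : ℝ) * z'.2 ≤ m := mul_le_of_le_one_right hm' h4'
  have i3 : 0 ≤ (m : ℝ) * z.2 := mul_nonneg hm' h3
  have i4 : 0 ≤ (m : ℝ) * z'.2 := mul_nonneg hm' h3'
  rcases h with h | h
  · have : (a i + m : ℝ) < a j := by exact_mod_cast h
    linarith
  · have : (a j + m : ℝ) < a i := by exact_mod_cast h
    linarith

/-- The picture given by the outer crossings of a word and by any pictures in the boxes. -/
theorem crossPic_outerCrossings_union (ho : ∀ j, o j + q ≤ k) (ha : ∀ j, a j + m ≤ w.length)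
    (hdisj : ∀ i j, i ≠ j → a i + m ≤ a j ∨ a j + m ≤ a i)
    {sub : ι → List (Fin (q - 1))} (hsub : ∀ j, (sub j).length = m ∨ sub j = []) :
    crossPic k (outerCrossings w a m ∪
      ⋃ j, Crossing.place (o j) ((m : ℝ) / w.length) ((a j : ℝ) / w.length) ''
        wordCrossings (sub j)) =
    (crossPic k (outerCrossings w a m) \ ⋃ j, slotBox hm hw o a j '' twinBox q) ∪
      ⋃ j, slotBox hm hw o a j '' wordPic q (sub j) := by
  have hN : (0 : ℝ) < w.length := by exact_mod_cast hw
  have hm' : (0 : ℝ) < m := by exact_mod_cast hm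
  simp only [wordPic_eq_crossPic]
  refine crossPic_eq_diff_union o (fun _ => (m : ℝ) / w.length) (fun j => (a j : ℝ) / w.length)
    (fun _ => div_pos hm' hN) (fun j => by positivity) (fun j => ?_) ho
    (fun j c hc => wordCrossings_pos_le hc) (fun j c hc => wordCrossings_height_mem hc)
    ?_ ?_
  · have h6 : (a j + m : ℝ) ≤ w.length := by exact_mod_cast ha j
    rw [← add_div, div_le_one hN]; exact h6
  · rintro j c ⟨x, i, hx, -, rfl⟩ y hy
    exact slot_separated hw (hx j) hy
  · rintro i j hij c ⟨b, l, hb, rfl⟩ y hy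
    have hb' := (List.getElem?_eq_some_iff.1 hb).1
    rcases hsub i with hs | hs
    · rw [hs] at hb' ⊢
      rw [place_slotCrossing hm hw]
      refine slot_separated hw ?_ hy
      rcases hdisj i j hij with h | h <;> omega
    · rw [hs] at hb'
      simp at hb'

end Boxes

/-! ## Isotopies of pictures of words -/

theorem slots_mem_crossingConf {ι : Type*} {R : ι → ι → Prop} {N : ℕ} (hN : 0 < N) {f : ι → ℕ}
    (hf : ∀ e, f e < N) (hR : ∀ e e', R e e' → f e < f e') :
    ((fun e => ((f e : ℝ) + 1 / 2) / N), (1 / (6 * N) : ℝ)) ∈ crossingConf R := by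
  have hN' : (0 : ℝ) < N := by exact_mod_cast hN
  have e1 : ∀ x : ℝ, (x + 1 / 2) / N - 1 / (6 * N) = (x + 1 / 3) / N := by
    intro x; field_simp; ring
  have e2 : ∀ x : ℝ, (x + 1 / 2) / N + 1 / (6 * N) = (x + 2 / 3) / N := by
    intro x; field_simp; ring
  refine ⟨by positivity, fun e => ?_, fun e e' h => ?_⟩
  · simp only [e1, e2]
    have : (f e + 1 : ℝ) ≤ N := by exact_mod_cast hf e
    exact ⟨by positivity, by rw [div_lt_one hN']; linarith⟩
  · simp only [e1, e2]
    have : (f e + 1 : ℝ) ≤ f e' := by exact_mod_cast hR e e' h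
    rw [div_lt_div_iff_of_pos_right hN']
    linarith

theorem wordCrossings_eq_range {k : ℕ} (w : List (Fin (k - 1))) :
    wordCrossings w = Set.range fun e : Fin w.length => slotCrossing w.length e (w[e] : ℕ) := by
  ext c
  constructor
  · rintro ⟨a, i, ha, rfl⟩
    obtain ⟨h, rfl⟩ := List.getElem?_eq_some_iff.1 ha
    exact ⟨⟨a, h⟩, rfl⟩
  · rintro ⟨e, rfl⟩
    exact ⟨e, w[e], by simp, rfl⟩

theorem boxIsotopic_comm {k : ℕ} (u v : List (Fin (k - 1))) {i j : Fin (k - 1)}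
    (hij : (i : ℕ) + 1 < j) :
    BoxIsotopic k (wordPic k (u ++ i :: j :: v)) (wordPic k (u ++ j :: i :: v)) := by
  set w := u ++ i :: j :: v with hw
  set w' := u ++ j :: i :: v with hw'
  have hlen : w.length = u.length + v.length + 2 := by simp [w]; omega
  have hlen' : w'.length = w.length := by simp [w, w']
  -- Crossings are labelled by their slots in the first word; `τ` gives their slots in the second.
  let τ : ℕ → ℕ := fun x => if x = u.length then u.length + 1 else
    if x = u.length + 1 then u.length else x
  have hττ : ∀ x, τ (τ x) = x := by intro x; simp only [τ]; split_ifs <;> omega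
  have hτlt : ∀ x, x < w.length → τ x < w.length := by
    intro x hx; simp only [τ]; split_ifs <;> omega
  have hget : ∀ x, w'[τ x]? = w[x]? := by
    intro x
    simp only [τ, w, w']
    split_ifs with h1 h2
    · rw [h1, List.getElem?_append_right (by omega), List.getElem?_append_right (by omega)]
      simp
    · rw [h2, List.getElem?_append_right (by omega), List.getElem?_append_right (by omega)]
      simp
    · rcases lt_or_ge x u.length with h | h
      · rw [List.getElem?_append_left h, List.getElem?_append_left h]
      · rw [List.getElem?_append_right (by omega), List.getElem?_append_right (by omega)]
        obtain ⟨y, rfl⟩ : ∃ y, x = u.length + 2 + y := ⟨x - u.length - 2, by omega⟩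
        have : u.length + 2 + y - u.length = y + 1 + 1 := by omega
        rw [this]
        simp
  let pos : Fin w.length → ℕ := fun e => w[e]
  -- All orders are kept except that of the commuting pair. This pair needs no order because its
  -- positions differ by at least 2.
  let R : Fin w.length → Fin w.length → Prop := fun e f =>
    e < f ∧ ¬ ((e : ℕ) = u.length ∧ (f : ℕ) = u.length + 1)
  have hN : 0 < w.length := by omega
  have key := boxIsotopic_crossingFamily (k := k) (pos := pos) (R := R)
    (fun e => by have := (w[e]).2; simp only [pos]; omega) ?_
    (slots_mem_crossingConf hN (f := fun e : Fin w.length => (e : ℕ)) (fun e => e.2)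
      fun e e' h => h.1)
    (slots_mem_crossingConf hN (f := fun e : Fin w.length => τ e) (fun e => hτlt _ e.2)
      fun e e' h => ?_)
  · rw [wordPic_eq_crossPic, wordPic_eq_crossPic]
    have h1 : wordCrossings w = Set.range fun e : Fin w.length => slotCrossing w.length e (pos e) :=
      wordCrossings_eq_range w
    have h2 : wordCrossings w' =
        Set.range fun e : Fin w.length => slotCrossing w.length (τ e) (pos e) := by
      ext c
      constructor
      · rintro ⟨a, l, ha, rfl⟩
        have ha' := (List.getElem?_eq_some_iff.1 ha).1
        rw [hlen'] at ha'
        refine ⟨⟨τ a, hτlt a ha'⟩, ?_⟩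
        have := hget (τ a)
        rw [hττ, ha, List.getElem?_eq_getElem (hτlt a ha'), Option.some.injEq] at this
        simp only [pos, hττ, hlen', this]
        rfl
      · rintro ⟨e, rfl⟩
        exact ⟨τ e, w[e], by rw [hget]; simp, by rw [hlen']⟩
    rw [h1, h2]
    exact key
  · intro e f hef h1 h2
    have hpos : ∀ e f : Fin w.length, (e : ℕ) = u.length → (f : ℕ) = u.length + 1 →
        pos e = i ∧ pos f = j := by
      intro e f he hf
      simp only [pos, Fin.getElem_fin, he, hf, w]
      constructor
      · simp
      · rw [List.getElem_append_right (by omega)]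
        simp
    have hef' : (e : ℕ) ≠ f := fun h => hef (Fin.ext h)
    rcases lt_or_gt_of_ne hef' with h | h
    · refine Or.inl ⟨h, fun h3 => ?_⟩
      have := hpos e f h3.1 h3.2
      omega
    · refine Or.inr ⟨h, fun h3 => ?_⟩
      have := hpos f e h3.1 h3.2
      omega
  · have h1 : (e : ℕ) < e' := h.1
    have h2 := h.2
    simp only [τ]
    split_ifs <;> omega

/-- Removing the two crossings of a bigon from the picture of a word results in a picture which is
isotopic to that of the shorter word. -/
theorem boxIsotopic_outerCrossings {k : ℕ} (u v : List (Fin (k - 1))) (i : Fin (k - 1)) :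
    BoxIsotopic k (wordPic k (u ++ v))
      (crossPic k (outerCrossings (u ++ i :: i :: v) (fun _ : Unit => u.length) 2)) := by
  set w := u ++ v with hw
  set w' := u ++ i :: i :: v with hw'
  have hlen : w.length = u.length + v.length := by simp [w]
  have hlen' : w'.length = w.length + 2 := by simp [w, w']; omega
  -- The letters of `v` move up two slots, leaving those of the bigon empty.
  let τ : ℕ → ℕ := fun x => if x < u.length then x else x + 2
  have hget : ∀ x, w'[τ x]? = w[x]? := by
    intro x
    simp only [τ, w, w']
    split_ifs with h1
    · rw [List.getElem?_append_left h1, List.getElem?_append_left h1]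
    · rw [List.getElem?_append_right (by omega), List.getElem?_append_right (by omega)]
      have : x + 2 - u.length = x - u.length + 1 + 1 := by omega
      rw [this]
      simp
  let pos : Fin w.length → ℕ := fun e => w[e]
  have h1 : wordCrossings w = Set.range fun e : Fin w.length => slotCrossing w.length e (pos e) :=
    wordCrossings_eq_range w
  have h2 : outerCrossings w' (fun _ : Unit => u.length) 2 =
      Set.range fun e : Fin w.length => slotCrossing w'.length (τ e) (pos e) := by
    ext c
    constructor
    · rintro ⟨x, l, hx, hl, rfl⟩
      have hx : x < u.length ∨ u.length + 2 ≤ x := hx ()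
      have hlt := (List.getElem?_eq_some_iff.1 hl).1
      obtain ⟨y, rfl⟩ : ∃ y, τ y = x := by
        rcases hx with hx | hx
        · exact ⟨x, if_pos hx⟩
        · refine ⟨x - 2, ?_⟩
          simp only [τ]
          rw [if_neg (by omega)]
          omega
      have hy : y < w.length := by
        simp only [τ] at hlt
        split_ifs at hlt <;> omega
      refine ⟨⟨y, hy⟩, ?_⟩
      rw [hget, List.getElem?_eq_getElem hy, Option.some.injEq] at hl
      simp only [pos, ← hl]
      rfl
    · rintro ⟨e, rfl⟩
      refine ⟨τ e, w[e], fun _ => ?_, by rw [hget]; simp, rfl⟩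
      simp only [τ]
      split_ifs <;> omega
  rw [wordPic_eq_crossPic, h1, h2]
  rcases Nat.eq_zero_or_pos w.length with h0 | h0
  · have : IsEmpty (Fin w.length) := by rw [h0]; infer_instance
    rw [Set.range_eq_empty, Set.range_eq_empty]
    exact ⟨Diffeomorph.refl _ _ _, fun z _ => rfl, by simp⟩
  refine boxIsotopic_crossingFamily (k := k) (pos := pos) (R := fun e f => e < f)
    (fun e => by have := (w[e]).2; simp only [pos]; omega) (fun e f h _ _ => lt_or_gt_of_ne h)
    (slots_mem_crossingConf h0 (f := fun e : Fin w.length => (e : ℕ)) (fun e => e.2)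
      fun e e' h => h)
    (slots_mem_crossingConf (by omega) (f := fun e : Fin w.length => τ e) (fun e => ?_)
      fun e e' h => ?_)
  · have := e.2
    simp only [τ]
    split_ifs <;> omega
  · have h : (e : ℕ) < e' := h
    simp only [τ]
    split_ifs <;> omega

/-! ## Rondles of tangles filled with words -/

section Filling

variable {k : ℕ} {φ : PlaneDiffeo} {E : Set (ℝ × ℝ)}

theorem PlaneDiffeo.conj_image (φ Φ : PlaneDiffeo) (P : Set (ℝ × ℝ)) :
    (φ.symm.trans (Φ.trans φ)) '' (φ '' P) = φ '' (Φ '' P) := by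
  rw [PlaneDiffeo.image_trans, PlaneDiffeo.image_trans, ← Set.image_comp φ.symm φ,
    ← Diffeomorph.coe_trans, Diffeomorph.self_trans_symm, Diffeomorph.coe_refl, Set.image_id]

/-- An isotopy in the box is realized by a compactly supported diffeomorphism of the plane. -/
theorem BoxIsotopic.exists_diffeo {P P' : Set (ℝ × ℝ)} (h : BoxIsotopic k P P')
    (hE : Disjoint E (φ '' twinBox k)) :
    ∃ Ψ : PlaneDiffeo, HasCompactSupp Ψ ∧ Ψ '' (E ∪ φ '' P) = E ∪ φ '' P' := by
  obtain ⟨Φ, h1, rfl⟩ := h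
  have hfix : ∀ z ∉ φ '' twinBox k, (φ.symm.trans (Φ.trans φ)) z = z := by
    intro z hz
    have : φ.symm z ∉ twinBox k := fun h => hz ⟨_, h, φ.apply_symm_apply z⟩
    rw [Diffeomorph.coe_trans, Function.comp_apply, Diffeomorph.coe_trans, Function.comp_apply,
      h1 _ this, φ.apply_symm_apply]
  refine ⟨φ.symm.trans (Φ.trans φ), ⟨φ '' twinBox k, ?_, hfix⟩, ?_⟩
  · exact (isCompact_Icc.prod isCompact_Icc).image φ.contDiff.continuous
  · rw [Set.image_union, PlaneDiffeo.conj_image]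
    congr 1
    have : Set.EqOn (φ.symm.trans (Φ.trans φ)) id E := fun z hz =>
      hfix z (Set.disjoint_left.1 hE hz)
    rw [this.image_eq, Set.image_id]

theorem toRondle_eq_of_boxIsotopic {P P' : Set (ℝ × ℝ)} (h : BoxIsotopic k P P')
    (hE : Disjoint E (φ '' twinBox k)) {D D' : LinkProjection} (hD : D.1 = E ∪ φ '' P)
    (hD' : D'.1 = E ∪ φ '' P') : D.toRondle = D'.toRondle := by
  obtain ⟨Ψ, hΨ, hP⟩ := h.exists_diffeo hE
  exact Quot.sound (Or.inl ⟨Ψ, hΨ, by rw [hD, hD', hP]⟩)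

/-- The two crossings occupy a box of two adjacent slots. Emptying it is a self-tangency
modification; the result has unevenly spaced crossings, and an isotopy brings it to the picture of
the shorter word. -/
theorem toRondle_eq_of_square (hE : Disjoint E (φ '' twinBox k)) (u v : List (Fin (k - 1)))
    (i : Fin (k - 1)) {D D' : LinkProjection} (hD : D.1 = E ∪ φ '' wordPic k (u ++ i :: i :: v))
    (hD' : D'.1 = E ∪ φ '' wordPic k (u ++ v)) : D.toRondle = D'.toRondle := by
  have hiso := boxIsotopic_outerCrossings u v i
  set w := u ++ i :: i :: v with hw
  have hlen : w.length = u.length + v.length + 2 := by simp [w]; omega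
  have hN : 0 < w.length := by omega
  have h2 : 0 < 2 := by norm_num
  let o : Unit → ℕ := fun _ => i
  let a : Unit → ℕ := fun _ => u.length
  let bigon : List (Fin (2 - 1)) := [⟨0, by decide⟩, ⟨0, by decide⟩]
  have ho : ∀ j, o j + 2 ≤ k := fun _ => by have := i.2; simp only [o]; omega
  have ha : ∀ j, a j + 2 ≤ w.length := fun _ => by simp only [a]; omega
  have hdisj : ∀ i j : Unit, i ≠ j → a i + 2 ≤ a j ∨ a j + 2 ≤ a i :=
    fun i j h => absurd (Subsingleton.elim i j) h
  have hpic : wordPic k w = (crossPic k (outerCrossings w a 2) \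
      ⋃ j, slotBox h2 hN o a j '' twinBox 2) ∪ ⋃ j, slotBox h2 hN o a j '' wordPic 2 bigon := by
    rw [wordPic_eq_crossPic, wordCrossings_eq_union h2 hN o a (sub := fun _ => bigon)
      (fun _ => rfl), crossPic_outerCrossings_union h2 hN o a ho ha hdisj (sub := fun _ => bigon)
      (fun _ => Or.inl rfl)]
    intro _ b x hx
    refine ⟨i, ?_, ?_⟩
    · have hb : b < 2 := (List.getElem?_eq_some_iff.1 hx).1
      simp only [a, w]
      rw [List.getElem?_append_right (by omega), Nat.add_sub_cancel_left]
      interval_cases b <;> rfl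
    · have := x.2
      simp only [o]
      omega
  have hpic' : crossPic k (outerCrossings w a 2) = (crossPic k (outerCrossings w a 2) \
      ⋃ j, slotBox h2 hN o a j '' twinBox 2) ∪ ⋃ j, slotBox h2 hN o a j '' wordPic 2 [] := by
    have h := crossPic_outerCrossings_union (q := 2) h2 hN o a ho ha hdisj (sub := fun _ => [])
      (fun _ => Or.inr rfl)
    have h0 : wordCrossings ([] : List (Fin (2 - 1))) = ∅ := by ext c; simp [wordCrossings]
    simpa only [h0, Set.image_empty, Set.iUnion_empty, Set.union_empty] using h
  have hU : ∀ g : Unit → Set (ℝ × ℝ), ⋃ j, g j = g () := fun g => ciSup_unique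
  rw [hU, hU] at hpic hpic'
  set β := slotBox h2 hN o a () with hβ
  have hE' : Disjoint (E ∪ φ '' (crossPic k (outerCrossings w a 2) \ β '' twinBox 2))
      ((β.trans φ) '' twinBox 2) := by
    rw [PlaneDiffeo.image_trans, Set.disjoint_union_left]
    refine ⟨hE.mono_right (Set.image_mono (slotBox_subset h2 hN o a ho ha ())), ?_⟩
    exact (Set.disjoint_image_iff φ.injective).2 Set.disjoint_sdiff_left
  obtain ⟨Ψ, hΨ, hP⟩ := hiso.exists_diffeo hE
  -- The intermediate set is a link projection because it is the image of `D'` under the isotopy.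
  let D'' : LinkProjection := ⟨Ψ '' D'.1, IsLinkProjection.image D'.2 Ψ⟩
  have hD'' : D''.1 = E ∪ φ '' crossPic k (outerCrossings w a 2) := by
    show Ψ '' D'.1 = _
    rw [hD', hP]
  have e1 : D'.toRondle = D''.toRondle := Quot.sound (Or.inl ⟨Ψ, hΨ, rfl⟩)
  rw [e1]
  refine Quot.sound (Or.inr ⟨β.trans φ, _, ⟨hE', ?_⟩, ⟨hE', ?_⟩⟩)
  · rw [hD, PlaneDiffeo.image_trans, Set.union_assoc, ← Set.image_union]
    exact congrArg (fun P => E ∪ φ '' P) hpic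
  · rw [hD'', PlaneDiffeo.image_trans, Set.union_assoc, ← Set.image_union]
    exact congrArg (fun P => E ∪ φ '' P) hpic'

/-- The rondle obtained by filling a tangle with a word depends only on the twin of the word. -/
theorem toRondle_eq_of_twinOfWord_eq (hE : Disjoint E (φ '' twinBox k))
    {w w' : List (Fin (k - 1))} (h : twinOfWord w = twinOfWord w') {D D' : LinkProjection}
    (hD : D.1 = E ∪ φ '' wordPic k w) (hD' : D'.1 = E ∪ φ '' wordPic k w') :
    D.toRondle = D'.toRondle := by
  -- Equality of twins is part of the predicate so that, in the transitivity step, the intermediate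
  -- word has the right permutation and its filling is a link projection.
  have key := twinOfWord_eq_induction (k := k) (P := fun w w' =>
    twinOfWord w = twinOfWord w' ∧ ∀ D D' : LinkProjection, D.1 = E ∪ φ '' wordPic k w →
      D'.1 = E ∪ φ '' wordPic k w' → D.toRondle = D'.toRondle) ?_ ?_ ?_ ?_ ?_ h
  · exact key.2 D D' hD hD'
  · intro w
    refine ⟨rfl, fun D D' h h' => ?_⟩
    rw [Subtype.ext (h.trans h'.symm)]
  · rintro w w' ⟨h1, h2⟩
    exact ⟨h1.symm, fun D D' h h' => (h2 D' D h' h).symm⟩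
  · rintro w w' w'' ⟨h1, h2⟩ ⟨h3, h4⟩
    refine ⟨h1.trans h3, fun D D'' h h'' => ?_⟩
    have hlp : IsLinkProjection (E ∪ φ '' wordPic k w) := h ▸ D.2
    let D' : LinkProjection := ⟨_, hlp.replace_word hE (congrArg (twinPerm k) h1)⟩
    exact (h2 D D' h rfl).trans (h4 D' D'' rfl h'')
  · intro u v i
    refine ⟨?_, fun D D' h h' => toRondle_eq_of_square hE u v i h h'⟩
    rw [twinOfWord_append, twinOfWord_append, twinOfWord_cons, twinOfWord_cons,
      ← mul_assoc (twinGen i), twinGen_mul_self, one_mul]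
  · intro u v i j hij
    refine ⟨?_, fun D D' h h' => toRondle_eq_of_boxIsotopic (boxIsotopic_comm u v hij) hE h h'⟩
    rw [twinOfWord_append, twinOfWord_append, twinOfWord_cons, twinOfWord_cons, twinOfWord_cons,
      twinOfWord_cons, ← mul_assoc (twinGen i), twinGen_comm hij, mul_assoc]

end Filling

/-! ## Words with triangles -/

/-- The word on `k` arcs given by a word on the `q` arcs in the positions `o, …, o + q - 1`. -/
def shiftWord {k q : ℕ} (o : ℕ) (ho : o + q ≤ k) (w : List (Fin (q - 1))) : List (Fin (k - 1)) :=
  w.map fun i : Fin (q - 1) => (⟨i + o, by omega⟩ : Fin (k - 1))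

theorem length_triangleWord (b : Bool) : (triangleWord b).length = 3 := by cases b <;> rfl

/-- The lower of the two positions is `o`, and `b` is the sign of the triangle in the word for 1.
The tail is made nonempty by appending σ_i σ_i, so that consecutive blocks have disjoint boxes. -/
theorem YBStep.exists_words {k : ℕ} {p : TwinGroup k} (h : YBStep p 1) :
    ∃ (o : ℕ) (ho : o + 3 ≤ k) (b : Bool) (G H : List (Fin (k - 1))), H ≠ [] ∧
      twinOfWord (G ++ shiftWord o ho (triangleWord (!b)) ++ H) = p ∧
      twinOfWord (G ++ shiftWord o ho (triangleWord b) ++ H) = 1 := by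
  obtain ⟨g, h, i, j, hij, rfl, h1⟩ := h
  obtain ⟨G, rfl⟩ := twinOfWord_surjective g
  obtain ⟨H, rfl⟩ := twinOfWord_surjective h
  have hH : twinOfWord (H ++ [i, i]) = twinOfWord H := by
    rw [twinOfWord_append, twinOfWord_cons, twinOfWord_cons, ← mul_assoc (twinGen i),
      twinGen_mul_self]
    simp [twinOfWord]
  have hi := i.2
  have hj := j.2
  rw [h1]
  rcases hij with hij | hij
  · refine ⟨i, by omega, false, G, H ++ [i, i], by simp, ?_, ?_⟩
    · rw [twinOfWord_append, twinOfWord_append, hH]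
      have e0 : (⟨0 + i, by omega⟩ : Fin (k - 1)) = i := Fin.ext (by simp)
      have e1 : (⟨1 + i, by omega⟩ : Fin (k - 1)) = j := Fin.ext (by simp only; omega)
      simp [shiftWord, triangleWord, twinOfWord, e1, mul_assoc]
    · rw [twinOfWord_append, twinOfWord_append, hH]
      have e1 : (⟨1 + i, by omega⟩ : Fin (k - 1)) = j := Fin.ext (by simp only; omega)
      simp [shiftWord, triangleWord, twinOfWord, e1, mul_assoc]
  · refine ⟨j, by omega, true, G, H ++ [i, i], by simp, ?_, ?_⟩
    · rw [twinOfWord_append, twinOfWord_append, hH]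
      have e1 : (⟨1 + j, by omega⟩ : Fin (k - 1)) = i := Fin.ext (by simp only; omega)
      simp [shiftWord, triangleWord, twinOfWord, e1, mul_assoc]
    · rw [twinOfWord_append, twinOfWord_append, hH]
      have e1 : (⟨1 + j, by omega⟩ : Fin (k - 1)) = i := Fin.ext (by simp only; omega)
      simp [shiftWord, triangleWord, twinOfWord, e1, mul_assoc]

/-- The word `u G₁ t₁ H₁ ⋯ Gₙ tₙ Hₙ v`. -/
def blockWord {α : Type*} {n : ℕ} (u v : List α) (G H t : Fin n → List α) : List α :=
  u ++ (List.ofFn fun j => G j ++ t j ++ H j).flatten ++ v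

/-- In `blockWord u v G H t`, the words `t j` of length `m` take slots which do not depend on `t`,
neither do the remaining letters. -/
theorem exists_slots_blockWord {α : Type*} {n m : ℕ} (v : List α) (u : List α)
    (G H : Fin n → List α) (hH : ∀ j, H j ≠ []) :
    ∃ (N : ℕ) (a : Fin n → ℕ), (∀ j, u.length ≤ a j) ∧ (∀ j, a j + m ≤ N) ∧
      (∀ i j, i < j → a i + m < a j) ∧
      ∀ t : Fin n → List α, (∀ j, (t j).length = m) →
        (blockWord u v G H t).length = N ∧
        (∀ j b, b < m → (blockWord u v G H t)[a j + b]? = (t j)[b]?) ∧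
        ∀ t' : Fin n → List α, (∀ j, (t' j).length = m) →
          ∀ x, (∀ j, x < a j ∨ a j + m ≤ x) →
            (blockWord u v G H t)[x]? = (blockWord u v G H t')[x]? := by
  induction n generalizing u with
  | zero =>
    refine ⟨(u ++ v).length, Fin.elim0, fun j => j.elim0, fun j => j.elim0, fun j => j.elim0,
      fun t _ => ⟨by simp [blockWord], fun j => j.elim0, fun t' _ x _ => by simp [blockWord]⟩⟩
  | succ n ih =>
    -- The later blocks and `v` form a word of the same kind with empty prefix; its slots are
    -- shifted by the length of the first block and `u`.
    obtain ⟨N, a, -, ha, hlt, hW⟩ := ih [] (fun j => G j.succ) (fun j => H j.succ)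
      fun j => hH j.succ
    have hsucc : ∀ t : Fin (n + 1) → List α, blockWord u v G H t = (u ++ G 0) ++ (t 0 ++ (H 0 ++
        blockWord [] v (fun j => G j.succ) (fun j => H j.succ) fun j => t j.succ)) := by
      intro t
      simp [blockWord, List.ofFn_succ]
    have hH0 : 0 < (H 0).length := List.length_pos_iff.2 (hH 0)
    refine ⟨(u ++ G 0).length + (m + ((H 0).length + N)),
      Fin.cons (u ++ G 0).length fun j => (u ++ G 0).length + (m + ((H 0).length + a j)),
      ?_, ?_, ?_, fun t ht => ⟨?_, ?_, fun t' ht' x hx => ?_⟩⟩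
    · intro j
      refine Fin.cases ?_ (fun j => ?_) j
      · simp
      · simp; omega
    · intro j
      refine Fin.cases ?_ (fun j => ?_) j
      · simp only [Fin.cons_zero]; omega
      · have := ha j
        simp only [Fin.cons_succ]; omega
    · intro i j hij
      induction j using Fin.cases with
      | zero => exact absurd hij (Fin.not_lt_zero i)
      | succ j =>
        induction i using Fin.cases with
        | zero => simp only [Fin.cons_succ, Fin.cons_zero]; omega
        | succ i =>
          have := hlt i j (Fin.succ_lt_succ_iff.1 hij)
          simp only [Fin.cons_succ]; omega
    · have := (hW (fun j => t j.succ) fun j => ht j.succ).1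
      rw [hsucc, List.length_append, List.length_append (as := t 0), List.length_append (as := H 0),
        ht 0, this]
    · intro j b hb
      rw [hsucc]
      induction j using Fin.cases with
      | zero =>
        simp only [Fin.cons_zero]
        rw [List.getElem?_append_right (by omega), Nat.add_sub_cancel_left,
          List.getElem?_append_left (by rw [ht]; exact hb)]
      | succ j =>
        simp only [Fin.cons_succ]
        have := (hW (fun j => t j.succ) fun j => ht j.succ).2.1 j b hb
        rw [List.getElem?_append_right (by omega), List.getElem?_append_right (by rw [ht]; omega),
          List.getElem?_append_right (by rw [ht]; omega), ← this, ht]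
        congr 1
        omega
    · have h0 := hx 0
      simp only [Fin.cons_zero] at h0
      rcases h0 with h0 | h0
      · rw [hsucc, hsucc, List.getElem?_append_left h0, List.getElem?_append_left h0]
      · have hdrop : ∀ t : Fin (n + 1) → List α, (∀ j, (t j).length = m) →
            (blockWord u v G H t)[x]? = (H 0 ++ blockWord [] v (fun j => G j.succ)
              (fun j => H j.succ) fun j => t j.succ)[x - (u ++ G 0).length - m]? := by
          intro t ht
          rw [hsucc, List.getElem?_append_right (by omega),
            List.getElem?_append_right (by rw [ht]; omega), ht]
        rw [hdrop t ht, hdrop t' ht']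
        rcases lt_or_ge (x - (u ++ G 0).length - m) (H 0).length with h1 | h1
        · rw [List.getElem?_append_left h1, List.getElem?_append_left h1]
        · rw [List.getElem?_append_right h1, List.getElem?_append_right h1]
          refine (hW (fun j => t j.succ) fun j => ht j.succ).2.2 _ (fun j => ht' j.succ) _
            fun j => ?_
          have := hx j.succ
          simp only [Fin.cons_succ] at this
          omega

theorem twinOfWord_blockWord {k n : ℕ} (u v : List (Fin (k - 1)))
    (G H t : Fin n → List (Fin (k - 1))) : twinOfWord (blockWord u v G H t) =
      twinOfWord u * (List.ofFn fun j => twinOfWord (G j ++ t j ++ H j)).prod * twinOfWord v := by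
  rw [blockWord, twinOfWord_append, twinOfWord_append]
  congr 2
  induction n with
  | zero => simp [twinOfWord]
  | succ n ih =>
    rw [List.ofFn_succ, List.ofFn_succ, List.flatten_cons, List.prod_cons, twinOfWord_append, ih]

section Triangles

variable {k n : ℕ} {φ : PlaneDiffeo} {E : Set (ℝ × ℝ)}

/-- The alternating sums of an invariant of finite order over fillings by words vanish, if the words
differ in disjoint triangles. -/
theorem alternatingSum_blockWord {A : Type*} [AddCommGroup A] {f : Rondle → A}
    (hE : Disjoint E (φ '' twinBox k)) (hf : AlternatingSumVanishes f n)
    (u v : List (Fin (k - 1))) (G H : Fin n → List (Fin (k - 1))) (hH : ∀ j, H j ≠ [])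
    (o : Fin n → ℕ) (ho : ∀ j, o j + 3 ≤ k) (b : Fin n → Bool) (D : Finset (Fin n) → LinkProjection)
    (hD : ∀ s, (D s).1 = E ∪ φ '' wordPic k (blockWord u v G H fun j =>
      shiftWord (o j) (ho j) (triangleWord (if j ∈ s then !(b j) else b j)))) :
    ∑ s : Finset (Fin n), (-1 : ℤ) ^ s.card • f (D s).toRondle = 0 := by
  rcases Nat.eq_zero_or_pos n with rfl | hn
  · refine hf ⟨Fin.elim0, Fin.elim0, (D ∅).1, fun j => j.elim0, fun j => j.elim0⟩ D fun s => ?_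
    rw [Subsingleton.elim s ∅, TriangleSystem.modify]
    simp
  obtain ⟨N, a, -, ha, hlt, hW⟩ := exists_slots_blockWord (m := 3) v u G H hH
  let t : Finset (Fin n) → Fin n → List (Fin (k - 1)) := fun s j =>
    shiftWord (o j) (ho j) (triangleWord (if j ∈ s then !(b j) else b j))
  have ht : ∀ s j, (t s j).length = 3 := fun s j => by
    simp only [t, shiftWord, List.length_map, length_triangleWord]
  have hN : 0 < N := by have := ha ⟨0, hn⟩; omega
  let W : Finset (Fin n) → List (Fin (k - 1)) := fun s => blockWord u v G H (t s)
  have hlen : ∀ s, (W s).length = N := fun s => (hW (t s) (ht s)).1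
  have h3 : 0 < 3 := by norm_num
  have hpos : ∀ s, 0 < (W s).length := fun s => by rw [hlen]; exact hN
  have ha' : ∀ s j, a j + 3 ≤ (W s).length := fun s j => by rw [hlen]; exact ha j
  have hdisj : ∀ i j, i ≠ j → a i + 3 < a j ∨ a j + 3 < a i := by
    intro i j hij
    rcases lt_or_gt_of_ne hij with h | h
    · exact Or.inl (hlt i j h)
    · exact Or.inr (hlt j i h)
  -- All words have the same length, so the boxes and the crossings outside them do not depend on
  -- `s`. Only the triangles change.
  have hbox : ∀ s, slotBox h3 (hpos s) o a = slotBox h3 (hpos ∅) o a := by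
    intro s
    ext1 j
    simp only [slotBox, hlen]
  have hout : ∀ s, outerCrossings (W s) a 3 = outerCrossings (W ∅) a 3 := by
    intro s
    ext c
    refine exists_congr fun x => exists_congr fun i => and_congr_right fun hx => ?_
    rw [(hW (t s) (ht s)).2.2 (t ∅) (ht ∅) x hx, hlen s, hlen ∅]
  have hpic : ∀ s, wordPic k (W s) = (crossPic k (outerCrossings (W ∅) a 3) \
      ⋃ j, slotBox h3 (hpos ∅) o a j '' twinBox 3) ∪ ⋃ j, slotBox h3 (hpos ∅) o a j ''
        wordPic 3 (triangleWord (if j ∈ s then !(b j) else b j)) := by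
    intro s
    rw [wordPic_eq_crossPic, wordCrossings_eq_union h3 (hpos s) o a
      (sub := fun j => triangleWord (if j ∈ s then !(b j) else b j))
      (fun j => length_triangleWord _),
      crossPic_outerCrossings_union h3 (hpos s) o a ho (ha' s) (fun i j hij => ?_)
      (sub := fun j => triangleWord (if j ∈ s then !(b j) else b j))
      (fun j => Or.inl (length_triangleWord _)), hout, hbox]
    · rcases hdisj i j hij with h | h
      · exact Or.inl h.le
      · exact Or.inr h.le
    · intro j c i hi
      have hc := (List.getElem?_eq_some_iff.1 hi).1
      rw [length_triangleWord] at hc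
      refine ⟨⟨i + o j, by have := ho j; omega⟩, ?_, rfl⟩
      simp only [W]
      rw [(hW (t s) (ht s)).2.1 j c hc]
      simp only [t, shiftWord, List.getElem?_map, hi, Option.map_some]
  -- The fixed part consists of the outer tangle and of the common picture outside the boxes.
  let S : TriangleSystem n :=
    { disc := fun j => (slotBox h3 (hpos ∅) o a j).trans φ
      sign := b
      outer := E ∪ φ '' (crossPic k (outerCrossings (W ∅) a 3) \
        ⋃ j, slotBox h3 (hpos ∅) o a j '' twinBox 3)
      outer_disjoint := by
        intro j
        rw [PlaneDiffeo.image_trans, Set.disjoint_union_left]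
        refine ⟨hE.mono_right (Set.image_mono (slotBox_subset h3 (hpos ∅) o a ho (ha' ∅) j)), ?_⟩
        refine (Set.disjoint_image_iff φ.injective).2 (Set.disjoint_sdiff_left.mono_right ?_)
        exact Set.subset_iUnion (fun j => slotBox h3 (hpos ∅) o a j '' twinBox 3) j
      disc_disjoint := by
        intro i j hij
        rw [PlaneDiffeo.image_trans, PlaneDiffeo.image_trans]
        exact (Set.disjoint_image_iff φ.injective).2
          (slotBox_disjoint h3 (hpos ∅) o a (hdisj i j hij)) }
  refine hf S D fun s => ?_
  have hs : (D s).1 = E ∪ φ '' wordPic k (W s) := hD s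
  rw [hs, hpic, Set.image_union, Set.image_iUnion, ← Set.union_assoc, TriangleSystem.modify]
  congr 1
  refine Set.iUnion_congr fun j => ?_
  exact (PlaneDiffeo.image_trans _ _ _).symm

end Triangles

/-! ### The main theorem -/

theorem theorem1p1 {A : Type*} [AddCommGroup A] (k n : ℕ) (hn : 1 ≤ n)
    (H : Subgroup (TwinGroup k)) (hH : IsSmallPureTwinGroup H)
    (p : TwinGroup k) (hp : p ∈ H.lowerCentralSeries (n - 1))
    (C C' : Rondle) (hC : DifferBy p C C')
    (f : Rondle → A) (hf : invariantOrder f < n) :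
    f C = f C' := by
  classical
  obtain ⟨S, -, hSpure, hSyb, rfl⟩ := hH
  obtain ⟨T, x, ⟨w, D, rfl, ⟨hE, hD⟩, rfl⟩, ⟨w', D', hw', ⟨-, hD'⟩, rfl⟩⟩ := hC
  obtain ⟨_, ⟨d, rfl, hd⟩, hdn⟩ := sInf_lt_iff.1 hf
  have hdn : d < n := by exact_mod_cast hdn
  have hp : p ∈ (Subgroup.closure S).lowerCentralSeries d :=
    Subgroup.lowerCentralSeries_antitone _ (by omega) hp
  have hpure : Subgroup.closure S ≤ pureTwinGroup k := (Subgroup.closure_le _).2 hSpure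
  -- The value of `f` on the filling by `z`, with the default 0 when no filling by `z` is a link
  -- projection. The choice of word is immaterial because the rondle depends only on the twin.
  let F : TwinGroup k → A := fun z =>
    if h : ∃ D : LinkProjection, ∃ v, twinOfWord v = z ∧ D.1 = T.outer ∪ T.disc '' wordPic k v then
      f h.choose.toRondle else 0
  have hF : ∀ (v : List (Fin (k - 1))) (D : LinkProjection),
      D.1 = T.outer ∪ T.disc '' wordPic k v → F (twinOfWord v) = f D.toRondle := by
    intro v D hD
    have h : ∃ D : LinkProjection, ∃ v', twinOfWord v' = twinOfWord v ∧
      D.1 = T.outer ∪ T.disc '' wordPic k v' := ⟨D, v, rfl, hD⟩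
    simp only [F, dif_pos h]
    obtain ⟨v', hv', hDv'⟩ := h.choose_spec
    rw [toRondle_eq_of_twinOfWord_eq hE hv' hDv' hD]
  have key := eq_of_mem_lowerCentralSeries (S := S) (fun y => F (y * twinOfWord w)) (n := d) ?_ hp
  · simp only [one_mul] at key
    rw [← hF w D hD, ← hF w' D' hD', hw', key]
  · intro h hh s hs
    obtain ⟨u, rfl⟩ := twinOfWord_surjective h
    choose o ho b G K hK hGp hG1 using fun i => (hSyb (s i) (hs i)).exists_words
    have hword : ∀ e : Finset (Fin (d + 1)), twinOfWord (blockWord u w G K fun j =>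
        shiftWord (o j) (ho j) (triangleWord (if j ∈ e then !(b j) else b j))) =
        twinOfWord u * (List.ofFn fun i => if i ∈ e then s i else 1).prod * twinOfWord w := by
      intro e
      rw [twinOfWord_blockWord]
      congr 4
      ext1 j
      by_cases hj : j ∈ e
      · simp only [if_pos hj, hGp]
      · simp only [if_neg hj, hG1]
    have hprod : ∀ e : Finset (Fin (d + 1)),
        (List.ofFn fun i => if i ∈ e then s i else 1).prod ∈ pureTwinGroup k := by
      intro e
      refine Subgroup.list_prod_mem _ fun y hy => ?_
      obtain ⟨i, rfl⟩ := List.mem_ofFn.1 hy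
      split_ifs
      · exact hSpure (hs i)
      · exact one_mem _
    -- The block word has the permutation of `w`, as the factors before it are pure; hence all
    -- fillings are link projections and `F` never takes its default value here.
    have hlp : ∀ e : Finset (Fin (d + 1)), IsLinkProjection (T.outer ∪ T.disc '' wordPic k
        (blockWord u w G K fun j => shiftWord (o j) (ho j)
          (triangleWord (if j ∈ e then !(b j) else b j)))) := by
      intro e
      have hlp : IsLinkProjection (T.outer ∪ T.disc '' wordPic k w) := hD ▸ D.2
      refine hlp.replace_word hE ?_
      rw [hword, map_mul, map_mul, MonoidHom.mem_ker.1 (hpure hh), MonoidHom.mem_ker.1 (hprod e),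
        one_mul, one_mul]
    have hsum := alternatingSum_blockWord hE hd u w G K hK o ho b (fun e => ⟨_, hlp e⟩)
      fun e => rfl
    rw [← hsum]
    refine Finset.sum_congr rfl fun e _ => ?_
    rw [← hword e, hF _ ⟨_, hlp e⟩ rfl]
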